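/- **Definitions.** A *graph* (Serre) has vertices and edges, origin and terminus maps $o,t$, and a fixed-point-free involution $e\mapsto e^{-1}$ exchanging $o$ and $t$. A *graph of groups* $\mathbb A$ on a graph $A$ has vertex groups $A_v$, edge groups $A_e=A_{e^{-1}}$ and monomorphisms $\alpha_e:A_e\to A_{o(e)}$, $\omega_e:A_e\to A_{t(e)}$ with $\alpha_{e^{-1}}=\omega_e$. An *$\mathbb A$-path* $\langle p_0,e_1,p_1,\dots,e_n,p_n\rangle$ of length $n$ is an edge path with elements $p_0\in A_{o(e_1)}$ and $p_i\in A_{t(e_i)}$ (for $n=0$, a single element $p_0$ of a vertex group). An *elementary reduction* replaces a subpath $\langle a,e,\omega_e(c),e^{-1},b\rangle$ by $\langle a\,\alpha_e(c)\,b\rangle$; a path is *reduced* if none applies; $\overline p$ is the class of $p$ under the equivalence generated by elementary reductions. $\pi_1(\mathbb A,v_0)$ is the group of classes of loops at $v_0$. An *$\mathbb A$-graph* $\mathbb B$ is a graph $B$ with a graph morphism $[\cdot]:B\to A$, subgroups $B_u\le A_{[u]}$, and elements $f_\alpha\in A_{[o(f)]}$, $f_\omega\in A_{[t(f)]}$ with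 $(f^{-1})_\alpha=(f_\omega)^{-1}$. It is itself a graph of groups, with vertex groups $B_u$, edge groups $$B_f=\alpha_{[f]}^{-1}(f_\alpha^{-1}B_{o(f)}f_\alpha)\cap\omega_{[f]}^{-1}(f_\omega B_{t(f)}f_\omega^{-1}),$$ $\alpha_f(g)=f_\alpha\alpha_{[f]}(g)f_\alpha^{-1}$ and $\omega_f(g)=f_\omega^{-1}\omega_{[f]}(g)f_\omega$. For a $\mathbb B$-path $q=\langle q_0,f_1,q_1,\dots,f_m,q_m\rangle$ put $\mu(q)=\langle q_0(f_1)_\alpha,[f_1],(f_1)_\omega q_1(f_2)_\alpha,\dots,[f_m],(f_m)_\omega q_m\rangle$, and let $\overline{L(\mathbb B,u,u')}=\{\overline{\mu(q)} : q \text{ a reduced } \mathbb B\text{-path from } u \text{ to } u'\}$. $\mathbb B$ is *folded* if - there are no edges $f_1,f_2$ with $t(f_1)=o(f_2)=u$, $f_1\ne f_2^{-1}$ and $[f_1]=[f_2^{-1}]=e$ such that $(f_1)_\omega\, b\,(f_2)_\alpha=\omega_e(c)$ for some $b\in B_u$, $c\in A_e$; and - $\alpha_{[f]}^{-1}(f_\alpha^{-1}B_{o(f)}f_\alpha)=\omega_{[f]}^{-1}(f_\omega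 B_{t(f)}f_\omega^{-1})$ for every edge $f$. Let $\mathbb A$ be a finite connected graph of finitely generated groups, with fixed finite generating lists of all vertex and edge groups; group elements are given to and returned by algorithms as words in these generators, and algorithms are computable functions. $\mathbb A$ is *benign* if 1. for each edge $e$ with $o(e)=v$, there is an algorithm that, given a finite $X\subset A_v$ and $a\in A_v$, decides whether $\langle X\rangle\cap a\,\alpha_e(A_e)$ is empty and, if not, produces an element of it in the form $a\,\alpha_e(c)$, by giving $c\in A_e$; 2. every subgroup of every edge group is finitely generated; 3. every edge group has decidable uniform membership problem (given finite $X\subset A_e$ and $a\in A_e$, decide whether $a\in\langle X\rangle$); 4. for each edge $e$ with $o(e)=v$, there is an algorithm that, given a finite $X\subset A_v$, computes a finite generating set (as words in the generators of $A_v$) of $\langle X\rangle\cap\alpha_e(A_e)$. **Theorem.** Let $\mathbb A$ be a benign graph of groups, $v_0$ a vertex and $G=\pi_1(\mathbb A,v_0)$. There is an algorithm that, given a finite list of $\mathbb A$-loops at $v_0$ generating a subgroup $H\le G$, and an $\mathbb A$-loop at $v_0$ representing $x\in G$, produces - an element $y\in A_{v_0}$ (an element of $G$ of path length $0$) with $yH=xH$,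 if such a $y$ exists, and - otherwise a finite folded $\mathbb A$-graph $\mathbb B^{(x)}$, with its vertex groups given by finite generating sets, with vertices $u_x,u_0$ of type $v_0$ such that $\overline{L(\mathbb B^{(x)},u_x,u_0)}=xH$. Likewise for right cosets: there is an algorithm that, given the same data, produces $y\in A_{v_0}$ with $Hy=Hx$ if such a $y$ exists, and otherwise a finite folded $\mathbb A$-graph, in the same form, with vertices $u_x,u_0$ of type $v_0$ such that $\overline{L(\mathbb B^{(x)},u_0,u_x)}=Hx$. -/

import Mathlib

open scoped Pointwise

universe u v w

set_option linter.checkUnivs false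

/-! ## Graphs and graphs of groups -/

/-- A graph in the sense of Serre. The type `E a b` is the set of edges with origin `a` and
terminus `b`; the involution exchanges origin and terminus and has no fixed point. -/
structure SerreGraph where
  V : Type u
  E : V → V → Type u
  inv : ∀ {a b : V}, E a b → E b a
  inv_inv : ∀ {a b : V} (e : E a b), inv (inv e) = e
  inv_ne : ∀ {a : V} (e : E a a), inv e ≠ e

namespace SerreGraph

/-- The set of all edges of a graph. -/
abbrev Edge (Γ : SerreGraph.{u}) : Type u := Σ a b : Γ.V, Γ.E a b

/-- Nonempty, and any two vertices are joined by an edge path. -/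
def Connected (Γ : SerreGraph.{u}) : Prop :=
  Nonempty Γ.V ∧ ∀ a b : Γ.V, Relation.ReflTransGen (fun c d => Nonempty (Γ.E c d)) a b

end SerreGraph

/-- A graph of groups on the graph `Γ`. The edge groups of an edge and of its inverse
are identified by an isomorphism that exchanges the two monomorphisms. -/
structure GraphOfGroups (Γ : SerreGraph.{u}) where
  GV : Γ.V → Type v
  [groupV : ∀ a, Group (GV a)]
  GE : ∀ {a b : Γ.V}, Γ.E a b → Type w
  [groupE : ∀ {a b : Γ.V} (e : Γ.E a b), Group (GE e)]
  α : ∀ {a b : Γ.V} (e : Γ.E a b), GE e →* GV a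
  ω : ∀ {a b : Γ.V} (e : Γ.E a b), GE e →* GV b
  α_injective : ∀ {a b : Γ.V} (e : Γ.E a b), Function.Injective (α e)
  ω_injective : ∀ {a b : Γ.V} (e : Γ.E a b), Function.Injective (ω e)
  inv_edge : ∀ {a b : Γ.V} (e : Γ.E a b), ∃ φ : GE e ≃* GE (Γ.inv e),
    ∀ c, α (Γ.inv e) (φ c) = ω e c ∧ ω (Γ.inv e) (φ c) = α e c

attribute [instance] GraphOfGroups.groupV GraphOfGroups.groupE

namespace GraphOfGroups

variable {Γ : SerreGraph.{u}} (A : GraphOfGroups.{u, v, w} Γ)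

/-- Paths `⟨p₀, e₁, p₁, …, eₙ, pₙ⟩` in a graph of groups. -/
inductive Path : Γ.V → Γ.V → Type (max u v)
  | single {a : Γ.V} (g : A.GV a) : Path a a
  | cons {a b c : Γ.V} (g : A.GV a) (e : Γ.E a b) (p : Path b c) : Path a c

namespace Path

variable {A}

/-- Concatenation of paths. -/
def comp {c : Γ.V} : ∀ {a b : Γ.V}, A.Path a b → A.Path b c → A.Path a c
  | _, _, single g, single h => single (g * h)
  | _, _, single g, cons h e p => cons (g * h) e p
  | _, _, cons g e p, q => cons g e (p.comp q)

/-- The inverse path. -/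
def symm : ∀ {a b : Γ.V}, A.Path a b → A.Path b a
  | _, _, single g => single g⁻¹
  | _, _, cons g e p => p.symm.comp (cons 1 (Γ.inv e) (single g⁻¹))

/-- `Red p q`: the path `q` is obtained from `p` by one elementary reduction, which replaces a
subpath `⟨g, e, ω_e(c), e⁻¹, h⟩` by `⟨g α_e(c) h⟩`. -/
inductive Red : ∀ {a b : Γ.V}, A.Path a b → A.Path a b → Prop
  | head {a b d : Γ.V} (g : A.GV a) (e : Γ.E a b) (c : A.GE e) (p : A.Path a d) :
      Red (cons g e (cons (A.ω e c) (Γ.inv e) p)) ((single (g * A.α e c)).comp p)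
  | tail {a b d : Γ.V} (g : A.GV a) (e : Γ.E a b) {p q : A.Path b d} :
      Red p q → Red (cons g e p) (cons g e q)

/-- No elementary reduction is applicable. -/
def IsReduced {a b : Γ.V} (p : A.Path a b) : Prop := ∀ q, ¬ Red p q

/-- The equivalence relation generated by elementary reductions. -/
def Equiv {a b : Γ.V} (p q : A.Path a b) : Prop := Relation.EqvGen Red p q

theorem comp_assoc {a b c d : Γ.V} (p : A.Path a b) (q : A.Path b c) (r : A.Path c d) :
    (p.comp q).comp r = p.comp (q.comp r) := by
  induction p with
  | single g => cases q <;> cases r <;> simp [comp, mul_assoc]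
  | cons g e p ih => simp [comp, ih]

theorem one_comp {a b : Γ.V} (p : A.Path a b) : (single 1).comp p = p := by
  cases p <;> simp [comp]

theorem comp_one {a b : Γ.V} (p : A.Path a b) : p.comp (single 1) = p := by
  induction p with
  | single g => simp [comp]
  | cons g e p ih => simp [comp, ih]

theorem Red.comp_right {a b c : Γ.V} {p p' : A.Path a b} (h : Red p p') (q : A.Path b c) :
    Red (p.comp q) (p'.comp q) := by
  induction h with
  | head g e k p => rw [comp_assoc]; exact Red.head g e k (p.comp q)
  | tail g e _ ih => exact Red.tail g e (ih q)

theorem Red.comp_left {a b c : Γ.V} (p : A.Path a b) {q q' : A.Path b c} (h : Red q q') :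
    Red (p.comp q) (p.comp q') := by
  induction p with
  | single g =>
    cases h with
    | head k e d r =>
      rw [← comp_assoc]
      simpa [comp, mul_assoc] using Red.head (g * k) e d r
    | tail k e h => exact Red.tail (g * k) e h
  | cons g e p ih => exact Red.tail g e (ih h)

theorem Equiv.comp {a b c : Γ.V} {p p' : A.Path a b} {q q' : A.Path b c}
    (h : p.Equiv p') (k : q.Equiv q') : (p.comp q).Equiv (p'.comp q') := by
  have h1 : ∀ r : A.Path b c, (p.comp r).Equiv (p'.comp r) := fun r => by
    induction h with
    | rel _ _ h => exact .rel _ _ (h.comp_right r)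
    | refl => exact .refl _
    | symm _ _ _ ih => exact .symm _ _ ih
    | trans _ _ _ _ _ ih ih' => exact .trans _ _ _ ih ih'
  have h2 : ∀ r : A.Path a b, (r.comp q).Equiv (r.comp q') := fun r => by
    induction k with
    | rel _ _ h => exact .rel _ _ (Red.comp_left r h)
    | refl => exact .refl _
    | symm _ _ _ ih => exact .symm _ _ ih
    | trans _ _ _ _ _ ih ih' => exact .trans _ _ _ ih ih'
  exact .trans _ _ _ (h1 q) (h2 p')

theorem backtrack {a b d : Γ.V} (g : A.GV a) (e : Γ.E a b) (e' : Γ.E b a) (he : e' = Γ.inv e)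
    (p : A.Path a d) : (cons g e (cons 1 e' p)).Equiv ((single g).comp p) := by
  subst he
  have := Red.head g e 1 p
  rw [map_one, map_one, mul_one] at this
  exact .rel _ _ this

theorem symm_comp {a b : Γ.V} (p : A.Path a b) : (p.symm.comp p).Equiv (single 1) := by
  induction p with
  | single g => simp only [symm, comp, inv_mul_cancel]; exact .refl _
  | cons g e p ih =>
    simp only [symm, comp_assoc, comp, inv_mul_cancel]
    refine .trans _ _ _ (Equiv.comp (.refl p.symm)
      (backtrack 1 (Γ.inv e) e (Γ.inv_inv e).symm p)) ?_
    rw [one_comp]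
    exact ih

theorem comp_symm {a b : Γ.V} (p : A.Path a b) : (p.comp p.symm).Equiv (single 1) := by
  induction p with
  | single g => simp only [symm, comp, mul_inv_cancel]; exact .refl _
  | @cons a b c g e p ih =>
    have h1 : ((cons g e p).comp (cons g e p).symm) =
        (cons g e (single 1)).comp ((p.comp p.symm).comp
          (cons 1 (Γ.inv e) (single g⁻¹))) := by
      simp only [symm, comp, comp_assoc, one_comp]
    rw [h1]
    refine .trans _ _ _ (Equiv.comp (.refl _) (Equiv.comp ih (.refl _))) ?_
    simp only [comp, one_mul]
    refine .trans _ _ _ (backtrack g e (Γ.inv e) rfl _) ?_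
    simp only [comp, mul_inv_cancel]
    exact .refl _

theorem Equiv.symm_congr {a b : Γ.V} {p q : A.Path a b} (h : p.Equiv q) :
    p.symm.Equiv q.symm := by
  have h1 : (p.symm.comp (q.comp q.symm)).Equiv p.symm := by
    simpa only [comp_one] using Equiv.comp (.refl p.symm) (comp_symm q)
  have h2 : ((p.symm.comp p).comp q.symm).Equiv q.symm := by
    simpa only [one_comp] using Equiv.comp (symm_comp p) (.refl q.symm)
  rw [comp_assoc] at h2
  exact .trans _ _ _ (.symm _ _ h1) (.trans _ _ _
    (Equiv.comp (.refl p.symm) (Equiv.comp (.symm _ _ h) (.refl q.symm))) h2)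

end Path

/-- Equivalence of paths from `a` to `b`. -/
def pathSetoid (a b : Γ.V) : Setoid (A.Path a b) where
  r := Path.Equiv
  iseqv := Relation.EqvGen.is_equivalence _

/-- Equivalence classes of paths from `a` to `b`. -/
def PathClass (a b : Γ.V) : Type (max u v) := Quotient (A.pathSetoid a b)

variable {A} in
/-- The equivalence class of a path. -/
def Path.cls {a b : Γ.V} (p : A.Path a b) : A.PathClass a b := Quotient.mk (A.pathSetoid a b) p

variable {A} in
/-- Transport of a class along equalities of its endpoints. -/
def PathClass.cast {a a' b b' : Γ.V} (ha : a = a') (hb : b = b') (g : A.PathClass a b) :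
    A.PathClass a' b' := ha ▸ hb ▸ g

/-- The fundamental group of a graph of groups at the vertex `a`: the set of
classes of loops, under concatenation. -/
abbrev π₁ (a : Γ.V) : Type (max u v) := A.PathClass a a

instance (a : Γ.V) : Group (A.π₁ a) where
  mul := Quotient.map₂ Path.comp fun _ _ h _ _ k => Path.Equiv.comp h k
  one := (Path.single (1 : A.GV a)).cls
  inv := Quotient.map Path.symm fun _ _ h => Path.Equiv.symm_congr h
  mul_assoc x y z := by
    induction x using Quotient.inductionOn with | _ x
    induction y using Quotient.inductionOn with | _ y
    induction z using Quotient.inductionOn with | _ z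
    exact congrArg (Quotient.mk _) (Path.comp_assoc x y z)
  one_mul x := by
    induction x using Quotient.inductionOn with | _ x
    exact congrArg (Quotient.mk _) (Path.one_comp x)
  mul_one x := by
    induction x using Quotient.inductionOn with | _ x
    exact congrArg (Quotient.mk _) (Path.comp_one x)
  inv_mul_cancel x := by
    induction x using Quotient.inductionOn with | _ x
    exact Quotient.sound (s := A.pathSetoid a a) (Path.symm_comp x)

end GraphOfGroups

/-! ## `A`-graphs -/

/-- An `A`-graph: a graph `B` with a graph morphism to the graph of `A`, a subgroup of the
vertex group of `A` for each vertex of `B`, and two elements `lα f`, `lω f` for each edge `f`. -/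
structure AGraph {Γ : SerreGraph.{u}} (A : GraphOfGroups.{u, v, w} Γ) where
  B : SerreGraph.{0}
  typ : B.V → Γ.V
  etyp : ∀ {a b : B.V}, B.E a b → Γ.E (typ a) (typ b)
  etyp_inv : ∀ {a b : B.V} (f : B.E a b), etyp (B.inv f) = Γ.inv (etyp f)
  grp : ∀ a : B.V, Subgroup (A.GV (typ a))
  lα : ∀ {a b : B.V}, B.E a b → A.GV (typ a)
  lω : ∀ {a b : B.V}, B.E a b → A.GV (typ b)
  lα_inv : ∀ {a b : B.V} (f : B.E a b), lα (B.inv f) = (lω f)⁻¹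

namespace AGraph

variable {Γ : SerreGraph.{u}} {A : GraphOfGroups.{u, v, w} Γ} (𝔹 : AGraph A)

/-- `α_[f]⁻¹(f_α⁻¹ B_{o(f)} f_α)` -/
def preα {a b : 𝔹.B.V} (f : 𝔹.B.E a b) : Subgroup (A.GE (𝔹.etyp f)) :=
  (𝔹.grp a).comap ((MulAut.conj (𝔹.lα f)).toMonoidHom.comp (A.α (𝔹.etyp f)))

/-- `ω_[f]⁻¹(f_ω B_{t(f)} f_ω⁻¹)` -/
def preω {a b : 𝔹.B.V} (f : 𝔹.B.E a b) : Subgroup (A.GE (𝔹.etyp f)) :=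
  (𝔹.grp b).comap ((MulAut.conj (𝔹.lω f)⁻¹).toMonoidHom.comp (A.ω (𝔹.etyp f)))

/-- The edge group `B_f`. -/
def edgeGrp {a b : 𝔹.B.V} (f : 𝔹.B.E a b) : Subgroup (A.GE (𝔹.etyp f)) := 𝔹.preα f ⊓ 𝔹.preω f

theorem mem_preα {a b : 𝔹.B.V} (f : 𝔹.B.E a b) (c : A.GE (𝔹.etyp f)) :
    c ∈ 𝔹.preα f ↔ 𝔹.lα f * A.α (𝔹.etyp f) c * (𝔹.lα f)⁻¹ ∈ 𝔹.grp a := by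
  simp [preα, Subgroup.mem_comap]

theorem mem_preω {a b : 𝔹.B.V} (f : 𝔹.B.E a b) (c : A.GE (𝔹.etyp f)) :
    c ∈ 𝔹.preω f ↔ (𝔹.lω f)⁻¹ * A.ω (𝔹.etyp f) c * 𝔹.lω f ∈ 𝔹.grp b := by
  simp [preω, Subgroup.mem_comap]

theorem lω_inv {a b : 𝔹.B.V} (f : 𝔹.B.E a b) : 𝔹.lω (𝔹.B.inv f) = (𝔹.lα f)⁻¹ := by
  have := 𝔹.lα_inv (𝔹.B.inv f)
  rw [𝔹.B.inv_inv] at this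
  rw [this, inv_inv]

/-- `α_f(c) = f_α α_[f](c) f_α⁻¹` -/
def edgeα {a b : 𝔹.B.V} (f : 𝔹.B.E a b) : 𝔹.edgeGrp f →* 𝔹.grp a :=
  (((MulAut.conj (𝔹.lα f)).toMonoidHom.comp (A.α (𝔹.etyp f))).comp
    (𝔹.edgeGrp f).subtype).codRestrict (𝔹.grp a) fun c => c.2.1

/-- `ω_f(c) = f_ω⁻¹ ω_[f](c) f_ω` -/
def edgeω {a b : 𝔹.B.V} (f : 𝔹.B.E a b) : 𝔹.edgeGrp f →* 𝔹.grp b :=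
  (((MulAut.conj (𝔹.lω f)⁻¹).toMonoidHom.comp (A.ω (𝔹.etyp f))).comp
    (𝔹.edgeGrp f).subtype).codRestrict (𝔹.grp b) fun c => c.2.2

theorem edgeα_coe {a b : 𝔹.B.V} (f : 𝔹.B.E a b) (c : 𝔹.edgeGrp f) :
    (𝔹.edgeα f c : A.GV (𝔹.typ a)) = 𝔹.lα f * A.α (𝔹.etyp f) c * (𝔹.lα f)⁻¹ := rfl

theorem edgeω_coe {a b : 𝔹.B.V} (f : 𝔹.B.E a b) (c : 𝔹.edgeGrp f) :
    (𝔹.edgeω f c : A.GV (𝔹.typ b)) = (𝔹.lω f)⁻¹ * A.ω (𝔹.etyp f) c * 𝔹.lω f := by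
  simp [edgeω]

/-- The graph of groups defined by an `A`-graph. -/
def toGraphOfGroups : GraphOfGroups.{0, v, w} 𝔹.B where
  GV a := 𝔹.grp a
  GE f := 𝔹.edgeGrp f
  α := 𝔹.edgeα
  ω := 𝔹.edgeω
  α_injective f := by
    intro c d h
    have h' := congrArg Subtype.val h
    rw [edgeα_coe, edgeα_coe] at h'
    exact Subtype.ext (A.α_injective _ (by simpa using h'))
  ω_injective f := by
    intro c d h
    have h' := congrArg Subtype.val h
    rw [edgeω_coe, edgeω_coe] at h'
    exact Subtype.ext (A.ω_injective _ (by simpa using h'))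
  inv_edge := by
    intro a b f
    obtain ⟨φ, hφ⟩ : ∃ φ : A.GE (𝔹.etyp f) ≃* A.GE (𝔹.etyp (𝔹.B.inv f)),
        ∀ c, A.α (𝔹.etyp (𝔹.B.inv f)) (φ c) = A.ω (𝔹.etyp f) c ∧
          A.ω (𝔹.etyp (𝔹.B.inv f)) (φ c) = A.α (𝔹.etyp f) c := by
      rw [𝔹.etyp_inv]
      exact A.inv_edge _
    have hmem : ∀ c, φ c ∈ 𝔹.edgeGrp (𝔹.B.inv f) ↔ c ∈ 𝔹.edgeGrp f := by
      intro c
      simp only [edgeGrp, Subgroup.mem_inf, mem_preα, mem_preω, (hφ c).1, (hφ c).2,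
        lα_inv, lω_inv, inv_inv]
      exact and_comm
    have hmap : (𝔹.edgeGrp f).map φ.toMonoidHom = 𝔹.edgeGrp (𝔹.B.inv f) := by
      ext d
      obtain ⟨c, rfl⟩ := φ.surjective d
      rw [hmem]
      simp
    have hval : ∀ c : 𝔹.edgeGrp f, (((φ.subgroupMap (𝔹.edgeGrp f)).trans
        (MulEquiv.subgroupCongr hmap) c : 𝔹.edgeGrp (𝔹.B.inv f)) :
          A.GE (𝔹.etyp (𝔹.B.inv f))) = φ c := fun _ => rfl
    refine ⟨(φ.subgroupMap (𝔹.edgeGrp f)).trans (MulEquiv.subgroupCongr hmap), fun c => ⟨?_, ?_⟩⟩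
    · apply Subtype.ext
      rw [edgeα_coe, edgeω_coe, hval, (hφ _).1, lα_inv, inv_inv]
    · apply Subtype.ext
      rw [edgeα_coe, edgeω_coe, hval, (hφ _).2, lω_inv, inv_inv]

/-- The `A`-path `μ(q)` of a path `q` in the graph of groups of `𝔹`. -/
def μ : ∀ {a b : 𝔹.B.V}, 𝔹.toGraphOfGroups.Path a b → A.Path (𝔹.typ a) (𝔹.typ b)
  | _, _, .single g => .single (show 𝔹.grp _ from g).1
  | _, _, .cons g f q =>
      .cons ((show 𝔹.grp _ from g).1 * 𝔹.lα f) (𝔹.etyp f)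
        ((GraphOfGroups.Path.single (𝔹.lω f)).comp (μ q))

/-- The set of classes of the `A`-paths `μ(q)`, for `q` a reduced path from `a` to `b`. -/
def L (a b : 𝔹.B.V) : Set (A.PathClass (𝔹.typ a) (𝔹.typ b)) :=
  {g | ∃ q : 𝔹.toGraphOfGroups.Path a b, q.IsReduced ∧ (𝔹.μ q).cls = g}

/-- `L a b` as a subset of the fundamental group at `v₀`, for vertices `a`, `b` of type `v₀`. -/
def LAt (v₀ : Γ.V) (a b : 𝔹.B.V) (ha : 𝔹.typ a = v₀) (hb : 𝔹.typ b = v₀) : Set (A.π₁ v₀) :=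
  GraphOfGroups.PathClass.cast ha hb '' 𝔹.L a b

/-- Two edges `f₁`, `f₂` with `t(f₁) = o(f₂)`, where `f₁` and `f₂⁻¹` are distinct edges of the same
type `e`, and `(f₁)_ω b (f₂)_α = ω_e(c)` for some `b` in the vertex group and some `c`. -/
def NotFoldedI : Prop :=
  ∃ (a k d : 𝔹.B.V) (f₁ : 𝔹.B.E a k) (f₂ : 𝔹.B.E k d),
    (⟨a, k, f₁⟩ : 𝔹.B.Edge) ≠ ⟨d, k, 𝔹.B.inv f₂⟩ ∧
    (⟨_, _, 𝔹.etyp f₁⟩ : Γ.Edge) = ⟨_, _, 𝔹.etyp (𝔹.B.inv f₂)⟩ ∧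
    ∃ b ∈ 𝔹.grp k, ∃ c : A.GE (𝔹.etyp f₁), 𝔹.lω f₁ * b * 𝔹.lα f₂ = A.ω (𝔹.etyp f₁) c

def NotFoldedII : Prop :=
  ∃ (a b : 𝔹.B.V) (f : 𝔹.B.E a b), 𝔹.preα f ≠ 𝔹.preω f

def IsFolded : Prop := ¬ 𝔹.NotFoldedI ∧ ¬ 𝔹.NotFoldedII

end AGraph

/-! ## Finite descriptions and algorithms

An algorithm is a computable function (`Computable`) between types of finite descriptions. -/

/-- Words in numbered letters and their formal inverses; `(i, true)` is the letter number `i`, and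
`(i, false)` is its inverse. -/
abbrev GWord : Type := List (ℕ × Bool)

/-- The value of a word, for the list `gens` of values of the letters. Letters beyond the list
have value `1`. -/
def GWord.eval {G : Type*} [Group G] (gens : List G) (W : GWord) : G :=
  (W.map fun l => if l.2 then gens.getD l.1 1 else (gens.getD l.1 1)⁻¹).prod

/-- The subgroup generated by the values of finitely many words. -/
def GWord.span {G : Type*} [Group G] (gens : List G) (X : List GWord) : Subgroup G :=
  Subgroup.closure {g | ∃ W ∈ X, GWord.eval gens W = g}

/-- Description of a path `⟨p₀, e₁, p₁, …, eₙ, pₙ⟩`: the word `p₀` and the list of the pairs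
of the number of `eᵢ` and the word `pᵢ`. -/
abbrev PathCode : Type := GWord × List (ℕ × GWord)

/-- Description of a vertex of an `A`-graph: the number of its type, and words that generate its
group. -/
abbrev VertexCode : Type := ℕ × List GWord

/-- Description of an edge `f` of an `A`-graph: the numbers of its origin, its terminus and its
inverse, the number of its type, and words for `f_α` and `f_ω`. -/
abbrev EdgeCode : Type := (ℕ × ℕ × ℕ) × ℕ × GWord × GWord

/-- Description of a finite `A`-graph with two distinguished vertices: the list of its vertices,
the list of its edges, and the numbers of the distinguished vertices. -/
abbrev AGraphCode : Type := List VertexCode × List EdgeCode × ℕ × ℕ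

namespace GraphOfGroups

variable {Γ : SerreGraph.{u}} (A : GraphOfGroups.{u, v, w} Γ)

/-- A graph of groups with finite underlying graph and finitely generated groups: numberings of its
vertices and edges, and finite generating lists of all vertex and edge groups. -/
structure Marking where
  nV : ℕ
  nE : ℕ
  vNum : Γ.V ≃ Fin nV
  eNum : Γ.Edge ≃ Fin nE
  vGens : ∀ a, List (A.GV a)
  eGens : ∀ {a b : Γ.V} (e : Γ.E a b), List (A.GE e)
  vGens_closure : ∀ a, Subgroup.closure {g | g ∈ vGens a} = ⊤
  eGens_closure : ∀ {a b : Γ.V} (e : Γ.E a b), Subgroup.closure {g | g ∈ eGens e} = ⊤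

variable {A}

/-- Benign graphs of groups. -/
structure Benign (M : A.Marking) : Prop where
  connected : Γ.Connected
  /-- Deciding if `⟨X⟩ ∩ g α_e(A_e)` is empty, and producing an element `g α_e(c)` of it if not. -/
  coset : ∀ {a b : Γ.V} (e : Γ.E a b), ∃ F : List GWord × GWord → Option GWord, Computable F ∧
    ∀ (X : List GWord) (g : GWord),
      (F (X, g) = none →
        (GWord.span (M.vGens a) X : Set (A.GV a)) ∩
          (GWord.eval (M.vGens a) g • ((A.α e).range : Set (A.GV a))) = ∅) ∧
      ∀ c, F (X, g) = some c →
        GWord.eval (M.vGens a) g * A.α e (GWord.eval (M.eGens e) c) ∈ GWord.span (M.vGens a) X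
  noetherian : ∀ {a b : Γ.V} (e : Γ.E a b) (K : Subgroup (A.GE e)), K.FG
  edge_membership : ∀ {a b : Γ.V} (e : Γ.E a b), ∃ F : List GWord × GWord → Bool, Computable F ∧
    ∀ (X : List GWord) (g : GWord),
      F (X, g) = true ↔ GWord.eval (M.eGens e) g ∈ GWord.span (M.eGens e) X
  intersection : ∀ {a b : Γ.V} (e : Γ.E a b), ∃ F : List GWord → List GWord, Computable F ∧
    ∀ X : List GWord,
      GWord.span (M.vGens a) (F X) = GWord.span (M.vGens a) X ⊓ (A.α e).range

/-- The path code describes the path. -/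
inductive Marking.Describes (M : A.Marking) : ∀ {a b : Γ.V}, PathCode → A.Path a b → Prop
  | single {a : Γ.V} (W : GWord) :
      Describes M (W, []) (Path.single (GWord.eval (M.vGens a) W))
  | cons {a b c : Γ.V} (W W' : GWord) (e : Γ.E a b) (l : List (ℕ × GWord)) (p : A.Path b c) :
      Describes M (W', l) p →
      Describes M (W, ((M.eNum ⟨a, b, e⟩ : ℕ), W') :: l)
        (Path.cons (GWord.eval (M.vGens a) W) e p)

/-- The path code describes a loop at `v₀` that represents the element `g`. -/
def Marking.DescribesElt (M : A.Marking) {v₀ : Γ.V} (P : PathCode) (g : A.π₁ v₀) : Prop :=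
  ∃ p : A.Path v₀ v₀, M.Describes P p ∧ p.cls = g

/-- The element of the fundamental group given by a path of length 0. -/
def lengthZero (A : GraphOfGroups.{u, v, w} Γ) (v₀ : Γ.V) (y : A.GV v₀) : A.π₁ v₀ :=
  (Path.single y).cls

/-- The code describes the `A`-graph `𝔹` with its distinguished vertices `ux` and `u0`. -/
def Marking.DescribesAGraph (M : A.Marking) (C : AGraphCode) (𝔹 : AGraph A) (ux u0 : 𝔹.B.V) :
    Prop :=
  ∃ (nv : 𝔹.B.V ≃ Fin C.1.length) (ne : 𝔹.B.Edge ≃ Fin C.2.1.length),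
    (∀ a, (C.1.get (nv a)).1 = M.vNum (𝔹.typ a) ∧
      𝔹.grp a = GWord.span (M.vGens (𝔹.typ a)) (C.1.get (nv a)).2) ∧
    (∀ (a b : 𝔹.B.V) (f : 𝔹.B.E a b), ∃ Wα Wω : GWord,
      C.2.1.get (ne ⟨a, b, f⟩) =
        (((nv a : ℕ), (nv b : ℕ), (ne ⟨b, a, 𝔹.B.inv f⟩ : ℕ)),
          (M.eNum ⟨_, _, 𝔹.etyp f⟩ : ℕ), Wα, Wω) ∧
      GWord.eval (M.vGens (𝔹.typ a)) Wα = 𝔹.lα f ∧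
      GWord.eval (M.vGens (𝔹.typ b)) Wω = 𝔹.lω f) ∧
    C.2.2 = ((nv ux : ℕ), (nv u0 : ℕ))

end GraphOfGroups

/-! The algorithm is an unbounded search. A recursively enumerable relation that offers some output
for every input contains a computable function (`RE.exists_computable`), so it suffices to describe
outcomes that can be confirmed in finite time, to show that each is correct, and to show that one
always exists. One outcome is a word for `y` with `y⁻¹ x ∈ H`. The other is a certificate
(`IsCert`): the code of a folded graph and an element `γ u` of `G` for each vertex `u`, such that
conjugation by the labels carries vertex groups and edges into `H`, together with `u_x ≠ u_0` and
paths that represent `x` from `u_x` to `u_0` and each generator of `H` at `u_0`.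

Correctness. The labels force every path from `u_x` to `u_0` to represent an element of `xH`, and
the paths in the certificate give all of `xH`. A certificate also excludes the first outcome: in a
folded graph `μ` preserves reducedness (`IsFolded.isReduced_μ`), and equivalent reduced paths have
equal length (`IsReduced.length_eq`, by confluence modulo slides), so an element of length zero in
`xH` would force `u_x = u_0`.

Confirmation. Conditions 1 and 3 make the word problems of the vertex groups enumerable, hence also
the relations of `G` and equality in `G` (`val_eq_one_iff`). The foldedness conditions are not
visibly existential: condition 1 settles the first (`Benign.re_coset`), conditions 2 and 4 the
second (`Benign.re_comap`).

Existence (`exists_isCert`). Let `H` act on the Bass–Serre tree, whose vertex orbits are double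
cosets of `H` and a vertex group. If no `y` exists, the vertices given by `x⁻¹` and `1` lie in
different orbits. Take the finite part of the quotient graph crossed by `x` and by the generators of
`H`, labelled by orbit representatives. Distinct edges are distinct orbits, which is the first
foldedness condition. Full vertex stabilizers need not be finitely generated; as vertex groups serve
finitely generated subgroups of them that contain the edge stabilizers (finitely generated by
condition 2) and the finitely many elements needed to read the paths. Both preimages in an edge
group are then the edge stabilizer, which is the second condition.

Graphs without edges are treated apart, and right cosets reduce to left cosets by inversion. -/

/-! ## Recursively enumerable predicates -/

/-- A predicate is recursively enumerable if it is the projection of a computable one. -/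
def RE {α : Type*} [Primcodable α] (p : α → Prop) : Prop :=
  ∃ f : α × ℕ → Bool, Computable f ∧ ∀ a, p a ↔ ∃ n, f (a, n) = true

namespace RE

variable {α β γ : Type*} [Primcodable α] [Primcodable β] [Primcodable γ]

theorem of_iff {p q : α → Prop} (hp : RE p) (h : ∀ a, q a ↔ p a) : RE q := by
  obtain ⟨f, hf, hpf⟩ := hp
  exact ⟨f, hf, fun a => (h a).trans (hpf a)⟩

theorem of_bool {f : α → Bool} (hf : Computable f) : RE fun a => f a = true :=
  ⟨fun x => f x.1, hf.comp Computable.fst, fun a => by simp⟩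

theorem comp {p : β → Prop} (hp : RE p) {g : α → β} (hg : Computable g) : RE fun a => p (g a) := by
  obtain ⟨f, hf, hpf⟩ := hp
  exact ⟨fun x => f (g x.1, x.2), hf.comp ((hg.comp Computable.fst).pair Computable.snd),
    fun a => hpf (g a)⟩

theorem const (P : Prop) : RE fun _ : α => P := by
  classical
  exact (of_bool (Computable.const (decide P))).of_iff fun _ => by simp

/-- Comparing codes instead of elements avoids any decidable equality on `β`. -/
theorem computable_decide_eq {f g : α → β} (hf : Computable f) (hg : Computable g) :
    Computable fun a => decide (Encodable.encode (f a) = Encodable.encode (g a)) := by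
  have h : Primrec fun x : ℕ × ℕ => decide (x.1 = x.2) := Primrec.eq.decide
  exact h.to_comp.comp ((Computable.encode.comp hf).pair (Computable.encode.comp hg))

theorem eq {f g : α → β} (hf : Computable f) (hg : Computable g) : RE fun a => f a = g a :=
  (of_bool (computable_decide_eq hf hg)).of_iff fun a => by simp

theorem ne {f g : α → β} (hf : Computable f) (hg : Computable g) : RE fun a => f a ≠ g a :=
  (of_bool (Primrec.not.to_comp.comp (computable_decide_eq hf hg))).of_iff fun a => by simp

theorem lt {f g : α → ℕ} (hf : Computable f) (hg : Computable g) : RE fun a => f a < g a := by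
  have h : Primrec fun x : ℕ × ℕ => decide (x.1 < x.2) := Primrec.nat_lt.decide
  exact (of_bool (h.to_comp.comp (hf.pair hg))).of_iff fun a => by simp

theorem and {p q : α → Prop} (hp : RE p) (hq : RE q) : RE fun a => p a ∧ q a := by
  obtain ⟨f, hf, hpf⟩ := hp
  obtain ⟨g, hg, hqg⟩ := hq
  have hu : Computable fun x : α × ℕ => x.2.unpair := Computable.unpair.comp Computable.snd
  refine ⟨fun x => f (x.1, x.2.unpair.1) && g (x.1, x.2.unpair.2),
    Primrec.and.to_comp.comp (hf.comp (Computable.fst.pair (Computable.fst.comp hu)))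
      (hg.comp (Computable.fst.pair (Computable.snd.comp hu))), fun a => ?_⟩
  simp only [hpf, hqg]
  constructor
  · rintro ⟨⟨m, hm⟩, n, hn⟩
    exact ⟨Nat.pair m n, by simp [hm, hn]⟩
  · rintro ⟨n, hn⟩
    simp only [Bool.and_eq_true] at hn
    exact ⟨⟨_, hn.1⟩, _, hn.2⟩

theorem or {p q : α → Prop} (hp : RE p) (hq : RE q) : RE fun a => p a ∨ q a := by
  obtain ⟨f, hf, hpf⟩ := hp
  obtain ⟨g, hg, hqg⟩ := hq
  refine ⟨fun x => f x || g x, Primrec.or.to_comp.comp hf hg, fun a => ?_⟩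
  simp only [hpf, hqg, ← exists_or, Bool.or_eq_true]

/-- Dovetailing: a single number codes both a candidate witness and the stage at which it is
confirmed. Numbers that decode to no witness count as failures. -/
theorem ex {p : α → β → Prop} (hp : RE fun x : α × β => p x.1 x.2) :
    RE fun a => ∃ b, p a b := by
  obtain ⟨f, hf, hpf⟩ := hp
  have hu : Computable fun x : α × ℕ => x.2.unpair := Computable.unpair.comp Computable.snd
  have hs : Computable fun z : (α × ℕ) × β => f ((z.1.1, z.2), z.1.2.unpair.2) :=
    hf.comp (((Computable.fst.comp Computable.fst).pair Computable.snd).pair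
      (Computable.snd.comp (hu.comp Computable.fst)))
  have hF : Computable fun x : α × ℕ => (Option.casesOn (Encodable.decode (α := β) x.2.unpair.1)
      false fun b => f ((x.1, b), x.2.unpair.2) : Bool) :=
    Computable.option_casesOn (Computable.decode.comp (Computable.fst.comp hu))
      (Computable.const false) hs.to₂
  refine ⟨_, hF, fun a => ?_⟩
  constructor
  · rintro ⟨b, hb⟩
    obtain ⟨n, hn⟩ := (hpf (a, b)).1 hb
    exact ⟨Nat.pair (Encodable.encode b) n, by simp [hn]⟩
  · rintro ⟨n, hn⟩
    rcases h : Encodable.decode (α := β) n.unpair.1 with _ | b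
    · simp [h] at hn
    · simp only [h] at hn
      exact ⟨b, (hpf (a, b)).2 ⟨_, hn⟩⟩

/-- The indices will be vertices and edges of `Γ`, which carry no encoding. A finite disjunction
needs none, nor any uniformity in `i`. -/
theorem ex_finite {ι : Type*} [Finite ι] {p : ι → α → Prop} (hp : ∀ i, RE (p i)) :
    RE fun a => ∃ i, p i a := by
  induction ι using Finite.induction_empty_option with
  | of_equiv e ih =>
    exact (ih fun i => hp (e i)).of_iff fun a => e.surjective.exists
  | h_empty => exact (const False).of_iff fun a => by simp
  | h_option ih =>
    exact ((hp none).or (ih fun i => hp (some i))).of_iff fun a => by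
      rw [Option.exists]

/-- The witness is a list of stages, one for each `k` below the bound; `g` checks them all. The
default stage for short lists is harmless, since any stage that succeeds proves `p`. -/
theorem ball_lt {p : α → ℕ → Prop} {N : α → ℕ} (hN : Computable N)
    (hp : RE fun x : α × ℕ => p x.1 x.2) : RE fun a => ∀ k < N a, p a k := by
  obtain ⟨f, hf, hpf⟩ := hp
  let g : α × List ℕ → ℕ → Bool := fun x N =>
    Nat.rec true (fun k b => b && f ((x.1, k), x.2.getD k 0)) N
  have hg : Computable fun x : α × List ℕ => g x (N x.1) := by
    have hs : Computable fun y : (α × List ℕ) × ℕ × Bool =>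
        y.2.2 && f ((y.1.1, y.2.1), y.1.2.getD y.2.1 0) := by
      refine Primrec.and.to_comp.comp (Computable.snd.comp Computable.snd) (hf.comp ?_)
      refine Computable.pair (Computable.pair (Computable.fst.comp Computable.fst)
        (Computable.fst.comp Computable.snd)) ?_
      exact (Primrec.list_getD 0).to_comp.comp (Computable.snd.comp Computable.fst)
        (Computable.fst.comp Computable.snd)
    exact Computable.nat_rec (hN.comp Computable.fst) (Computable.const true) hs.to₂
  have key : ∀ x n, g x n = true ↔ ∀ k < n, f ((x.1, k), x.2.getD k 0) = true := by
    intro x n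
    induction n with
    | zero => simp [g]
    | succ n ih =>
      have : g x (n + 1) = (g x n && f ((x.1, n), x.2.getD n 0)) := rfl
      rw [this, Bool.and_eq_true, ih, Nat.forall_lt_succ_right]
  refine (ex (p := fun a l => g (a, l) (N a) = true) (of_bool hg)).of_iff fun a => ?_
  constructor
  · intro h
    have h' : ∀ k, ∃ n, k < N a → f ((a, k), n) = true := fun k => by
      by_cases hk : k < N a
      · obtain ⟨n, hn⟩ := (hpf (a, k)).1 (h k hk)
        exact ⟨n, fun _ => hn⟩
      · exact ⟨0, fun h => absurd h hk⟩
    choose w hw using h'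
    refine ⟨(List.range (N a)).map w, (key _ _).2 fun k hk => ?_⟩
    have : ((List.range (N a)).map w).getD k 0 = w k := by
      simp [List.getD, hk]
    rw [this]
    exact hw k hk
  · rintro ⟨l, hl⟩ k hk
    exact (hpf (a, k)).2 ⟨_, (key _ _).1 hl k hk⟩

theorem mem_list {f : α → β} {l : α → List β} (hf : Computable f) (hl : Computable l) :
    RE fun a => f a ∈ l a := by
  refine (ex (p := fun a k => (l a)[k]? = some (f a)) (eq (Computable.list_getElem?.comp
    (hl.comp Computable.fst) Computable.snd) (Computable.option_some.comp
      (hf.comp Computable.fst)))).of_iff fun a => ?_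
  exact List.mem_iff_getElem?

theorem ball_list {p : α → β → Prop} {l : α → List β} (hl : Computable l)
    (hp : RE fun x : α × β => p x.1 x.2) : RE fun a => ∀ b ∈ l a, p a b := by
  have h : RE fun x : α × ℕ => ∃ b, (l x.1)[x.2]? = some b ∧ p x.1 b := by
    have h1 : RE fun y : (α × ℕ) × β => p y.1.1 y.2 :=
      hp.comp (g := fun y : (α × ℕ) × β => (y.1.1, y.2))
        ((Computable.fst.comp Computable.fst).pair Computable.snd)
    exact ex ((eq (Computable.list_getElem?.comp (hl.comp (Computable.fst.comp Computable.fst))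
      (Computable.snd.comp Computable.fst)) (Computable.option_some.comp Computable.snd)).and h1)
  refine (ball_lt (p := fun a k => ∃ b, (l a)[k]? = some b ∧ p a b)
    (Computable.list_length.comp hl) h).of_iff fun a => ?_
  constructor
  · intro H k hk
    exact ⟨(l a)[k], by simp [hk], H _ (List.getElem_mem hk)⟩
  · intro H b hb
    obtain ⟨k, hk, rfl⟩ := List.mem_iff_getElem.1 hb
    obtain ⟨b, hb, hpb⟩ := H k hk
    rw [List.getElem?_eq_getElem hk] at hb
    cases hb
    exact hpb

theorem bex_list {p : α → β → Prop} {l : α → List β} (hl : Computable l)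
    (hp : RE fun x : α × β => p x.1 x.2) : RE fun a => ∃ b ∈ l a, p a b :=
  ex ((mem_list Computable.snd (hl.comp Computable.fst)).and hp)

/-- The fold is an iteration on pairs (state, remaining list), repeated as often as the list is
long. -/
theorem _root_.Computable.list_foldl' {f : α → List β} {g : α → γ} {h : α × γ × β → γ}
    (hf : Computable f) (hg : Computable g) (hh : Computable h) :
    Computable fun a => (f a).foldl (fun s b => h (a, s, b)) (g a) := by
  have H : Computable fun a => (Nat.rec (g a, f a)
      (fun _ x => List.casesOn x.2 x fun b l => (h (a, x.1, b), l)) (f a).length :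
        γ × List β) := by
    have hcase : Computable fun y : α × ℕ × γ × List β =>
        (Option.casesOn (y.2.2.2[0]?) y.2.2 (fun b => (h (y.1, y.2.2.1, b), y.2.2.2.tail)) :
          γ × List β) := by
      have h1 : Computable fun z : (α × ℕ × γ × List β) × β => z.1 := Computable.fst
      have h2 : Computable fun z : (α × ℕ × γ × List β) × β =>
          (h (z.1.1, z.1.2.2.1, z.2), z.1.2.2.2.tail) :=
        Computable.pair (hh.comp (Computable.pair (Computable.fst.comp h1)
          (Computable.pair (Computable.fst.comp (Computable.snd.comp (Computable.snd.comp h1)))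
            Computable.snd))) (Primrec.list_tail.to_comp.comp
              (Computable.snd.comp (Computable.snd.comp (Computable.snd.comp h1))))
      exact Computable.option_casesOn (Computable.list_getElem?.comp (Computable.snd.comp
        (Computable.snd.comp Computable.snd)) (Computable.const 0))
        (Computable.snd.comp Computable.snd) h2.to₂
    have hs : Computable fun y : α × ℕ × γ × List β =>
        (List.casesOn y.2.2.2 y.2.2 fun b l => (h (y.1, y.2.2.1, b), l) : γ × List β) := by
      refine hcase.of_eq fun y => ?_
      rcases y with ⟨a, n, s, _ | ⟨b, l⟩⟩ <;> rfl
    exact Computable.nat_rec (Computable.list_length.comp hf) (hg.pair hf) hs.to₂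
  refine (Computable.fst.comp H).of_eq fun a => ?_
  suffices ∀ (l : List β) (s : γ) (n : ℕ), n = l.length → (Nat.rec (s, l)
      (fun _ x => List.casesOn x.2 x fun b l => (h (a, x.1, b), l)) n : γ × List β) =
        (l.foldl (fun s b => h (a, s, b)) s, []) by
    rw [this _ _ _ rfl]
  intro l
  induction l with
  | nil => rintro s n rfl; rfl
  | cons b l ih =>
    rintro s n rfl
    rw [List.foldl_cons, ← ih (h (a, s, b)) _ rfl]
    have hrec : ∀ n, (Nat.rec (s, b :: l)
        (fun _ x => List.casesOn x.2 x fun b l => (h (a, x.1, b), l)) (n + 1) : γ × List β) =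
        Nat.rec (h (a, s, b), l)
        (fun _ x => List.casesOn x.2 x fun b l => (h (a, x.1, b), l)) n := by
      intro n
      induction n with
      | zero => rfl
      | succ n ih =>
        change (fun x : γ × List β => (List.casesOn x.2 x fun b l => (h (a, x.1, b), l) :
          γ × List β)) _ = _
        rw [ih]
    exact hrec _

/-- A chain is witnessed by the list of its successive elements, each paired with the stage that
confirms the step leading to it. The Boolean in `step` records whether all steps so far were
confirmed. -/
theorem reflTransGen {r : α → β → β → Prop} (hr : RE fun x : α × β × β => r x.1 x.2.1 x.2.2) :
    RE fun x : α × β × β => Relation.ReflTransGen (r x.1) x.2.1 x.2.2 := by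
  obtain ⟨f, hf, hrf⟩ := hr
  let step : α → Bool × β → β × ℕ → Bool × β :=
    fun a s y => (s.1 && f ((a, s.2, y.1), y.2), y.1)
  have hstep : Computable fun z : ((α × β × β) × List (β × ℕ)) × (Bool × β) × (β × ℕ) =>
      step z.1.1.1 z.2.1 z.2.2 := by
    have hs : Computable fun z : ((α × β × β) × List (β × ℕ)) × (Bool × β) × (β × ℕ) => z.2.1 :=
      Computable.fst.comp Computable.snd
    have hy : Computable fun z : ((α × β × β) × List (β × ℕ)) × (Bool × β) × (β × ℕ) => z.2.2 :=
      Computable.snd.comp Computable.snd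
    have ha : Computable fun z : ((α × β × β) × List (β × ℕ)) × (Bool × β) × (β × ℕ) => z.1.1.1 :=
      Computable.fst.comp (Computable.fst.comp Computable.fst)
    exact (Primrec.and.to_comp.comp (Computable.fst.comp hs) (hf.comp ((ha.pair
      ((Computable.snd.comp hs).pair (Computable.fst.comp hy))).pair
        (Computable.snd.comp hy)))).pair (Computable.fst.comp hy)
  have hfold := Computable.list_foldl' (f := fun z : (α × β × β) × List (β × ℕ) => z.2)
    (g := fun z => (true, z.1.2.1)) Computable.snd ((Computable.const true).pair
      (Computable.fst.comp (Computable.snd.comp Computable.fst))) hstep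
  have key : ∀ a (l : List (β × ℕ)) (s : Bool × β) (t : β), l.foldl (step a) s = (true, t) →
      s.1 = true ∧ Relation.ReflTransGen (r a) s.2 t := by
    intro a l
    induction l with
    | nil => rintro s t h; simp only [List.foldl_nil] at h; subst h; exact ⟨rfl, .refl⟩
    | cons y l ih =>
      intro s t h
      obtain ⟨h1, h2⟩ := ih _ _ h
      simp only [step, Bool.and_eq_true] at h1 h2
      exact ⟨h1.1, .head ((hrf (a, s.2, y.1)).2 ⟨_, h1.2⟩) h2⟩
  refine (ex (p := fun (x : α × β × β) (l : List (β × ℕ)) =>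
      l.foldl (step x.1) (true, x.2.1) = (true, x.2.2)) (eq hfold
        ((Computable.const true).pair (Computable.snd.comp
          (Computable.snd.comp Computable.fst))))).of_iff fun x => ?_
  obtain ⟨a, s, t⟩ := x
  constructor
  · intro h
    simp only at h
    induction h using Relation.ReflTransGen.head_induction_on with
    | refl => exact ⟨[], rfl⟩
    | @head b c hbc _ ih =>
      obtain ⟨l, hl⟩ := ih
      obtain ⟨n, hn⟩ := (hrf (a, b, c)).1 hbc
      refine ⟨(c, n) :: l, ?_⟩
      simpa [step, hn] using hl
  · rintro ⟨l, hl⟩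
    exact (key a l _ _ hl).2

/-- A total recursively enumerable relation contains the graph of a computable function. -/
theorem exists_computable {p : α → β → Prop} (hp : RE fun x : α × β => p x.1 x.2)
    (h : ∀ a, ∃ b, p a b) : ∃ F : α → β, Computable F ∧ ∀ a, p a (F a) := by
  obtain ⟨f, hf, hpf⟩ := hp
  -- The number `n` codes a candidate output and a stage; the first `n` that confirms its candidate
  -- supplies the value. Totality of `p` makes the search end.
  let g : α → ℕ → Option β := fun a n =>
    Option.casesOn (Encodable.decode (α := β) n.unpair.1) none
      fun b => bif f ((a, b), n.unpair.2) then some b else none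
  have hg : Computable₂ g := by
    have hu : Computable fun x : α × ℕ => x.2.unpair := Computable.unpair.comp Computable.snd
    refine Computable.option_casesOn (Computable.decode.comp (Computable.fst.comp hu))
      (Computable.const none) (Computable.cond (hf.comp (((Computable.fst.comp
        Computable.fst).pair Computable.snd).pair (Computable.snd.comp
          (hu.comp Computable.fst)))) (Computable.option_some.comp Computable.snd)
            (Computable.const none))
  have hmem : ∀ a n b, b ∈ g a n → p a b := by
    intro a n b hb
    simp only [g] at hb
    rcases hd : Encodable.decode (α := β) n.unpair.1 with _ | b'
    · simp [hd] at hb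
    · simp only [hd] at hb
      rcases hfb : f ((a, b'), n.unpair.2) with _ | _
      · simp [hfb] at hb
      · simp only [hfb, cond_true, Option.mem_def, Option.some.injEq] at hb
        subst hb
        exact (hpf (a, b')).2 ⟨_, hfb⟩
  have hdom : ∀ a, (Nat.rfindOpt (g a)).Dom := by
    intro a
    obtain ⟨b, hb⟩ := h a
    obtain ⟨n, hn⟩ := (hpf (a, b)).1 hb
    exact Nat.rfindOpt_dom.2 ⟨Nat.pair (Encodable.encode b) n, b, by simp [g, hn]⟩
  refine ⟨fun a => (Nat.rfindOpt (g a)).get (hdom a),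
    (Partrec.rfindOpt hg).of_eq_tot fun a => Part.get_mem _, fun a => ?_⟩
  obtain ⟨n, hn⟩ := Nat.rfindOpt_spec (Part.get_mem (hdom a))
  exact hmem a n _ hn

end RE

-- Automation for computability of composite functions

attribute [fun_prop] Computable

namespace Computable

variable {α β γ : Type*} [Primcodable α] [Primcodable β] [Primcodable γ]

@[fun_prop] theorem fun_id : Computable fun x : α => x := Computable.id

@[fun_prop] theorem fun_const (b : β) : Computable fun _ : α => b := Computable.const b

@[fun_prop] theorem fun_comp {f : β → γ} {g : α → β} (hf : Computable f) (hg : Computable g) :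
    Computable fun x => f (g x) := hf.comp hg

@[fun_prop] theorem fun_fst {f : α → β × γ} (hf : Computable f) : Computable fun x => (f x).1 :=
  Computable.fst.comp hf

@[fun_prop] theorem fun_snd {f : α → β × γ} (hf : Computable f) : Computable fun x => (f x).2 :=
  Computable.snd.comp hf

@[fun_prop] theorem fun_pair {f : α → β} {g : α → γ} (hf : Computable f) (hg : Computable g) :
    Computable fun x => (f x, g x) := hf.pair hg

@[fun_prop] theorem fun_append {f g : α → List β} (hf : Computable f) (hg : Computable g) :
    Computable fun x => f x ++ g x := Computable.list_append.comp hf hg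

@[fun_prop] theorem fun_cons {f : α → β} {g : α → List β} (hf : Computable f)
    (hg : Computable g) : Computable fun x => f x :: g x := Computable.list_cons.comp hf hg

@[fun_prop] theorem fun_length {f : α → List β} (hf : Computable f) :
    Computable fun x => (f x).length := Computable.list_length.comp hf

@[fun_prop] theorem fun_getD {f : α → List β} {g : α → ℕ} (d : β) (hf : Computable f)
    (hg : Computable g) : Computable fun x => (f x).getD (g x) d :=
  (Primrec.list_getD d).to_comp.comp hf hg

@[fun_prop] theorem fun_some {f : α → β} (hf : Computable f) :
    Computable fun x => some (f x) := Computable.option_some.comp hf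

end Computable

/-! ## Words -/

section Word

variable {L L' : Type*}

/-- The value of a word in the letters `L` and their formal inverses. -/
def wordVal {G : Type*} [Group G] (v : L → G) (W : List (L × Bool)) : G :=
  (W.map fun l => if l.2 then v l.1 else (v l.1)⁻¹).prod

/-- The formal inverse of a word. -/
def wordInv (W : List (L × Bool)) : List (L × Bool) := (W.map fun l => (l.1, !l.2)).reverse

/-- Substitution of words for letters. -/
def wordSubst (s : L → List (L' × Bool)) (W : List (L × Bool)) : List (L' × Bool) :=
  W.flatMap fun l => if l.2 then s l.1 else wordInv (s l.1)

theorem wordInv_wordInv (W : List (L × Bool)) : wordInv (wordInv W) = W := by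
  simp [wordInv, List.map_reverse, Function.comp_def]

variable {G : Type*} [Group G] (v : L → G)

theorem wordVal_nil : wordVal v [] = 1 := rfl

theorem wordVal_cons (l : L × Bool) (W : List (L × Bool)) :
    wordVal v (l :: W) = (if l.2 then v l.1 else (v l.1)⁻¹) * wordVal v W := by
  simp [wordVal]

theorem wordVal_append (W W' : List (L × Bool)) :
    wordVal v (W ++ W') = wordVal v W * wordVal v W' := by
  simp [wordVal]

theorem wordVal_inv (W : List (L × Bool)) : wordVal v (wordInv W) = (wordVal v W)⁻¹ := by
  induction W with
  | nil => simp [wordVal, wordInv]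
  | cons l W ih =>
    have : wordInv (l :: W) = wordInv W ++ [(l.1, !l.2)] := by simp [wordInv]
    rw [this, wordVal_append, ih, wordVal_cons, wordVal_cons, mul_inv_rev, wordVal_nil]
    rcases l with ⟨l, _ | _⟩ <;> simp

theorem wordVal_subst {v : L' → G} (s : L → List (L' × Bool)) (W : List (L × Bool)) :
    wordVal v (wordSubst s W) = wordVal (fun l => wordVal v (s l)) W := by
  induction W with
  | nil => rfl
  | cons l W ih =>
    have : wordSubst s (l :: W) = (if l.2 then s l.1 else wordInv (s l.1)) ++ wordSubst s W := rfl
    rw [this, wordVal_append, wordVal_cons, ih]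
    rcases l with ⟨l, _ | _⟩ <;> simp [wordVal_inv]

/-- The subgroup generated by the values of finitely many words. -/
def wordSpan (X : List (List (L × Bool))) : Subgroup G :=
  Subgroup.closure {g | ∃ W ∈ X, wordVal v W = g}

theorem wordVal_mem_wordSpan {X : List (List (L × Bool))} {W : List (L × Bool)} (h : W ∈ X) :
    wordVal v W ∈ wordSpan v X := Subgroup.subset_closure ⟨W, h, rfl⟩

theorem wordSpan_le {X : List (List (L × Bool))} {K : Subgroup G} :
    wordSpan v X ≤ K ↔ ∀ W ∈ X, wordVal v W ∈ K := by
  rw [wordSpan, Subgroup.closure_le]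
  exact ⟨fun h W hW => h ⟨W, hW, rfl⟩, fun h g ⟨W, hW, hg⟩ => hg ▸ h W hW⟩

theorem wordVal_mem {K : Subgroup G} (h : ∀ l, v l ∈ K) (W : List (L × Bool)) :
    wordVal v W ∈ K := by
  induction W with
  | nil => exact K.one_mem
  | cons l W ih =>
    rw [wordVal_cons]
    refine K.mul_mem ?_ ih
    split
    · exact h _
    · exact K.inv_mem (h _)

theorem mem_closure_range_iff (g : G) :
    g ∈ Subgroup.closure (Set.range v) ↔ ∃ W, wordVal v W = g := by
  constructor
  · intro h
    induction h using Subgroup.closure_induction with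
    | mem g hg =>
      obtain ⟨l, rfl⟩ := hg
      exact ⟨[(l, true)], by simp [wordVal]⟩
    | one => exact ⟨[], rfl⟩
    | mul g h _ _ ihg ihh =>
      obtain ⟨W, rfl⟩ := ihg
      obtain ⟨W', rfl⟩ := ihh
      exact ⟨W ++ W', wordVal_append v W W'⟩
    | inv g _ ih =>
      obtain ⟨W, rfl⟩ := ih
      exact ⟨wordInv W, wordVal_inv v W⟩
  · rintro ⟨W, rfl⟩
    exact wordVal_mem v (fun l => Subgroup.subset_closure (Set.mem_range_self l)) W

/-- Elements of the span are words in the indices of `X`; indices beyond the list stand for the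
empty word and add nothing. Membership thus becomes an existential statement over an encodable type.
-/
theorem mem_wordSpan_iff {X : List (List (L × Bool))} {g : G} :
    g ∈ wordSpan v X ↔ ∃ V : List (ℕ × Bool), wordVal v (wordSubst (fun i => X.getD i []) V) = g := by
  have : wordSpan v X = Subgroup.closure (Set.range fun i => wordVal v (X.getD i [])) := by
    refine le_antisymm ((wordSpan_le v).2 fun W hW => Subgroup.subset_closure
      (?_ : _ ∈ Set.range _))
      ((Subgroup.closure_le _).2 ?_)
    · obtain ⟨i, hi, rfl⟩ := List.mem_iff_getElem.1 hW
      exact ⟨i, by simp [List.getD, hi]⟩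
    · rintro _ ⟨i, rfl⟩
      by_cases hi : i < X.length
      · simp only [List.getD, List.getElem?_eq_getElem hi, Option.getD_some]
        exact wordVal_mem_wordSpan v (List.getElem_mem hi)
      · simp only [List.getD, List.getElem?_eq_none (not_lt.1 hi), Option.getD_none]
        exact one_mem _
  rw [this, mem_closure_range_iff]
  simp only [wordVal_subst]

theorem exists_wordVal_getD {gens : List G} (h : Subgroup.closure {g | g ∈ gens} = ⊤) (g : G) :
    ∃ W : GWord, GWord.eval gens W = g := by
  refine (mem_closure_range_iff (fun i => gens.getD i 1) g).1 (?_ : _ ∈ _)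
  have : g ∈ Subgroup.closure {g | g ∈ gens} := h ▸ Subgroup.mem_top g
  refine Subgroup.closure_mono ?_ this
  rintro g (hg : g ∈ gens)
  obtain ⟨i, hi, rfl⟩ := List.mem_iff_getElem.1 hg
  exact ⟨i, by simp [List.getD, hi]⟩

theorem GWord.eval_eq_wordVal (gens : List G) (W : GWord) :
    GWord.eval gens W = wordVal (fun i => gens.getD i 1) W := rfl

theorem GWord.span_eq_wordSpan (gens : List G) (X : List GWord) :
    GWord.span gens X = wordSpan (fun i => gens.getD i 1) X := rfl

end Word

/-! ### Enumerability of membership in finitely generated subgroups -/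

section WordComputable

variable {α L L' : Type*} [Primcodable α] [Primcodable L] [Primcodable L']

theorem Primrec.wordInv : Primrec (wordInv : List (L × Bool) → List (L × Bool)) :=
  Primrec.list_reverse.comp (Primrec.list_map Primrec.id
    ((Primrec.fst.comp Primrec.snd).pair (Primrec.not.comp (Primrec.snd.comp Primrec.snd))).to₂)

@[fun_prop] theorem Computable.fun_wordInv {f : α → List (L × Bool)} (hf : Computable f) :
    Computable fun x => wordInv (f x) := Primrec.wordInv.to_comp.comp hf

theorem Primrec.wordSubst_getD : Primrec fun x : List (List (L × Bool)) × List (ℕ × Bool) =>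
    wordSubst (fun i => x.1.getD i []) x.2 := by
  have h : Primrec fun y : (List (List (L × Bool)) × List (ℕ × Bool)) × ℕ × Bool =>
      y.1.1.getD y.2.1 [] :=
    (Primrec.list_getD []).comp (Primrec.fst.comp Primrec.fst) (Primrec.fst.comp Primrec.snd)
  have h' : Primrec fun y : (List (List (L × Bool)) × List (ℕ × Bool)) × ℕ × Bool =>
      if y.2.2 then y.1.1.getD y.2.1 [] else _root_.wordInv (y.1.1.getD y.2.1 []) := by
    refine (Primrec.cond (Primrec.snd.comp Primrec.snd) h (Primrec.wordInv.comp h)).of_eq ?_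
    rintro ⟨⟨X, V⟩, i, _ | _⟩ <;> rfl
  exact Primrec.list_flatMap Primrec.snd h'.to₂

@[fun_prop] theorem Computable.fun_wordSubst {f : α → List (List (L × Bool))}
    {g : α → List (ℕ × Bool)} (hf : Computable f) (hg : Computable g) :
    Computable fun x => wordSubst (fun i => (f x).getD i []) (g x) :=
  Primrec.wordSubst_getD.to_comp.comp (hf.pair hg)

/-- Guess a word in the generators and confirm equality through the word problem, which need only be
enumerable. -/
theorem RE.mem_wordSpan {G : Type*} [Group G] {v : L → G}
    (hv : RE fun W : List (L × Bool) => wordVal v W = 1) {f : α → List (L × Bool)}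
    {X : α → List (List (L × Bool))} (hf : Computable f) (hX : Computable X) :
    RE fun a => wordVal v (f a) ∈ wordSpan v (X a) := by
  have : RE fun y : α × List (ℕ × Bool) => wordVal v (wordInv (f y.1) ++
      wordSubst (fun i => (X y.1).getD i []) y.2) = 1 :=
    hv.comp (g := fun y : α × List (ℕ × Bool) => wordInv (f y.1) ++
      wordSubst (fun i => (X y.1).getD i []) y.2) (by fun_prop)
  refine (RE.ex (p := fun a V => wordVal v (wordInv (f a) ++
      wordSubst (fun i => (X a).getD i []) V) = 1) this).of_iff fun a => ?_
  simp only [mem_wordSpan_iff, wordVal_append, wordVal_inv, inv_mul_eq_one]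
  exact exists_congr fun V => eq_comm

theorem RE.wordVal_eq {G : Type*} [Group G] {v : L → G}
    (hv : RE fun W : List (L × Bool) => wordVal v W = 1) {f g : α → List (L × Bool)}
    (hf : Computable f) (hg : Computable g) : RE fun a => wordVal v (f a) = wordVal v (g a) := by
  refine (hv.comp (g := fun a => wordInv (f a) ++ g a) (by fun_prop)).of_iff fun a => ?_
  rw [wordVal_append, wordVal_inv, inv_mul_eq_one]

theorem RE.wordSpan_le {G : Type*} [Group G] {v : L → G}
    (hv : RE fun W : List (L × Bool) => wordVal v W = 1) {X Y : α → List (List (L × Bool))}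
    (hX : Computable X) (hY : Computable Y) :
    RE fun a => wordSpan v (X a) ≤ wordSpan v (Y a) := by
  refine (RE.ball_list (p := fun a W => wordVal v W ∈ wordSpan v (Y a)) hX
    (RE.mem_wordSpan hv (by fun_prop) (by fun_prop))).of_iff fun a => _root_.wordSpan_le v

theorem RE.wordSpan_eq {G : Type*} [Group G] {v : L → G}
    (hv : RE fun W : List (L × Bool) => wordVal v W = 1) {X Y : α → List (List (L × Bool))}
    (hX : Computable X) (hY : Computable Y) :
    RE fun a => wordSpan v (X a) = wordSpan v (Y a) :=
  ((RE.wordSpan_le hv hX hY).and (RE.wordSpan_le hv hY hX)).of_iff fun _ => le_antisymm_iff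

end WordComputable

/-! ## Reduced paths -/

namespace GraphOfGroups.Path

variable {Γ : SerreGraph.{u}} {A : GraphOfGroups.{u, v, w} Γ}

/-- The number of edges of a path. -/
def length : ∀ {a b : Γ.V}, A.Path a b → ℕ
  | _, _, single _ => 0
  | _, _, cons _ _ p => p.length + 1

theorem length_single_comp {a b : Γ.V} (g : A.GV a) (p : A.Path a b) :
    ((single g).comp p).length = p.length := by
  cases p <;> rfl

theorem single_comp_single_comp {a b : Γ.V} (g h : A.GV a) (p : A.Path a b) :
    (single g).comp ((single h).comp p) = (single (g * h)).comp p := by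
  rw [← comp_assoc]
  rfl

theorem Red.cons_cases {a b d : Γ.V} {g : A.GV a} {e : Γ.E a b} {p : A.Path b d}
    {q : A.Path a d} (h : Red (cons g e p) q) :
    (∃ c r, p = cons (A.ω e c) (Γ.inv e) r ∧ q = (single (g * A.α e c)).comp r) ∨
      ∃ q', Red p q' ∧ q = cons g e q' := by
  cases h with
  | head g e c p => exact .inl ⟨c, p, rfl, rfl⟩
  | tail g e h => exact .inr ⟨_, h, rfl⟩

theorem Red.length_lt {a b : Γ.V} {p q : A.Path a b} (h : Red p q) : q.length < p.length := by
  induction h with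
  | head g e c p => simp only [length, length_single_comp]; omega
  | tail g e _ ih => simp only [length]; omega

theorem isReduced_single {a : Γ.V} (g : A.GV a) : (single g : A.Path a a).IsReduced := by
  intro q h
  cases h

/-! ### Slides, and confluence of reductions modulo slides -/

/-- `Slide p q`: the path `q` is obtained from `p` by moving an element of an edge group from
one side of the edge to the other side. -/
inductive Slide : ∀ {a b : Γ.V}, A.Path a b → A.Path a b → Prop
  | head {a b d : Γ.V} (g : A.GV a) (e : Γ.E a b) (c : A.GE e) (p : A.Path b d) :
      Slide (cons (g * A.α e c) e p) (cons g e ((single (A.ω e c)).comp p))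
  | tail {a b d : Γ.V} (g : A.GV a) (e : Γ.E a b) {p q : A.Path b d} :
      Slide p q → Slide (cons g e p) (cons g e q)

theorem Slide.cons_cases {a b d : Γ.V} {g : A.GV a} {e : Γ.E a b} {p : A.Path b d}
    {q : A.Path a d} (h : Slide (cons g e p) q) :
    (∃ g' c, g = g' * A.α e c ∧ q = cons g' e ((single (A.ω e c)).comp p)) ∨
      ∃ q', Slide p q' ∧ q = cons g e q' := by
  cases h with
  | head g e c p => exact .inl ⟨g, c, rfl, rfl⟩
  | tail g e h => exact .inr ⟨_, h, rfl⟩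

theorem Slide.symm {a b : Γ.V} {p q : A.Path a b} (h : Slide p q) : Slide q p := by
  induction h with
  | head g e c p =>
    have := Slide.head (g * A.α e c) e c⁻¹ ((single (A.ω e c)).comp p)
    simpa only [map_inv, mul_inv_cancel_right, single_comp_single_comp, inv_mul_cancel,
      one_comp] using this
  | tail g e _ ih => exact .tail g e ih

theorem Slide.length_eq {a b : Γ.V} {p q : A.Path a b} (h : Slide p q) :
    p.length = q.length := by
  induction h with
  | head g e c p => simp only [length, length_single_comp]
  | tail g e _ ih => simp only [length, ih]

theorem Slide.single_comp {a b : Γ.V} (g : A.GV a) {p q : A.Path a b} (h : Slide p q) :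
    Slide ((single g).comp p) ((single g).comp q) := by
  cases h with
  | head k e c p => simpa only [comp, mul_assoc] using Slide.head (g * k) e c p
  | tail k e h => exact .tail (g * k) e h

/-- The equivalence relation generated by slides. -/
abbrev SlideEq {a b : Γ.V} (p q : A.Path a b) : Prop := Relation.EqvGen Slide p q

theorem SlideEq.cons {a b d : Γ.V} (g : A.GV a) (e : Γ.E a b) {p q : A.Path b d}
    (h : SlideEq p q) : SlideEq (cons g e p) (cons g e q) := by
  induction h with
  | rel _ _ h => exact .rel _ _ (.tail g e h)
  | refl => exact .refl _
  | symm _ _ _ ih => exact .symm _ _ ih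
  | trans _ _ _ _ _ ih ih' => exact .trans _ _ _ ih ih'

theorem SlideEq.length_eq {a b : Γ.V} {p q : A.Path a b} (h : SlideEq p q) :
    p.length = q.length := by
  induction h with
  | rel _ _ h => exact h.length_eq
  | refl => rfl
  | symm _ _ _ ih => exact ih.symm
  | trans _ _ _ _ _ ih ih' => exact ih.trans ih'

/-- A slide does not destroy a possible reduction. Apart from disjoint positions there are two
overlaps: sliding over the first or over the second of the two cancelling edges. In both the middle
element stays in the image of `ω`, and the reduced paths coincide. -/
theorem Slide.exists_red {a b : Γ.V} {p p' q : A.Path a b} (h : Slide p p') (k : Red p q) :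
    ∃ q', Red p' q' ∧ SlideEq q q' := by
  induction p with
  | single g => cases k
  | @cons a b d g e p ih =>
    obtain ⟨g', c, rfl, rfl⟩ | ⟨p', hp, rfl⟩ := h.cons_cases
    · obtain ⟨d, r, rfl, rfl⟩ | ⟨p2, hp2, rfl⟩ := k.cons_cases
      · refine ⟨_, ?_, .refl _⟩
        have := Red.head g' e (c * d) r
        simpa only [comp, map_mul, mul_assoc] using this
      · exact ⟨_, .tail g' e (hp2.comp_left _), .rel _ _ (.head g' e c p2)⟩
    · obtain ⟨d, r, rfl, rfl⟩ | ⟨p2, hp2, rfl⟩ := k.cons_cases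
      · obtain ⟨k', c, hd, rfl⟩ | ⟨r', hr, rfl⟩ := hp.cons_cases
        · obtain ⟨φ, hφ⟩ := A.inv_edge e
          obtain ⟨c, rfl⟩ := φ.surjective c
          rw [(hφ c).1] at hd
          obtain rfl : k' = A.ω e (d * c⁻¹) := by
            rw [map_mul, hd, map_inv, mul_inv_cancel_right]
          refine ⟨_, .head g e (d * c⁻¹) _, ?_⟩
          rw [single_comp_single_comp, (hφ c).2, mul_assoc, ← map_mul, inv_mul_cancel_right]
          exact .refl _
        · exact ⟨_, .head g e d r', .rel _ _ (hr.single_comp _)⟩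
      · obtain ⟨q', hq, hs⟩ := ih hp hp2
        exact ⟨_, .tail g e hq, hs.cons g e⟩

theorem SlideEq.exists_red {a b : Γ.V} {p p' : A.Path a b} (h : SlideEq p p') :
    (∀ q, Red p q → ∃ q', Red p' q' ∧ SlideEq q q') ∧
      ∀ q, Red p' q → ∃ q', Red p q' ∧ SlideEq q q' := by
  induction h with
  | rel _ _ h => exact ⟨fun q k => h.exists_red k, fun q k => h.symm.exists_red k⟩
  | refl => exact ⟨fun q k => ⟨q, k, .refl _⟩, fun q k => ⟨q, k, .refl _⟩⟩
  | symm _ _ _ ih => exact ⟨ih.2, ih.1⟩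
  | trans _ _ _ _ _ ih ih' =>
    constructor
    · intro q k
      obtain ⟨q1, k1, h1⟩ := ih.1 q k
      obtain ⟨q2, k2, h2⟩ := ih'.1 q1 k1
      exact ⟨q2, k2, .trans _ _ _ h1 h2⟩
    · intro q k
      obtain ⟨q1, k1, h1⟩ := ih'.2 q k
      obtain ⟨q2, k2, h2⟩ := ih.2 q1 k1
      exact ⟨q2, k2, .trans _ _ _ h1 h2⟩

/-- The critical pair is a subpath `e, e⁻¹, e`: cancelling the first two edges or the last two
leaves one edge `e` with the same element of the edge group on different sides of it. This is why
reductions are confluent only modulo slides. -/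
theorem Red.head_tail {a b d : Γ.V} (g : A.GV a) (e : Γ.E a b) (c : A.GE e) (r : A.Path a d)
    {q : A.Path b d} (k : Red (Path.cons (A.ω e c) (Γ.inv e) r) q) :
    SlideEq ((single (g * A.α e c)).comp r) (Path.cons g e q) ∨
      ∃ s, Red ((single (g * A.α e c)).comp r) s ∧ Red (Path.cons g e q) s := by
  obtain ⟨c', s, rfl, rfl⟩ | ⟨r', hr, rfl⟩ := k.cons_cases
  · left
    obtain ⟨φ, hφ⟩ := A.inv_edge e
    obtain ⟨c', rfl⟩ := φ.surjective c'
    refine .rel _ _ ?_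
    have := Slide.head g e (c * c') s
    rw [map_mul, map_mul, ← mul_assoc] at this
    rw [(hφ c').1, (hφ c').2, Γ.inv_inv]
    exact this
  · exact .inr ⟨_, hr.comp_left _, .head g e c r'⟩

theorem Red.locally_confluent {a b : Γ.V} {p q₁ q₂ : A.Path a b} (h₁ : Red p q₁)
    (h₂ : Red p q₂) :
    SlideEq q₁ q₂ ∨ ∃ r₁ r₂, Red q₁ r₁ ∧ Red q₂ r₂ ∧ SlideEq r₁ r₂ := by
  induction p with
  | single g => cases h₁
  | @cons a b d g e p ih =>
    obtain ⟨c, r, rfl, rfl⟩ | ⟨p₁, hp₁, rfl⟩ := h₁.cons_cases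
    · obtain ⟨c', r', h, rfl⟩ | ⟨p₂, hp₂, rfl⟩ := h₂.cons_cases
      · simp only [Path.cons.injEq, heq_eq_eq, true_and] at h
        obtain ⟨h, rfl⟩ := h
        obtain rfl := A.ω_injective e h
        exact .inl (.refl _)
      · obtain h | ⟨s, h, h'⟩ := Red.head_tail g e c r hp₂
        · exact .inl h
        · exact .inr ⟨s, s, h, h', .refl _⟩
    · obtain ⟨c, r, rfl, rfl⟩ | ⟨p₂, hp₂, rfl⟩ := h₂.cons_cases
      · obtain h | ⟨s, h, h'⟩ := Red.head_tail g e c r hp₁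
        · exact .inl (.symm _ _ h)
        · exact .inr ⟨s, s, h', h, .refl _⟩
      · obtain h | ⟨r₁, r₂, k₁, k₂, h⟩ := ih hp₁ hp₂
        · exact .inl (h.cons g e)
        · exact .inr ⟨_, _, .tail g e k₁, .tail g e k₂, h.cons g e⟩

/-- Elementary reductions of paths up to slides. -/
def QuotRed {a b : Γ.V} (x y : Quot (Slide (A := A) (a := a) (b := b))) : Prop :=
  ∃ p q, Quot.mk _ p = x ∧ Quot.mk _ q = y ∧ Red p q

/-- Since slides preserve reducibility, a reduction of a slide class can be carried out on any
prescribed representative. -/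
theorem QuotRed.of_mk {a b : Γ.V} {p : A.Path a b} {y} (h : QuotRed (Quot.mk _ p) y) :
    ∃ q, Quot.mk _ q = y ∧ Red p q := by
  obtain ⟨p', q, hp, rfl, k⟩ := h
  obtain ⟨q', hq, hs⟩ := (SlideEq.exists_red (Quot.eqvGen_exact hp)).1 q k
  exact ⟨q', (Quot.eqvGen_sound hs).symm, hq⟩

/-- Two reductions of one class meet again after at most one step on each side, which is strong
enough for Church–Rosser without an appeal to termination. -/
theorem QuotRed.diamond {a b : Γ.V} (x y z : Quot (Slide (A := A) (a := a) (b := b)))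
    (hy : QuotRed x y) (hz : QuotRed x z) :
    ∃ d, Relation.ReflGen QuotRed y d ∧ Relation.ReflTransGen QuotRed z d := by
  obtain ⟨p, rfl⟩ := Quot.exists_rep x
  obtain ⟨q₁, rfl, h₁⟩ := hy.of_mk
  obtain ⟨q₂, rfl, h₂⟩ := hz.of_mk
  obtain h | ⟨r₁, r₂, k₁, k₂, h⟩ := h₁.locally_confluent h₂
  · rw [Quot.eqvGen_sound h]
    exact ⟨_, .refl, .refl⟩
  · exact ⟨Quot.mk _ r₁, .single ⟨_, _, rfl, rfl, k₁⟩,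
      .single ⟨_, _, rfl, (Quot.eqvGen_sound h).symm, k₂⟩⟩

/-- Equivalent reduced paths have the same length. -/
theorem IsReduced.length_eq {a b : Γ.V} {p q : A.Path a b} (hp : p.IsReduced)
    (hq : q.IsReduced) (h : p.Equiv q) : p.length = q.length := by
  -- Church–Rosser: equivalent paths have a common descendant among slide classes. For reduced paths
  -- neither class can move, so the paths differ by slides, which preserve length.
  have hj : ∀ p q : A.Path a b, p.Equiv q → Relation.Join
      (Relation.ReflTransGen QuotRed) (Quot.mk Slide p) (Quot.mk Slide q) := by
    intro p q h
    have he := Relation.equivalence_join_reflTransGen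
      (QuotRed.diamond (A := A) (a := a) (b := b))
    induction h with
    | rel p q h => exact ⟨_, .single ⟨_, _, rfl, rfl, h⟩, .refl⟩
    | refl => exact he.refl _
    | symm _ _ _ ih => exact he.symm ih
    | trans _ _ _ _ _ ih ih' => exact he.trans ih ih'
  have hirr : ∀ (p : A.Path a b), p.IsReduced → ∀ y,
      Relation.ReflTransGen QuotRed (Quot.mk _ p) y → Quot.mk _ p = y := by
    intro p hp y h
    obtain h | ⟨z, hz, -⟩ := Relation.ReflTransGen.cases_head h
    · exact h
    · obtain ⟨q, -, k⟩ := hz.of_mk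
      exact absurd k (hp q)
  obtain ⟨y, h₁, h₂⟩ := hj p q h
  have := (hirr p hp y h₁).trans (hirr q hq y h₂).symm
  exact SlideEq.length_eq (Quot.eqvGen_exact this)

theorem exists_isReduced {a b : Γ.V} (p : A.Path a b) : ∃ q, q.IsReduced ∧ p.Equiv q := by
  induction hn : p.length using Nat.strong_induction_on generalizing p with
  | _ n ih =>
    by_cases h : p.IsReduced
    · exact ⟨p, h, .refl _⟩
    · simp only [IsReduced, not_forall, not_not] at h
      obtain ⟨r, hr⟩ := h
      obtain ⟨q, hq, hrq⟩ := ih _ (hn ▸ hr.length_lt) r rfl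
      exact ⟨q, hq, .trans _ _ _ (.rel _ _ hr) hrq⟩

theorem eq_single_of_length {a b : Γ.V} (p : A.Path a b) (h : p.length = 0) : a = b := by
  cases p with
  | single => rfl
  | cons => simp [length] at h

end GraphOfGroups.Path

/-! ## Paths in `A`-graphs -/

namespace AGraph

open GraphOfGroups

variable {Γ : SerreGraph.{u}} {A : GraphOfGroups.{u, v, w} Γ} (𝔹 : AGraph A)

theorem μ_comp {a b c : 𝔹.B.V} (p : 𝔹.toGraphOfGroups.Path a b)
    (q : 𝔹.toGraphOfGroups.Path b c) : 𝔹.μ (p.comp q) = (𝔹.μ p).comp (𝔹.μ q) := by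
  induction p with
  | single g =>
    cases q with
    | single h => rfl
    | cons h f q =>
      change Path.cons ((g.1 * h.1) * 𝔹.lα f) _ _ = Path.cons (g.1 * (h.1 * 𝔹.lα f)) _ _
      rw [mul_assoc]
  | cons g f p ih =>
    simp only [Path.comp, μ, ih, Path.comp_assoc]

theorem length_μ {a b : 𝔹.B.V} (p : 𝔹.toGraphOfGroups.Path a b) :
    (𝔹.μ p).length = p.length := by
  induction p with
  | single g => rfl
  | cons g f p ih => simp only [μ, Path.length, Path.length_single_comp, ih]

/-- The conjugating factors in `edgeω` cancel against `f_ω` and `(f⁻¹)_α = f_ω⁻¹`, so a reduction at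
`f` becomes a reduction at `[f]`. -/
theorem μ_red {a b : 𝔹.B.V} {p q : 𝔹.toGraphOfGroups.Path a b} (h : Path.Red p q) :
    (𝔹.μ p).Equiv (𝔹.μ q) := by
  induction h with
  | @head a b d g f c p =>
    refine .rel _ _ ?_
    have h1 : 𝔹.μ (.cons g f (.cons (𝔹.toGraphOfGroups.ω f c) (𝔹.B.inv f) p)) =
        .cons (g.1 * 𝔹.lα f) (𝔹.etyp f) (.cons (A.ω (𝔹.etyp f) c.1) (Γ.inv (𝔹.etyp f))
          ((Path.single (𝔹.lα f)⁻¹).comp (𝔹.μ p))) := by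
      have hω : ((show 𝔹.grp b from 𝔹.toGraphOfGroups.ω f c) : A.GV (𝔹.typ b)) =
        (𝔹.lω f)⁻¹ * A.ω (𝔹.etyp f) c.1 * 𝔹.lω f := 𝔹.edgeω_coe f c
      simp only [μ]
      rw [hω, 𝔹.etyp_inv, 𝔹.lα_inv, 𝔹.lω_inv]
      simp [Path.comp, mul_assoc]
    have h2 : 𝔹.μ ((Path.single (g * 𝔹.toGraphOfGroups.α f c)).comp p) =
        (Path.single (g.1 * 𝔹.lα f * A.α (𝔹.etyp f) c.1)).comp
          ((Path.single (𝔹.lα f)⁻¹).comp (𝔹.μ p)) := by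
      rw [μ_comp, Path.single_comp_single_comp]
      simp only [μ]
      congr 2
      change g.1 * (𝔹.lα f * A.α (𝔹.etyp f) c.1 * (𝔹.lα f)⁻¹) = _
      group
    rw [h1, h2]
    exact .head _ _ _ _
  | tail g f _ ih =>
    exact Path.Equiv.comp (.refl (Path.cons (g.1 * 𝔹.lα f) (𝔹.etyp f)
      (Path.single (𝔹.lω f)))) ih

theorem μ_equiv {a b : 𝔹.B.V} {p q : 𝔹.toGraphOfGroups.Path a b} (h : p.Equiv q) :
    (𝔹.μ p).Equiv (𝔹.μ q) := by
  induction h with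
  | rel _ _ h => exact 𝔹.μ_red h
  | refl => exact .refl _
  | symm _ _ _ ih => exact .symm _ _ ih
  | trans _ _ _ _ _ ih ih' => exact .trans _ _ _ ih ih'

/-- Reducing a path does not change the class of its image, so the reducedness demanded in `L` may
be dropped. -/
theorem mem_L_iff {a b : 𝔹.B.V} (g : A.PathClass (𝔹.typ a) (𝔹.typ b)) :
    g ∈ 𝔹.L a b ↔ ∃ q : 𝔹.toGraphOfGroups.Path a b, (𝔹.μ q).cls = g := by
  constructor
  · rintro ⟨q, -, h⟩
    exact ⟨q, h⟩
  · rintro ⟨q, rfl⟩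
    obtain ⟨r, hr, h⟩ := q.exists_isReduced
    exact ⟨r, hr, (Quotient.sound (s := A.pathSetoid _ _) (𝔹.μ_equiv h)).symm⟩

theorem _root_.SerreGraph.edge_eq_inv {Γ : SerreGraph.{u}} {a b d : Γ.V} (e : Γ.E a b)
    (e' : Γ.E b d) (h : d = a) (he : e' ≍ Γ.inv e) :
    (⟨a, b, e⟩ : Γ.Edge) = ⟨d, b, Γ.inv e'⟩ := by
  subst h
  rw [eq_of_heq he, Γ.inv_inv]

theorem _root_.SerreGraph.eq_inv_of_edge_eq {Γ : SerreGraph.{u}} {a b d : Γ.V} (e : Γ.E a b)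
    (e' : Γ.E b d) (h : (⟨a, b, e⟩ : Γ.Edge) = ⟨d, b, Γ.inv e'⟩) : d = a ∧ e' ≍ Γ.inv e := by
  have h1 : a = d := congrArg Sigma.fst h
  subst h1
  simp only [Sigma.mk.injEq, heq_eq_eq, true_and] at h
  rw [h, Γ.inv_inv]
  exact ⟨rfl, HEq.rfl⟩

/-! ### Folded `A`-graphs -/

variable {𝔹}

/-- A reduction of `μ(q)` uses consecutive edges `f`, `f'` of inverse types with `f_ω k f'_α =
ω(c)`. If `f' ≠ f⁻¹`, this is a pair excluded by the first foldedness condition. If `f' = f⁻¹`, the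
second condition puts `c` into the edge group of `f`, so that `q` was already reducible. -/
theorem IsFolded.isReduced_μ (h𝔹 : 𝔹.IsFolded) {a b : 𝔹.B.V}
    {q : 𝔹.toGraphOfGroups.Path a b} (hq : q.IsReduced) : (𝔹.μ q).IsReduced := by
  induction q with
  | single g => exact Path.isReduced_single _
  | @cons a b d g f q ih =>
    have hq' : q.IsReduced := fun r hr => hq _ (.tail g f hr)
    intro r hr
    simp only [μ] at hr
    obtain ⟨c, s, hs, -⟩ | ⟨r', hr', -⟩ := hr.cons_cases
    · cases q with
      | single k => simp [μ, Path.comp] at hs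
      | @cons b d' d k f' q =>
        simp only [μ, Path.comp, Path.cons.injEq] at hs
        obtain ⟨h1, h2, h3, h4⟩ := hs
        have hedge : (⟨_, _, 𝔹.etyp f⟩ : Γ.Edge) = ⟨_, _, 𝔹.etyp (𝔹.B.inv f')⟩ := by
          rw [𝔹.etyp_inv]
          exact SerreGraph.edge_eq_inv _ _ h1 h3
        by_cases hne : (⟨a, b, f⟩ : 𝔹.B.Edge) = ⟨d', b, 𝔹.B.inv f'⟩
        · obtain ⟨rfl, hf⟩ := SerreGraph.eq_inv_of_edge_eq _ _ hne
          obtain rfl := eq_of_heq hf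
          have hk : (k.1 : A.GV (𝔹.typ b)) = (𝔹.lω f)⁻¹ * A.ω (𝔹.etyp f) c * 𝔹.lω f := by
            rw [← h2, 𝔹.lα_inv]
            group
          have hω : c ∈ 𝔹.preω f := by
            rw [mem_preω, ← hk]
            exact k.2
          have hα : c ∈ 𝔹.preα f := by
            rw [not_not.1 (not_exists.1 (not_exists.1 (not_exists.1 h𝔹.2 _) _) f)]
            exact hω
          have hk' : k = 𝔹.toGraphOfGroups.ω f (⟨c, hα, hω⟩ : 𝔹.edgeGrp f) :=
            Subtype.ext (hk.trans (𝔹.edgeω_coe f ⟨c, hα, hω⟩).symm)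
          rw [hk'] at hq
          exact hq _ (.head g f _ q)
        · exact h𝔹.1 ⟨a, b, d', f, f', hne, hedge, k.1, k.2, c, by rw [mul_assoc]; exact h2⟩
    -- Inside the tail, removing the prefix `f_ω` turns the reduction into one of `μ` of the tail.
    · have := hr'.comp_left (Path.single (𝔹.lω f)⁻¹)
      rw [Path.single_comp_single_comp, inv_mul_cancel, Path.one_comp] at this
      exact ih hq' _ this

/-- In a folded `A`-graph, only paths with equal endpoints represent elements of length zero. -/
theorem IsFolded.eq_of_length_eq_zero (h𝔹 : 𝔹.IsFolded) {a b : 𝔹.B.V}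
    (q : 𝔹.toGraphOfGroups.Path a b) (r : A.Path (𝔹.typ a) (𝔹.typ b)) (hr : r.length = 0)
    (h : (𝔹.μ q).Equiv r) : a = b := by
  obtain ⟨q', hq', hqq'⟩ := q.exists_isReduced
  have hr' : r.IsReduced := fun s hs => by have := hs.length_lt; omega
  have := (h𝔹.isReduced_μ hq').length_eq hr' (.trans _ _ _ (.symm _ _ (𝔹.μ_equiv hqq')) h)
  rw [length_μ, hr] at this
  exact q'.eq_single_of_length this

end AGraph

/-! ## The fundamental group as a finitely generated group -/

namespace GraphOfGroups

variable {Γ : SerreGraph.{u}} {A : GraphOfGroups.{u, v, w} Γ}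

theorem Path.cls_eq_iff {a b : Γ.V} {p q : A.Path a b} : p.cls = q.cls ↔ p.Equiv q :=
  ⟨fun h => Quotient.exact (s := A.pathSetoid a b) h,
    fun h => Quotient.sound (s := A.pathSetoid a b) h⟩

theorem Path.cls_mul {a : Γ.V} (p q : A.Path a a) : p.cls * q.cls = ((p.comp q).cls : A.π₁ a) :=
  rfl

theorem Path.cls_one {a : Γ.V} : (1 : A.π₁ a) = (Path.single 1 : A.Path a a).cls := rfl

/-! ### Paths as elements of the fundamental group -/

section Loop

variable {v₀ : Γ.V} (τ : ∀ a, A.Path v₀ a)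

/-- The element of the fundamental group given by a path, after its endpoints have been joined to
the base point by the paths `τ`. -/
def toLoop {a b : Γ.V} (p : A.Path a b) : A.π₁ v₀ := ((τ a).comp (p.comp (τ b).symm)).cls

theorem toLoop_congr {a b : Γ.V} {p q : A.Path a b} (h : p.Equiv q) : toLoop τ p = toLoop τ q :=
  Path.cls_eq_iff.2 (Path.Equiv.comp (.refl _) (Path.Equiv.comp h (.refl _)))

/-- Closing up a path loses nothing, because the connecting paths can be cancelled again. -/
theorem equiv_of_toLoop_eq {a b : Γ.V} {p q : A.Path a b} (h : toLoop τ p = toLoop τ q) :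
    p.Equiv q := by
  have key : ∀ p : A.Path a b,
      ((τ a).symm.comp (((τ a).comp (p.comp (τ b).symm)).comp (τ b))).Equiv p := by
    intro p
    rw [Path.comp_assoc, Path.comp_assoc, ← Path.comp_assoc]
    have := Path.Equiv.comp (Path.symm_comp (τ a))
      (Path.Equiv.comp (.refl p) (Path.symm_comp (τ b)))
    rwa [Path.one_comp, Path.comp_one] at this
  refine .trans _ _ _ (.symm _ _ (key p)) (.trans _ _ _ ?_ (key q))
  exact Path.Equiv.comp (.refl _) (Path.Equiv.comp (Path.cls_eq_iff.1 h) (.refl _))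

theorem toLoop_comp {a b c : Γ.V} (p : A.Path a b) (q : A.Path b c) :
    toLoop τ (p.comp q) = toLoop τ p * toLoop τ q := by
  rw [toLoop, toLoop, toLoop, Path.cls_mul, Path.cls_eq_iff]
  simp only [Path.comp_assoc]
  refine Path.Equiv.comp (.refl _) (Path.Equiv.comp (.refl _) ?_)
  rw [← Path.comp_assoc]
  have := Path.Equiv.comp (Path.symm_comp (τ b)) (.refl (q.comp (τ c).symm))
  rw [Path.one_comp] at this
  exact .symm _ _ this

theorem toLoop_one {a : Γ.V} : toLoop τ (Path.single (1 : A.GV a)) = 1 := by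
  rw [toLoop, Path.one_comp, Path.cls_one, Path.cls_eq_iff]
  exact Path.comp_symm _

theorem toLoop_tree (hτ : τ v₀ = Path.single 1) (a : Γ.V) : toLoop τ (τ a) = 1 := by
  rw [toLoop, hτ, Path.one_comp, Path.cls_one, Path.cls_eq_iff]
  exact Path.comp_symm _

/-- The connecting path at the base point is trivial, so `toLoop` replaces transport along
equalities of endpoints. -/
theorem cast_cls (hτ : τ v₀ = Path.single 1) {a b : Γ.V} (ha : a = v₀) (hb : b = v₀)
    (p : A.Path a b) : PathClass.cast ha hb p.cls = toLoop τ p := by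
  subst ha
  subst hb
  rw [toLoop, hτ, Path.one_comp]
  simp only [Path.symm, inv_one, Path.comp_one]
  rfl

theorem cls_eq_toLoop (hτ : τ v₀ = Path.single 1) (p : A.Path v₀ v₀) :
    (p.cls : A.π₁ v₀) = toLoop τ p := cast_cls τ hτ rfl rfl p

/-- The image of a vertex group in the fundamental group. -/
def vertexHom (a : Γ.V) : A.GV a →* A.π₁ v₀ where
  toFun g := toLoop τ (Path.single g)
  map_one' := toLoop_one τ
  map_mul' g h := (toLoop_comp τ (Path.single g) (Path.single h) :)

/-- The element of the fundamental group given by an edge. -/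
def edgeElt {a b : Γ.V} (e : Γ.E a b) : A.π₁ v₀ :=
  toLoop τ (Path.cons 1 e (Path.single 1))

theorem toLoop_single {a : Γ.V} (g : A.GV a) : toLoop τ (Path.single g) = vertexHom τ a g := rfl

theorem toLoop_cons {a b c : Γ.V} (g : A.GV a) (e : Γ.E a b) (p : A.Path b c) :
    toLoop τ (Path.cons g e p) = vertexHom τ a g * edgeElt τ e * toLoop τ p := by
  rw [← toLoop_single, edgeElt, ← toLoop_comp, ← toLoop_comp]
  simp [Path.comp, Path.one_comp]

theorem edgeElt_inv {a b : Γ.V} (e : Γ.E a b) :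
    edgeElt τ (Γ.inv e) = (edgeElt τ e)⁻¹ := by
  rw [eq_inv_iff_mul_eq_one, edgeElt, edgeElt, ← toLoop_comp, ← toLoop_one τ (a := b)]
  apply toLoop_congr
  have := Path.backtrack (1 : A.GV b) (Γ.inv e) e (Γ.inv_inv e).symm (Path.single 1)
  simpa [Path.comp] using this

theorem edgeElt_mul {a b : Γ.V} (e : Γ.E a b) (c : A.GE e) :
    edgeElt τ e * vertexHom τ b (A.ω e c) = vertexHom τ a (A.α e c) * edgeElt τ e := by
  rw [← mul_inv_eq_iff_eq_mul, ← edgeElt_inv, edgeElt, edgeElt, ← toLoop_single, ← toLoop_comp,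
    ← toLoop_comp, ← toLoop_single]
  apply toLoop_congr
  have := Path.Red.head (1 : A.GV a) e c (Path.single 1)
  simp only [Path.comp, one_mul, mul_one] at this ⊢
  exact .rel _ _ this

end Loop

/-- Words in the letters `(n + 1, i)` for generator number `i` of vertex number `n`, and `(0, k)`
for edge number `k`. -/
abbrev LWord : Type := List ((ℕ × ℕ) × Bool)

/-! ### A presentation of the fundamental group -/

namespace Marking

variable (M : A.Marking)

/-- The word in the generators of the fundamental group for a word in the generators of a vertex
group. -/
def emb (a : Γ.V) (W : GWord) : LWord := W.map fun l => (((M.vNum a : ℕ) + 1, l.1), l.2)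

/-- The one-letter word for an edge. -/
def edgeWord {a b : Γ.V} (e : Γ.E a b) : LWord := [((0, (M.eNum ⟨a, b, e⟩ : ℕ)), true)]

theorem primrec_emb (a : Γ.V) : Primrec (M.emb a) :=
  Primrec.list_map Primrec.id (((Primrec.const _).pair (Primrec.fst.comp Primrec.snd)).pair
    (Primrec.snd.comp Primrec.snd)).to₂

@[fun_prop] theorem computable_emb {α : Type*} [Primcodable α] {a : Γ.V} {f : α → GWord}
    (hf : Computable f) : Computable fun x => M.emb a (f x) := (M.primrec_emb a).to_comp.comp hf

theorem emb_append (a : Γ.V) (W W' : GWord) : M.emb a (W ++ W') = M.emb a W ++ M.emb a W' := by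
  simp [emb]

/-- A word for an element of a vertex group. -/
noncomputable def word {a : Γ.V} (g : A.GV a) : GWord :=
  (exists_wordVal_getD (M.vGens_closure a) g).choose

theorem eval_word {a : Γ.V} (g : A.GV a) : GWord.eval (M.vGens a) (M.word g) = g :=
  (exists_wordVal_getD (M.vGens_closure a) g).choose_spec

/-- Words for the images under `α` of the generators of an edge group. -/
noncomputable def αWords {a b : Γ.V} (e : Γ.E a b) : List GWord :=
  (M.eGens e).map fun c => M.word (A.α e c)

/-- Words for the images under `ω` of the generators of an edge group. -/
noncomputable def ωWords {a b : Γ.V} (e : Γ.E a b) : List GWord :=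
  (M.eGens e).map fun c => M.word (A.ω e c)

/-- Letters beyond `gens'` have value `1`, and their substitutes are empty words, so no bound on the
letters is needed. -/
theorem eval_subst_map {G H : Type*} [Group G] [Group H] (f : H →* G) (gens : List G)
    (gens' : List H) (s : H → GWord) (hs : ∀ c, GWord.eval gens (s c) = f c) (W : GWord) :
    GWord.eval gens (wordSubst (fun i => (gens'.map s).getD i []) W) =
      f (GWord.eval gens' W) := by
  have h : ∀ i, wordVal (fun i => gens.getD i 1) ((gens'.map s).getD i []) =
      f (gens'.getD i 1) := by
    intro i
    by_cases hi : i < gens'.length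
    · simpa [List.getD, hi, GWord.eval_eq_wordVal] using hs _
    · simp [List.getD, not_lt.1 hi, wordVal_nil]
  rw [GWord.eval_eq_wordVal, wordVal_subst]
  simp only [h]
  induction W with
  | nil => simp [wordVal, GWord.eval]
  | cons l W ih =>
    rw [wordVal_cons, ih, GWord.eval_eq_wordVal, GWord.eval_eq_wordVal, wordVal_cons, map_mul]
    split <;> simp

theorem eval_αWords {a b : Γ.V} (e : Γ.E a b) (W : GWord) :
    GWord.eval (M.vGens a) (wordSubst (fun i => (M.αWords e).getD i []) W) =
      A.α e (GWord.eval (M.eGens e) W) :=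
  eval_subst_map (A.α e) _ _ _ (fun c => M.eval_word (A.α e c)) W

theorem eval_ωWords {a b : Γ.V} (e : Γ.E a b) (W : GWord) :
    GWord.eval (M.vGens b) (wordSubst (fun i => (M.ωWords e).getD i []) W) =
      A.ω e (GWord.eval (M.eGens e) W) :=
  eval_subst_map (A.ω e) _ _ _ (fun c => M.eval_word (A.ω e c)) W

variable {v₀ : Γ.V} (τ : ∀ a, A.Path v₀ a)

/-- The values of the letters of the words `LWord`. -/
noncomputable def letterVal : ℕ × ℕ → A.π₁ v₀
  | (0, k) => if h : k < M.nE then edgeElt τ (M.eNum.symm ⟨k, h⟩).2.2 else 1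
  | (n + 1, i) => if h : n < M.nV then
      vertexHom τ (M.vNum.symm ⟨n, h⟩) ((M.vGens (M.vNum.symm ⟨n, h⟩)).getD i 1) else 1

/-- The value of a word in the generators of the fundamental group. -/
noncomputable abbrev val (W : LWord) : A.π₁ v₀ := wordVal (M.letterVal τ) W

theorem val_append (W W' : LWord) : M.val τ (W ++ W') = M.val τ W * M.val τ W' :=
  wordVal_append _ W W'

theorem val_inv (W : LWord) : M.val τ (wordInv W) = (M.val τ W)⁻¹ := wordVal_inv _ W

theorem val_nil : M.val τ [] = 1 := rfl

theorem val_edgeWord {a b : Γ.V} (e : Γ.E a b) : M.val τ (M.edgeWord e) = edgeElt τ e := by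
  have h : ∀ x : Γ.Edge, x = ⟨a, b, e⟩ → edgeElt τ x.2.2 = edgeElt τ e := by
    rintro _ rfl
    rfl
  simpa [val, wordVal, edgeWord, letterVal] using h _ (M.eNum.symm_apply_apply ⟨a, b, e⟩)

theorem val_emb (a : Γ.V) (W : GWord) :
    M.val τ (M.emb a W) = vertexHom τ a (GWord.eval (M.vGens a) W) := by
  have h : ∀ i, M.letterVal τ ((M.vNum a : ℕ) + 1, i) =
      vertexHom τ a ((M.vGens a).getD i 1) := by
    intro i
    have h : ∀ x : Γ.V, x = a →
        vertexHom τ x ((M.vGens x).getD i 1) = vertexHom τ a ((M.vGens a).getD i 1) := by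
      rintro _ rfl
      rfl
    simpa [letterVal] using h _ (M.vNum.symm_apply_apply a)
  induction W with
  | nil => simp [val, emb, wordVal, GWord.eval]
  | cons l W ih =>
    have : M.emb a (l :: W) = (((M.vNum a : ℕ) + 1, l.1), l.2) :: M.emb a W := rfl
    rw [this, val, wordVal_cons, ← val, ih, GWord.eval_eq_wordVal, GWord.eval_eq_wordVal,
      wordVal_cons, map_mul]
    simp only [h]
    split <;> simp

/-- A word for a path. -/
noncomputable def pathWord : ∀ {a b : Γ.V}, A.Path a b → LWord
  | a, _, .single g => M.emb a (M.word g)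
  | a, _, .cons g e p => M.emb a (M.word g) ++ M.edgeWord e ++ pathWord p

theorem val_pathWord {a b : Γ.V} (p : A.Path a b) : M.val τ (M.pathWord p) = toLoop τ p := by
  induction p with
  | single g => rw [pathWord, val_emb, eval_word, toLoop_single]
  | cons g e p ih =>
    rw [pathWord, val_append, val_append, ih, val_emb, eval_word, toLoop_cons,
      val_edgeWord]

/-- Defining relations of the fundamental group. -/
inductive BasicRel : LWord → LWord → Prop
  | vertex (a : Γ.V) (W W' : GWord) :
      GWord.eval (M.vGens a) W = GWord.eval (M.vGens a) W' → BasicRel (M.emb a W) (M.emb a W')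
  | edge {a b : Γ.V} (e : Γ.E a b) (W : GWord) :
      BasicRel (M.emb a (wordSubst (fun i => (M.αWords e).getD i []) W) ++ M.edgeWord e)
        (M.edgeWord e ++ M.emb b (wordSubst (fun i => (M.ωWords e).getD i []) W))
  | cancel {a b : Γ.V} (e : Γ.E a b) : BasicRel (M.edgeWord e ++ M.edgeWord (Γ.inv e)) []
  | inv {a b : Γ.V} (e : Γ.E a b) :
      BasicRel [((0, (M.eNum ⟨a, b, e⟩ : ℕ)), false)] (M.edgeWord (Γ.inv e))
  | tree (a : Γ.V) : BasicRel (M.pathWord (τ a)) []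
  | junk_edge (k : ℕ) (s : Bool) : ¬ k < M.nE → BasicRel [((0, k), s)] []
  | junk_vertex (n i : ℕ) (s : Bool) : ¬ n < M.nV → BasicRel [((n + 1, i), s)] []

variable {M τ} in
theorem BasicRel.val_eq (hτ : τ v₀ = Path.single 1) {W W' : LWord} (h : M.BasicRel τ W W') :
    M.val τ W = M.val τ W' := by
  cases h with
  | vertex a W W' h => rw [val_emb, val_emb, h]
  | edge e W =>
    rw [val_append, val_append, val_emb, val_emb, val_edgeWord, eval_αWords,
      eval_ωWords, edgeElt_mul]
  | cancel e =>
    rw [val_append, val_edgeWord, val_edgeWord, edgeElt_inv, mul_inv_cancel, val_nil]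
  | inv e =>
    have : [((0, (M.eNum ⟨_, _, e⟩ : ℕ)), false)] = wordInv (M.edgeWord e) := rfl
    rw [this, val_inv, val_edgeWord, val_edgeWord, edgeElt_inv]
  | tree a => rw [val_pathWord, toLoop_tree τ hτ, val_nil]
  | junk_edge k s h => simp [val, wordVal, letterVal, h]
  | junk_vertex n i s h => simp [val, wordVal, letterVal, h]

/-- One application of a defining relation inside a word. -/
def WordStep (W W' : LWord) : Prop :=
  ∃ y : LWord × LWord × LWord × LWord, W = y.1 ++ y.2.1 ++ y.2.2.2 ∧
    W' = y.1 ++ y.2.2.1 ++ y.2.2.2 ∧ (M.BasicRel τ y.2.1 y.2.2.1 ∨ M.BasicRel τ y.2.2.1 y.2.1)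

/-- Equivalence of words under the defining relations. -/
abbrev WordEquiv (W W' : LWord) : Prop := Relation.ReflTransGen (M.WordStep τ) W W'

variable {M τ}

theorem WordStep.symm {W W' : LWord} (h : M.WordStep τ W W') : M.WordStep τ W' W := by
  obtain ⟨y, h1, h2, h3⟩ := h
  exact ⟨(y.1, y.2.2.1, y.2.1, y.2.2.2), h2, h1, h3.symm⟩

theorem WordEquiv.symm {W W' : LWord} (h : M.WordEquiv τ W W') : M.WordEquiv τ W' W := by
  induction h with
  | refl => exact .refl
  | tail _ h ih => exact .head h.symm ih

theorem BasicRel.wordEquiv {W W' : LWord} (h : M.BasicRel τ W W') : M.WordEquiv τ W W' :=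
  .single ⟨([], W, W', []), by simp, by simp, .inl h⟩

theorem WordEquiv.append {U U' W W' : LWord} (h : M.WordEquiv τ U U') (k : M.WordEquiv τ W W') :
    M.WordEquiv τ (U ++ W) (U' ++ W') := by
  have h1 : M.WordEquiv τ (U ++ W) (U' ++ W) := by
    refine Relation.ReflTransGen.lift (· ++ W) ?_ _ _ h
    rintro _ _ ⟨⟨x, r, r', y⟩, rfl, rfl, hr⟩
    exact ⟨(x, r, r', y ++ W), by simp, by simp, hr⟩
  have h2 : M.WordEquiv τ (U' ++ W) (U' ++ W') := by
    refine Relation.ReflTransGen.lift (U' ++ ·) ?_ _ _ k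
    rintro _ _ ⟨⟨x, r, r', y⟩, rfl, rfl, hr⟩
    exact ⟨(U' ++ x, r, r', y), by simp, by simp, hr⟩
  exact h1.trans h2

theorem WordEquiv.val_eq (hτ : τ v₀ = Path.single 1) {W W' : LWord} (h : M.WordEquiv τ W W') :
    M.val τ W = M.val τ W' := by
  induction h with
  | refl => rfl
  | tail _ h ih =>
    obtain ⟨y, rfl, rfl, h | h⟩ := h <;>
      rw [ih, val_append, val_append, val_append, val_append, h.val_eq hτ]

theorem wordEquiv_emb {a : Γ.V} {W W' : GWord}
    (h : GWord.eval (M.vGens a) W = GWord.eval (M.vGens a) W') :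
    M.WordEquiv τ (M.emb a W) (M.emb a W') := (BasicRel.vertex a W W' h).wordEquiv

theorem wordEquiv_single_comp {a b : Γ.V} (g : A.GV a) (p : A.Path a b) :
    M.WordEquiv τ (M.pathWord ((Path.single g).comp p)) (M.emb a (M.word g) ++ M.pathWord p) := by
  have h : ∀ h : A.GV a, M.WordEquiv τ (M.emb a (M.word (g * h)))
      (M.emb a (M.word g) ++ M.emb a (M.word h)) := by
    intro h
    rw [← emb_append]
    refine wordEquiv_emb ?_
    rw [eval_word, GWord.eval_eq_wordVal, wordVal_append, ← GWord.eval_eq_wordVal,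
      ← GWord.eval_eq_wordVal, eval_word, eval_word]
  cases p with
  | single k => exact h k
  | cons k e p =>
    simp only [Path.comp, pathWord, ← List.append_assoc]
    exact ((h k).append .refl).append .refl

theorem wordEquiv_comp {a b c : Γ.V} (p : A.Path a b) (q : A.Path b c) :
    M.WordEquiv τ (M.pathWord (p.comp q)) (M.pathWord p ++ M.pathWord q) := by
  induction p with
  | single g => exact wordEquiv_single_comp g q
  | cons g e p ih =>
    simp only [Path.comp, pathWord, List.append_assoc]
    exact WordEquiv.append .refl (WordEquiv.append .refl (ih q))

/-- Write `c` as a word in the generators of the edge group; the edge relation carries `ω(c)` back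
across `e` as `α(c)`, after which `e e⁻¹` cancels. -/
theorem wordEquiv_of_red {a b : Γ.V} {p q : A.Path a b} (h : Path.Red p q) :
    M.WordEquiv τ (M.pathWord p) (M.pathWord q) := by
  induction h with
  | @head a b d g e c p =>
    obtain ⟨W, rfl⟩ := exists_wordVal_getD (M.eGens_closure e) c
    refine .trans ?_ (wordEquiv_comp _ _).symm
    simp only [pathWord, ← List.append_assoc]
    refine WordEquiv.append ?_ .refl
    refine .trans (b := M.emb a (M.word g) ++ (M.emb a (wordSubst
      (fun i => (M.αWords e).getD i []) W) ++ M.edgeWord e) ++ M.edgeWord (Γ.inv e)) ?_ ?_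
    · refine WordEquiv.append ?_ .refl
      rw [List.append_assoc]
      refine WordEquiv.append .refl (.trans (WordEquiv.append .refl (wordEquiv_emb ?_))
        (BasicRel.edge e W).wordEquiv.symm)
      rw [eval_word, eval_ωWords]
    · simp only [List.append_assoc]
      rw [← List.append_assoc, ← emb_append]
      refine .trans (WordEquiv.append (wordEquiv_emb ?_) (BasicRel.cancel e).wordEquiv)
        (by rw [List.append_nil])
      rw [eval_word, GWord.eval_eq_wordVal, wordVal_append, ← GWord.eval_eq_wordVal,
        ← GWord.eval_eq_wordVal, eval_word, eval_αWords]
  | tail g e _ ih => exact WordEquiv.append .refl ih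

theorem wordEquiv_of_equiv {a b : Γ.V} {p q : A.Path a b} (h : p.Equiv q) :
    M.WordEquiv τ (M.pathWord p) (M.pathWord q) := by
  induction h with
  | rel _ _ h => exact wordEquiv_of_red h
  | refl => exact .refl
  | symm _ _ _ ih => exact ih.symm
  | trans _ _ _ _ _ ih ih' => exact ih.trans ih'

theorem wordEquiv_one (a : Γ.V) : M.WordEquiv τ (M.pathWord (Path.single (1 : A.GV a))) [] :=
  wordEquiv_emb (W' := []) (by rw [eval_word]; rfl)

/-- The tree relations kill the word of each `τ a`; the word of its inverse path is then killed as
well, since the product of the two is derivably trivial. -/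
theorem wordEquiv_loop {a b : Γ.V} (p : A.Path a b) :
    M.WordEquiv τ (M.pathWord ((τ a).comp (p.comp (τ b).symm))) (M.pathWord p) := by
  have h : M.WordEquiv τ (M.pathWord (τ b).symm) [] := by
    have h1 := (wordEquiv_comp (M := M) (τ := τ) (τ b).symm (τ b)).symm.trans
      ((wordEquiv_of_equiv (Path.symm_comp (τ b))).trans (wordEquiv_one b))
    refine .trans ?_ h1
    simpa using WordEquiv.append (U := M.pathWord (τ b).symm) .refl
      (BasicRel.tree (M := M) b).wordEquiv.symm
  refine (wordEquiv_comp _ _).trans ?_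
  refine (WordEquiv.append (BasicRel.tree a).wordEquiv ((wordEquiv_comp _ _).trans
    (WordEquiv.append .refl h))).trans ?_
  simp only [List.nil_append, List.append_nil]
  exact .refl

theorem exists_path_wordEquiv_letter (l : (ℕ × ℕ) × Bool) :
    ∃ p : A.Path v₀ v₀, M.WordEquiv τ [l] (M.pathWord p) := by
  have hone : ∃ p : A.Path v₀ v₀, M.WordEquiv τ [] (M.pathWord p) :=
    ⟨Path.single 1, (wordEquiv_one v₀).symm⟩
  obtain ⟨⟨_ | n, k⟩, s⟩ := l
  · by_cases hk : k < M.nE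
    · obtain ⟨⟨a, b, e⟩, he⟩ := M.eNum.surjective ⟨k, hk⟩
      have hedge : ∀ {a b : Γ.V} (e : Γ.E a b),
          ∃ p : A.Path v₀ v₀, M.WordEquiv τ (M.edgeWord e) (M.pathWord p) := by
        intro a b e
        refine ⟨_, .trans ?_ (wordEquiv_loop (Path.cons 1 e (Path.single 1))).symm⟩
        have := WordEquiv.append (WordEquiv.append (wordEquiv_one (M := M) (τ := τ) a)
          (.refl (a := M.edgeWord e))) (wordEquiv_one b)
        rw [List.nil_append, List.append_nil] at this
        exact this.symm
      have hk' : k = (M.eNum ⟨a, b, e⟩ : ℕ) := by rw [he]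
      subst hk'
      cases s with
      | true => exact hedge e
      | false =>
        obtain ⟨p, hp⟩ := hedge (Γ.inv e)
        exact ⟨p, (BasicRel.inv e).wordEquiv.trans hp⟩
    · obtain ⟨p, hp⟩ := hone
      exact ⟨p, (BasicRel.junk_edge k s hk).wordEquiv.trans hp⟩
  · by_cases hn : n < M.nV
    · obtain ⟨a, ha⟩ := M.vNum.surjective ⟨n, hn⟩
      have hn' : n = (M.vNum a : ℕ) := by rw [ha]
      subst hn'
      refine ⟨_, .trans ?_ (wordEquiv_loop (Path.single
        (GWord.eval (M.vGens a) [(k, s)]))).symm⟩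
      exact wordEquiv_emb (W := [(k, s)]) (by rw [eval_word])
    · obtain ⟨p, hp⟩ := hone
      exact ⟨p, (BasicRel.junk_vertex n k s hn).wordEquiv.trans hp⟩

theorem exists_path_wordEquiv (W : LWord) :
    ∃ p : A.Path v₀ v₀, M.WordEquiv τ W (M.pathWord p) := by
  induction W with
  | nil => exact ⟨Path.single 1, (wordEquiv_one v₀).symm⟩
  | cons l W ih =>
    obtain ⟨p, hp⟩ := exists_path_wordEquiv_letter (M := M) (τ := τ) l
    obtain ⟨q, hq⟩ := ih
    exact ⟨p.comp q, (hp.append hq).trans (wordEquiv_comp p q).symm⟩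

/-- Completeness of the relations: every word is derivably the word of a loop, triviality of the
value makes that loop equivalent to the trivial one, and equivalences of paths lift to derivations.
Derivability is a form of triviality that can be enumerated. -/
theorem val_eq_one_iff (hτ : τ v₀ = Path.single 1) (W : LWord) :
    M.val τ W = 1 ↔ M.WordEquiv τ W [] := by
  constructor
  · intro h
    obtain ⟨p, hp⟩ := exists_path_wordEquiv (M := M) (τ := τ) W
    refine hp.trans ((wordEquiv_of_equiv ?_).trans (wordEquiv_one v₀))
    apply equiv_of_toLoop_eq τ
    rw [← val_pathWord M, ← hp.val_eq hτ, h, toLoop_one]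
  · intro h
    rw [h.val_eq hτ]
    rfl

end Marking

end GraphOfGroups

/-! ## Enumerating the relations of a benign graph of groups -/

namespace GraphOfGroups

variable {Γ : SerreGraph.{u}} {A : GraphOfGroups.{u, v, w} Γ} {M : A.Marking}

theorem Marking.finite_vertex (M : A.Marking) : Finite Γ.V := Finite.of_equiv _ M.vNum.symm

theorem Marking.finite_edge (M : A.Marking) : Finite Γ.Edge := Finite.of_equiv _ M.eNum.symm

theorem _root_.GWord.span_nil {G : Type*} [Group G] (gens : List G) : GWord.span gens [] = ⊥ := by
  simp [GWord.span]

/-- Condition 1 for the trivial subgroup decides whether `g` lies in `α(A_e)` and then returns `c`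
with `g α(c) = 1`. So `g = 1` exactly when `c = 1`, which is condition 3 for the trivial subgroup.
-/
theorem Benign.re_eval_eq_one (hA : Benign M) {a b : Γ.V} (e : Γ.E a b) :
    RE fun W : GWord => wordVal (fun i => (M.vGens a).getD i 1) W = 1 := by
  obtain ⟨F, hF, hF'⟩ := hA.coset e
  obtain ⟨K, hK, hK'⟩ := hA.edge_membership e
  have h : RE fun W : GWord => ∃ c : GWord, F ([], W) = some c ∧ K ([], c) = true := by
    refine RE.ex (p := fun (W : GWord) (c : GWord) => F ([], W) = some c ∧ K ([], c) = true) ?_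
    exact (RE.eq (by fun_prop) (by fun_prop)).and (RE.of_bool (by fun_prop))
  refine h.of_iff fun W => ?_
  rw [← GWord.eval_eq_wordVal]
  have key : ∀ c, F ([], W) = some c → (GWord.eval (M.vGens a) W = 1 ↔ K ([], c) = true) := by
    intro c hc
    have := (hF' [] W).2 c hc
    rw [GWord.span_nil, Subgroup.mem_bot, mul_eq_one_iff_eq_inv] at this
    rw [hK', GWord.span_nil, Subgroup.mem_bot, this, inv_eq_one, ← map_one (A.α e),
      (A.α_injective e).eq_iff]
  constructor
  · intro hW
    rcases hc : F ([], W) with _ | c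
    · have := (hF' [] W).1 hc
      refine absurd (Set.mem_inter (one_mem (GWord.span (M.vGens a) [])) ?_)
        (Set.eq_empty_iff_forall_notMem.1 this 1)
      rw [hW, one_smul]
      exact one_mem (A.α e).range
    · exact ⟨c, rfl, (key c hc).1 hW⟩
  · rintro ⟨c, hc, hc'⟩
    exact (key c hc).2 hc'

/-- The conditions reach a vertex group only through an edge that starts there, hence `hE`. -/
theorem Benign.re_basicRel (hA : Benign M) (hE : ∀ a : Γ.V, ∃ b, Nonempty (Γ.E a b)) {v₀ : Γ.V}
    (τ : ∀ a, A.Path v₀ a) : RE fun x : LWord × LWord => M.BasicRel τ x.1 x.2 := by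
  have := M.finite_vertex
  have := M.finite_edge
  have h1 : RE fun x : LWord × LWord => ∃ (a : Γ.V) (y : GWord × GWord),
      x.1 = M.emb a y.1 ∧ x.2 = M.emb a y.2 ∧ wordVal (fun i => (M.vGens a).getD i 1) y.1 =
        wordVal (fun i => (M.vGens a).getD i 1) y.2 := by
    refine RE.ex_finite fun a => RE.ex ?_
    obtain ⟨b, ⟨e⟩⟩ := hE a
    exact (RE.eq (by fun_prop) (by fun_prop)).and ((RE.eq (by fun_prop) (by fun_prop)).and
      (RE.wordVal_eq (hA.re_eval_eq_one e) (by fun_prop) (by fun_prop)))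
  have h2 : RE fun x : LWord × LWord => ∃ (e : Γ.Edge) (W : GWord),
      x.1 = M.emb e.1 (wordSubst (fun i => (M.αWords e.2.2).getD i []) W) ++
        M.edgeWord e.2.2 ∧ x.2 = M.edgeWord e.2.2 ++
          M.emb e.2.1 (wordSubst (fun i => (M.ωWords e.2.2).getD i []) W) := by
    refine RE.ex_finite fun e => RE.ex ?_
    exact (RE.eq (by fun_prop) (by fun_prop)).and (RE.eq (by fun_prop) (by fun_prop))
  have h3 : RE fun x : LWord × LWord => ∃ (e : Γ.Edge),
      x.1 = M.edgeWord e.2.2 ++ M.edgeWord (Γ.inv e.2.2) ∧ x.2 = [] :=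
    RE.ex_finite fun e => (RE.eq (by fun_prop) (by fun_prop)).and
      (RE.eq (by fun_prop) (by fun_prop))
  have h4 : RE fun x : LWord × LWord => ∃ (e : Γ.Edge),
      x.1 = [((0, (M.eNum e : ℕ)), false)] ∧ x.2 = M.edgeWord (Γ.inv e.2.2) :=
    RE.ex_finite fun e => (RE.eq (by fun_prop) (by fun_prop)).and
      (RE.eq (by fun_prop) (by fun_prop))
  have h5 : RE fun x : LWord × LWord => ∃ (a : Γ.V), x.1 = M.pathWord (τ a) ∧ x.2 = [] :=
    RE.ex_finite fun e => (RE.eq (by fun_prop) (by fun_prop)).and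
      (RE.eq (by fun_prop) (by fun_prop))
  -- The inequality `M.nE < y.1 + 1` is `¬ y.1 < M.nE` in a shape accepted by `RE.lt`.
  have h6 : RE fun x : LWord × LWord => ∃ (y : ℕ × Bool),
      x.1 = [((0, y.1), y.2)] ∧ x.2 = [] ∧ M.nE < y.1 + 1 :=
    RE.ex ((RE.eq (by fun_prop) (by fun_prop)).and ((RE.eq (by fun_prop) (by fun_prop)).and
      (RE.lt (by fun_prop) (Computable.succ.comp (by fun_prop)))))
  have h7 : RE fun x : LWord × LWord => ∃ (y : ℕ × ℕ × Bool),
      x.1 = [((y.1 + 1, y.2.1), y.2.2)] ∧ x.2 = [] ∧ M.nV < y.1 + 1 := by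
    have : Computable fun x : (LWord × LWord) × ℕ × ℕ × Bool => x.2.1 + 1 :=
      Computable.succ.comp (by fun_prop)
    exact RE.ex ((RE.eq (by fun_prop) (by fun_prop)).and ((RE.eq (by fun_prop) (by fun_prop)).and
      (RE.lt (by fun_prop) this)))
  refine (h1.or (h2.or (h3.or (h4.or (h5.or (h6.or h7)))))).of_iff ?_
  rintro ⟨W, W'⟩
  constructor
  · intro h
    cases h with
    | vertex a W W' h => exact .inl ⟨a, (W, W'), rfl, rfl, h⟩
    | edge e W => exact .inr (.inl ⟨⟨_, _, e⟩, W, rfl, rfl⟩)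
    | cancel e => exact .inr (.inr (.inl ⟨⟨_, _, e⟩, rfl, rfl⟩))
    | inv e => exact .inr (.inr (.inr (.inl ⟨⟨_, _, e⟩, rfl, rfl⟩)))
    | tree a => exact .inr (.inr (.inr (.inr (.inl ⟨a, rfl, rfl⟩))))
    | junk_edge k s h =>
      exact .inr (.inr (.inr (.inr (.inr (.inl ⟨(k, s), rfl, rfl, by dsimp only; omega⟩)))))
    | junk_vertex n i s h =>
      exact .inr (.inr (.inr (.inr (.inr (.inr ⟨(n, i, s), rfl, rfl, by dsimp only; omega⟩)))))
  · rintro (⟨a, y, h, h', k⟩ | ⟨e, W, h, h'⟩ | ⟨e, h, h'⟩ | ⟨e, h, h'⟩ | ⟨a, h, h'⟩ |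
      ⟨y, h, h', k⟩ | ⟨y, h, h', k⟩) <;> dsimp only at h h' ⊢ <;> rw [h, h']
    · exact .vertex a _ _ k
    · exact .edge _ _
    · exact .cancel _
    · exact .inv _
    · exact .tree _
    · exact .junk_edge _ _ (by omega)
    · exact .junk_vertex _ _ _ (by omega)

theorem Benign.re_val_eq_one (hA : Benign M) (hE : ∀ a : Γ.V, ∃ b, Nonempty (Γ.E a b)) {v₀ : Γ.V}
    {τ : ∀ a, A.Path v₀ a} (hτ : τ v₀ = Path.single 1) :
    RE fun W : LWord => wordVal (M.letterVal τ) W = 1 := by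
  have h : RE fun x : Unit × LWord × LWord => M.WordStep τ x.2.1 x.2.2 := by
    refine RE.ex ?_
    have hb := hA.re_basicRel hE τ
    refine (RE.eq (by fun_prop) (by fun_prop)).and ((RE.eq (by fun_prop) (by fun_prop)).and
      (RE.or ?_ ?_))
    · exact hb.comp (g := fun x : (Unit × LWord × LWord) × LWord × LWord × LWord × LWord =>
        (x.2.2.1, x.2.2.2.1)) (by fun_prop)
    · exact hb.comp (g := fun x : (Unit × LWord × LWord) × LWord × LWord × LWord × LWord =>
        (x.2.2.2.1, x.2.2.1)) (by fun_prop)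
  refine ((RE.reflTransGen (r := fun _ : Unit => M.WordStep τ) h).comp
    (g := fun W : LWord => ((), W, ([] : LWord))) (by fun_prop)).of_iff fun W => ?_
  exact Marking.val_eq_one_iff hτ W

/-! ### Enumerability of the two foldedness conditions -/

/-- Conjugation of words. -/
def conjWords (U : GWord) (X : List GWord) : List GWord :=
  X.map fun W => wordInv U ++ W ++ U

@[fun_prop] theorem computable_conjWords {α : Type*} [Primcodable α] {f : α → GWord}
    {g : α → List GWord} (hf : Computable f) (hg : Computable g) :
    Computable fun x => conjWords (f x) (g x) := by
  have h : Primrec fun x : GWord × List GWord => conjWords x.1 x.2 := by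
    have h1 : Primrec fun y : (GWord × List GWord) × GWord => wordInv y.1.1 ++ y.2 ++ y.1.1 :=
      Primrec.list_append.comp (Primrec.list_append.comp
        (Primrec.wordInv.comp (Primrec.fst.comp Primrec.fst)) Primrec.snd)
          (Primrec.fst.comp Primrec.fst)
    exact Primrec.list_map Primrec.snd h1.to₂
  exact h.to_comp.comp (hf.pair hg)

theorem mem_span_conjWords {G : Type*} [Group G] (gens : List G) (U : GWord) (X : List GWord)
    (g : G) : g ∈ GWord.span gens (conjWords U X) ↔
      GWord.eval gens U * g * (GWord.eval gens U)⁻¹ ∈ GWord.span gens X := by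
  have : GWord.span gens (conjWords U X) =
      (GWord.span gens X).map (MulAut.conj (GWord.eval gens U)⁻¹).toMonoidHom := by
    rw [GWord.span, GWord.span, MonoidHom.map_closure]
    congr 1
    ext g
    simp [conjWords, GWord.eval_eq_wordVal, wordVal_append, wordVal_inv, mul_assoc]
  rw [this, Subgroup.mem_map]
  constructor
  · rintro ⟨k, hk, rfl⟩
    simpa [mul_assoc] using hk
  · intro h
    exact ⟨_, h, by simp [mul_assoc]⟩

/-- With `u`, `v` the values of `U`, `V`: `v = k u α(c)` means `u⁻¹ k u = u⁻¹ v α(c)⁻¹`. The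
universal statement therefore says that the conjugate `u⁻¹⟨X⟩u` misses the coset `u⁻¹ v α(A_e)`, and
the algorithm of condition 1 answers `none` exactly then. -/
theorem Benign.re_coset (hA : Benign M) {α : Type*} [Primcodable α] {a b : Γ.V} (e : Γ.E a b)
    {X : α → List GWord} {U V : α → GWord} (hX : Computable X) (hU : Computable U)
    (hV : Computable V) :
    RE fun x => ∀ k ∈ GWord.span (M.vGens a) (X x), ∀ c, GWord.eval (M.vGens a) (V x) ≠
      k * GWord.eval (M.vGens a) (U x) * A.α e c := by
  obtain ⟨F, hF, hF'⟩ := hA.coset e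
  refine (RE.eq (f := fun x => F (conjWords (U x) (X x), wordInv (U x) ++ V x))
    (g := fun _ => none) (by fun_prop) (by fun_prop)).of_iff fun x => ?_
  set u := GWord.eval (M.vGens a) (U x) with hu
  set v := GWord.eval (M.vGens a) (V x) with hv
  have hw : GWord.eval (M.vGens a) (wordInv (U x) ++ V x) = u⁻¹ * v := by
    rw [GWord.eval_eq_wordVal, wordVal_append, wordVal_inv]
    rfl
  constructor
  · intro h
    rcases hc : F (conjWords (U x) (X x), wordInv (U x) ++ V x) with _ | c
    · rfl
    · have := (hF' _ _).2 c hc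
      rw [mem_span_conjWords, hw] at this
      refine absurd ?_ (h _ this (GWord.eval (M.eGens e) c)⁻¹)
      rw [map_inv, ← hu]
      group
  · intro h k hk c hc
    have := Set.eq_empty_iff_forall_notMem.1 ((hF' _ _).1 h) (u⁻¹ * k * u)
    refine this ⟨?_, ?_⟩
    · rw [SetLike.mem_coe, mem_span_conjWords, ← hu]
      simpa [mul_assoc] using hk
    · rw [hw, hc]
      refine ⟨A.α e c⁻¹, ⟨c⁻¹, rfl⟩, ?_⟩
      rw [map_inv]
      simp [mul_assoc]

theorem _root_.GWord.exists_span_eq {G : Type*} [Group G] {gens : List G}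
    (h : Subgroup.closure {g | g ∈ gens} = ⊤) {K : Subgroup G} (hK : K.FG) :
    ∃ X : List GWord, GWord.span gens X = K := by
  obtain ⟨S, rfl⟩ := hK
  choose W hW using fun g => exists_wordVal_getD h g
  refine ⟨S.toList.map W, ?_⟩
  rw [GWord.span]
  congr 1
  ext g
  simp [hW]

theorem span_map_subst {G H : Type*} [Group G] [Group H] (f : H →* G) (gens : List G)
    (gens' : List H) (T : List GWord)
    (hT : ∀ W, GWord.eval gens (wordSubst (fun i => T.getD i []) W) = f (GWord.eval gens' W))
    (K : List GWord) : GWord.span gens (K.map (wordSubst fun i => T.getD i [])) =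
      (GWord.span gens' K).map f := by
  rw [GWord.span, GWord.span, MonoidHom.map_closure]
  congr 1
  ext g
  simp only [List.mem_map, Set.mem_ofPred_eq, Set.mem_image, exists_exists_and_eq_and, hT]

theorem computable_map_subst {α : Type*} [Primcodable α] (T : List GWord) {f : α → List GWord}
    (hf : Computable f) :
    Computable fun x => (f x).map (wordSubst (L' := ℕ) fun i => T.getD i []) := by
  have h : Primrec fun K : List GWord => K.map (wordSubst (L' := ℕ) fun i => T.getD i []) :=
    Primrec.list_map Primrec.id (Primrec.to₂ (Primrec.wordSubst_getD.comp
      ((Primrec.const T).pair Primrec.snd)))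
  exact h.to_comp.comp hf

/-- Injectivity of `f` allows subgroups of `H` to be compared through their images, and the image of
the preimage is the intersection that condition 4 computes. -/
theorem comap_conj_eq_iff {G H : Type*} [Group G] [Group H] (f : H →* G)
    (hf : Function.Injective f) (gens : List G) (U : GWord) (X : List GWord) (Y : Subgroup G)
    (hY : Y = GWord.span gens (conjWords U X) ⊓ f.range) (K : Subgroup H) :
    (GWord.span gens X).comap ((MulAut.conj (GWord.eval gens U)).toMonoidHom.comp f) = K ↔
      Y = K.map f := by
  have h : (GWord.span gens X).comap ((MulAut.conj (GWord.eval gens U)).toMonoidHom.comp f) =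
      (GWord.span gens (conjWords U X)).comap f := by
    ext c
    rw [Subgroup.mem_comap, Subgroup.mem_comap, mem_span_conjWords]
    rfl
  rw [h, hY, inf_comm, ← Subgroup.map_comap_eq]
  exact (Subgroup.map_injective hf).eq_iff.symm

/-- Guess generators `K` of the common subgroup of the edge group, and confirm that `α(K)` and
`ω(K)` generate the two intersections delivered by condition 4. A suitable `K` exists by condition
2. -/
theorem Benign.re_comap (hA : Benign M) {α : Type*} [Primcodable α] {a b : Γ.V} (e : Γ.E a b)
    {X Y : α → List GWord} {U V : α → GWord} (hX : Computable X) (hY : Computable Y)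
    (hU : Computable U) (hV : Computable V) :
    RE fun x => (GWord.span (M.vGens a) (X x)).comap ((MulAut.conj
        (GWord.eval (M.vGens a) (U x))).toMonoidHom.comp (A.α e)) =
      (GWord.span (M.vGens b) (Y x)).comap ((MulAut.conj
        (GWord.eval (M.vGens b) (V x))⁻¹).toMonoidHom.comp (A.ω e)) := by
  obtain ⟨F, hF, hF'⟩ := hA.intersection e
  obtain ⟨F₂, hF₂, hF₂'⟩ := hA.intersection (Γ.inv e)
  have hrange : (A.α (Γ.inv e)).range = (A.ω e).range := by
    obtain ⟨φ, hφ⟩ := A.inv_edge e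
    ext g
    constructor
    · rintro ⟨c, rfl⟩
      obtain ⟨c, rfl⟩ := φ.surjective c
      exact ⟨c, (hφ c).1.symm⟩
    · rintro ⟨c, rfl⟩
      exact ⟨φ c, (hφ c).1⟩
  rw [hrange] at hF₂'
  have h : RE fun x => ∃ K : List GWord,
      wordSpan (fun i => (M.vGens a).getD i 1) (F (conjWords (U x) (X x))) =
        wordSpan (fun i => (M.vGens a).getD i 1)
          (K.map (wordSubst fun i => (M.αWords e).getD i [])) ∧
      wordSpan (fun i => (M.vGens b).getD i 1) (F₂ (conjWords (wordInv (V x)) (Y x))) =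
        wordSpan (fun i => (M.vGens b).getD i 1)
          (K.map (wordSubst fun i => (M.ωWords e).getD i [])) := by
    refine RE.ex (RE.and ?_ ?_)
    · exact RE.wordSpan_eq (hA.re_eval_eq_one e) (by fun_prop)
        (computable_map_subst _ (by fun_prop))
    · exact RE.wordSpan_eq (hA.re_eval_eq_one (Γ.inv e)) (by fun_prop)
        (computable_map_subst _ (by fun_prop))
  refine h.of_iff fun x => ?_
  simp only [← GWord.span_eq_wordSpan, span_map_subst (A.α e) _ _ _ (M.eval_αWords e),
    span_map_subst (A.ω e) _ _ _ (M.eval_ωWords e)]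
  have h1 := comap_conj_eq_iff (A.α e) (A.α_injective e) (M.vGens a) (U x) (X x) _ (hF' _)
  have h2 := comap_conj_eq_iff (A.ω e) (A.ω_injective e) (M.vGens b) (wordInv (V x)) (Y x) _
    (hF₂' _)
  have hinv : GWord.eval (M.vGens b) (wordInv (V x)) = (GWord.eval (M.vGens b) (V x))⁻¹ :=
    wordVal_inv (fun i => (M.vGens b).getD i 1) _
  rw [hinv] at h2
  simp only [← h1, ← h2]
  constructor
  · intro h
    obtain ⟨K, hK⟩ := GWord.exists_span_eq (M.eGens_closure e) (hA.noetherian e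
      ((GWord.span (M.vGens a) (X x)).comap ((MulAut.conj
        (GWord.eval (M.vGens a) (U x))).toMonoidHom.comp (A.α e))))
    exact ⟨K, hK.symm, h ▸ hK.symm⟩
  · rintro ⟨K, h, h'⟩
    rw [h, h']

end GraphOfGroups

/-! ## Certificates for cosets -/

namespace AGraphCode

variable (C : AGraphCode)

/-- The type of a vertex. -/
def vTyp (i : ℕ) : ℕ := (C.1.getD i (0, [])).1
/-- The generating words of the group of a vertex. -/
def vGrp (i : ℕ) : List GWord := (C.1.getD i (0, [])).2
/-- The record of an edge. -/
def edge (k : ℕ) : EdgeCode := C.2.1.getD k ((0, 0, 0), 0, [], [])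
/-- The origin of an edge. -/
def org (k : ℕ) : ℕ := (C.edge k).1.1
/-- The terminus of an edge. -/
def ter (k : ℕ) : ℕ := (C.edge k).1.2.1
/-- The inverse of an edge. -/
def inv (k : ℕ) : ℕ := (C.edge k).1.2.2
/-- The type of an edge. -/
def eTyp (k : ℕ) : ℕ := (C.edge k).2.1
/-- The word for the label of an edge at its origin. -/
def wα (k : ℕ) : GWord := (C.edge k).2.2.1
/-- The word for the label of an edge at its terminus. -/
def wω (k : ℕ) : GWord := (C.edge k).2.2.2

section Computable

variable {α : Type*} [Primcodable α] {f : α → AGraphCode} {g : α → ℕ}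

@[fun_prop] theorem computable_vTyp (hf : Computable f) (hg : Computable g) :
    Computable fun x => (f x).vTyp (g x) := by unfold vTyp; fun_prop

@[fun_prop] theorem computable_vGrp (hf : Computable f) (hg : Computable g) :
    Computable fun x => (f x).vGrp (g x) := by unfold vGrp; fun_prop

@[fun_prop] theorem computable_edge (hf : Computable f) (hg : Computable g) :
    Computable fun x => (f x).edge (g x) := by unfold edge; fun_prop

@[fun_prop] theorem computable_org (hf : Computable f) (hg : Computable g) :
    Computable fun x => (f x).org (g x) := by unfold org; fun_prop

@[fun_prop] theorem computable_ter (hf : Computable f) (hg : Computable g) :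
    Computable fun x => (f x).ter (g x) := by unfold ter; fun_prop

@[fun_prop] theorem computable_inv (hf : Computable f) (hg : Computable g) :
    Computable fun x => (f x).inv (g x) := by unfold inv; fun_prop

@[fun_prop] theorem computable_eTyp (hf : Computable f) (hg : Computable g) :
    Computable fun x => (f x).eTyp (g x) := by unfold eTyp; fun_prop

@[fun_prop] theorem computable_wα (hf : Computable f) (hg : Computable g) :
    Computable fun x => (f x).wα (g x) := by unfold wα; fun_prop

@[fun_prop] theorem computable_wω (hf : Computable f) (hg : Computable g) :
    Computable fun x => (f x).wω (g x) := by unfold wω; fun_prop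

end Computable

end AGraphCode

namespace GraphOfGroups

variable {Γ : SerreGraph.{u}} {A : GraphOfGroups.{u, v, w} Γ}

/-! ### Certificates and their enumerability -/

namespace Marking

variable (M : A.Marking) {v₀ : Γ.V} (τ : ∀ a, A.Path v₀ a)

/-- One step of a path in the graph of groups described by a code, together with the word for
the corresponding path in `A`. -/
def PathStep (C : AGraphCode) (s t : ℕ × LWord) : Prop :=
  (∃ a : Γ.V, s.1 < C.1.length ∧ C.vTyp s.1 = M.vNum a ∧ t.1 = s.1 ∧ ∃ U ∈ C.vGrp s.1,
    t.2 = s.2 ++ M.emb a U ∨ t.2 = s.2 ++ M.emb a (wordInv U)) ∨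
  ∃ e : Γ.Edge, ∃ k, k < C.2.1.length ∧ C.eTyp k = M.eNum e ∧ C.org k = s.1 ∧ C.ter k = t.1 ∧
    t.2 = s.2 ++ (M.emb e.1 (C.wα k) ++ M.edgeWord e.2.2 ++ M.emb e.2.1 (C.wω k))

/-- The code describes a path from `i` to `j` that represents `g`. -/
def Reaches (C : AGraphCode) (i j : ℕ) (g : A.π₁ v₀) : Prop :=
  ∃ W : LWord, M.val τ W = g ∧ Relation.ReflTransGen (M.PathStep C) (i, []) (j, W)

/-- Edge number `k` of a code is well formed and has type `e`. -/
structure EdgeWF (C : AGraphCode) (k : ℕ) (e : Γ.Edge) : Prop where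
  eTyp : C.eTyp k = M.eNum e
  org_lt : C.org k < C.1.length
  ter_lt : C.ter k < C.1.length
  inv_lt : C.inv k < C.2.1.length
  inv_ne : C.inv k ≠ k
  inv_inv : C.inv (C.inv k) = k
  org_inv : C.org (C.inv k) = C.ter k
  eTyp_inv : C.eTyp (C.inv k) = M.eNum ⟨e.2.1, e.1, Γ.inv e.2.2⟩
  vTyp_org : C.vTyp (C.org k) = M.vNum e.1
  vTyp_ter : C.vTyp (C.ter k) = M.vNum e.2.1
  wα_inv : C.wα (C.inv k) = wordInv (C.wω k)

/-- The conditions for a code to describe a folded graph that represents the coset of `x` modulo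
the subgroup `H` generated by `X`, where vertex `i` is labelled by the element `γ i`. -/
structure IsCert (X : List LWord) (x : LWord) (C : AGraphCode) (γ : List LWord) : Prop where
  vertex : ∀ i < C.1.length, ∃ a : Γ.V, C.vTyp i = M.vNum a ∧ ∀ W ∈ C.vGrp i,
    M.val τ (γ.getD i [] ++ M.emb a W ++ wordInv (γ.getD i [])) ∈ wordSpan (M.letterVal τ) X
  edge : ∀ k < C.2.1.length, ∃ e : Γ.Edge, M.EdgeWF C k e ∧
    M.val τ (γ.getD (C.org k) [] ++ (M.emb e.1 (C.wα k) ++ M.edgeWord e.2.2 ++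
      M.emb e.2.1 (C.wω k)) ++ wordInv (γ.getD (C.ter k) [])) ∈ wordSpan (M.letterVal τ) X ∧
    (GWord.span (M.vGens e.1) (C.vGrp (C.org k))).comap ((MulAut.conj
        (GWord.eval (M.vGens e.1) (C.wα k))).toMonoidHom.comp (A.α e.2.2)) =
      (GWord.span (M.vGens e.2.1) (C.vGrp (C.ter k))).comap ((MulAut.conj
        (GWord.eval (M.vGens e.2.1) (C.wω k))⁻¹).toMonoidHom.comp (A.ω e.2.2)) ∧
    ∀ l < C.2.1.length, l = k ∨ C.org l ≠ C.org k ∨ C.eTyp l ≠ C.eTyp k ∨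
      ∀ b ∈ GWord.span (M.vGens e.1) (C.vGrp (C.org k)), ∀ c,
        GWord.eval (M.vGens e.1) (C.wα l) ≠ b * GWord.eval (M.vGens e.1) (C.wα k) * A.α e.2.2 c
  ux_lt : C.2.2.1 < C.1.length
  u0_lt : C.2.2.2 < C.1.length
  ux_ne : C.2.2.1 ≠ C.2.2.2
  ux_typ : C.vTyp C.2.2.1 = M.vNum v₀
  u0_typ : C.vTyp C.2.2.2 = M.vNum v₀
  u0_mem : M.val τ (γ.getD C.2.2.2 []) ∈ wordSpan (M.letterVal τ) X
  ux_mem : M.val τ (γ.getD C.2.2.1 [] ++ x) ∈ wordSpan (M.letterVal τ) X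
  reaches_x : M.Reaches τ C C.2.2.1 C.2.2.2 (M.val τ x)
  reaches : ∀ W ∈ X, M.Reaches τ C C.2.2.2 C.2.2.2 (M.val τ W)

theorem edgeWF_iff (C : AGraphCode) (k : ℕ) (e : Γ.Edge) : M.EdgeWF C k e ↔
    C.eTyp k = M.eNum e ∧ C.org k < C.1.length ∧ C.ter k < C.1.length ∧
    C.inv k < C.2.1.length ∧ C.inv k ≠ k ∧ C.inv (C.inv k) = k ∧ C.org (C.inv k) = C.ter k ∧
    C.eTyp (C.inv k) = M.eNum ⟨e.2.1, e.1, Γ.inv e.2.2⟩ ∧ C.vTyp (C.org k) = M.vNum e.1 ∧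
    C.vTyp (C.ter k) = M.vNum e.2.1 ∧ C.wα (C.inv k) = wordInv (C.wω k) :=
  ⟨fun ⟨h1, h2, h3, h4, h5, h6, h7, h8, h9, h10, h11⟩ =>
    ⟨h1, h2, h3, h4, h5, h6, h7, h8, h9, h10, h11⟩,
    fun ⟨h1, h2, h3, h4, h5, h6, h7, h8, h9, h10, h11⟩ =>
      ⟨h1, h2, h3, h4, h5, h6, h7, h8, h9, h10, h11⟩⟩

theorem re_edgeWF (e : Γ.Edge) : RE fun x : AGraphCode × ℕ => M.EdgeWF x.1 x.2 e := by
  simp only [edgeWF_iff]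
  exact (RE.eq (by fun_prop) (by fun_prop)).and <| (RE.lt (by fun_prop) (by fun_prop)).and <|
    (RE.lt (by fun_prop) (by fun_prop)).and <| (RE.lt (by fun_prop) (by fun_prop)).and <|
    (RE.ne (by fun_prop) (by fun_prop)).and <| (RE.eq (by fun_prop) (by fun_prop)).and <|
    (RE.eq (by fun_prop) (by fun_prop)).and <| (RE.eq (by fun_prop) (by fun_prop)).and <|
    (RE.eq (by fun_prop) (by fun_prop)).and <| (RE.eq (by fun_prop) (by fun_prop)).and <|
    (RE.eq (by fun_prop) (by fun_prop))

theorem re_pathStep : RE fun x : AGraphCode × (ℕ × LWord) × (ℕ × LWord) =>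
    M.PathStep x.1 x.2.1 x.2.2 := by
  have := M.finite_vertex
  have := M.finite_edge
  refine RE.or (RE.ex_finite fun a => ?_) (RE.ex_finite fun e => RE.ex ?_)
  · exact (RE.lt (by fun_prop) (by fun_prop)).and <| (RE.eq (by fun_prop) (by fun_prop)).and <|
      (RE.eq (by fun_prop) (by fun_prop)).and <| RE.bex_list (by fun_prop) <|
      (RE.eq (by fun_prop) (by fun_prop)).or (RE.eq (by fun_prop) (by fun_prop))
  · exact (RE.lt (by fun_prop) (by fun_prop)).and <| (RE.eq (by fun_prop) (by fun_prop)).and <|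
      (RE.eq (by fun_prop) (by fun_prop)).and <| (RE.eq (by fun_prop) (by fun_prop)).and <|
      (RE.eq (by fun_prop) (by fun_prop))

variable {M τ}

theorem re_reaches (hG : RE fun W : LWord => wordVal (M.letterVal τ) W = 1) {α : Type*}
    [Primcodable α] {C : α → AGraphCode} {i j : α → ℕ} {W : α → LWord} (hC : Computable C)
    (hi : Computable i) (hj : Computable j) (hW : Computable W) :
    RE fun x => M.Reaches τ (C x) (i x) (j x) (M.val τ (W x)) := by
  refine RE.ex (RE.and (RE.wordVal_eq hG (by fun_prop) (by fun_prop)) ?_)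
  exact (RE.reflTransGen (r := M.PathStep) M.re_pathStep).comp
    (g := fun x : α × LWord => (C x.1, (i x.1, ([] : LWord)), (j x.1, x.2))) (by fun_prop)

theorem isCert_iff (X : List LWord) (x : LWord) (C : AGraphCode) (γ : List LWord) :
    M.IsCert τ X x C γ ↔
  (∀ i < C.1.length, ∃ a : Γ.V, C.vTyp i = M.vNum a ∧ ∀ W ∈ C.vGrp i,
    M.val τ (γ.getD i [] ++ M.emb a W ++ wordInv (γ.getD i [])) ∈ wordSpan (M.letterVal τ) X) ∧
  (∀ k < C.2.1.length, ∃ e : Γ.Edge, M.EdgeWF C k e ∧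
    M.val τ (γ.getD (C.org k) [] ++ (M.emb e.1 (C.wα k) ++ M.edgeWord e.2.2 ++
      M.emb e.2.1 (C.wω k)) ++ wordInv (γ.getD (C.ter k) [])) ∈ wordSpan (M.letterVal τ) X ∧
    (GWord.span (M.vGens e.1) (C.vGrp (C.org k))).comap ((MulAut.conj
        (GWord.eval (M.vGens e.1) (C.wα k))).toMonoidHom.comp (A.α e.2.2)) =
      (GWord.span (M.vGens e.2.1) (C.vGrp (C.ter k))).comap ((MulAut.conj
        (GWord.eval (M.vGens e.2.1) (C.wω k))⁻¹).toMonoidHom.comp (A.ω e.2.2)) ∧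
    ∀ l < C.2.1.length, l = k ∨ C.org l ≠ C.org k ∨ C.eTyp l ≠ C.eTyp k ∨
      ∀ b ∈ GWord.span (M.vGens e.1) (C.vGrp (C.org k)), ∀ c,
        GWord.eval (M.vGens e.1) (C.wα l) ≠
          b * GWord.eval (M.vGens e.1) (C.wα k) * A.α e.2.2 c) ∧
  C.2.2.1 < C.1.length ∧ C.2.2.2 < C.1.length ∧ C.2.2.1 ≠ C.2.2.2 ∧
  C.vTyp C.2.2.1 = M.vNum v₀ ∧ C.vTyp C.2.2.2 = M.vNum v₀ ∧
  M.val τ (γ.getD C.2.2.2 []) ∈ wordSpan (M.letterVal τ) X ∧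
  M.val τ (γ.getD C.2.2.1 [] ++ x) ∈ wordSpan (M.letterVal τ) X ∧
  M.Reaches τ C C.2.2.1 C.2.2.2 (M.val τ x) ∧
  ∀ W ∈ X, M.Reaches τ C C.2.2.2 C.2.2.2 (M.val τ W) :=
  ⟨fun ⟨h1, h2, h3, h4, h5, h6, h7, h8, h9, h10, h11⟩ =>
    ⟨h1, h2, h3, h4, h5, h6, h7, h8, h9, h10, h11⟩,
    fun ⟨h1, h2, h3, h4, h5, h6, h7, h8, h9, h10, h11⟩ =>
      ⟨h1, h2, h3, h4, h5, h6, h7, h8, h9, h10, h11⟩⟩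

/-- All clauses except the two on foldedness are bounded combinations of comparisons and guessed
words or paths; those two rest on `Benign.re_comap` and `Benign.re_coset`. -/
theorem re_isCert (hA : Benign M) (hG : RE fun W : LWord => wordVal (M.letterVal τ) W = 1) :
    RE fun x : (List LWord × LWord) × AGraphCode × List LWord =>
      M.IsCert τ x.1.1 x.1.2 x.2.1 x.2.2 := by
  have := M.finite_vertex
  have := M.finite_edge
  simp only [isCert_iff]
  refine RE.and ?_ <| RE.and ?_ <| (RE.lt (by fun_prop) (by fun_prop)).and <|
    (RE.lt (by fun_prop) (by fun_prop)).and <| (RE.ne (by fun_prop) (by fun_prop)).and <|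
    (RE.eq (by fun_prop) (by fun_prop)).and <| (RE.eq (by fun_prop) (by fun_prop)).and <|
    (RE.mem_wordSpan hG (by fun_prop) (by fun_prop)).and <|
    (RE.mem_wordSpan hG (by fun_prop) (by fun_prop)).and <|
    (re_reaches hG (by fun_prop) (by fun_prop) (by fun_prop) (by fun_prop)).and <|
    RE.ball_list (by fun_prop)
      (re_reaches hG (by fun_prop) (by fun_prop) (by fun_prop) (by fun_prop))
  · refine RE.ball_lt (by fun_prop) (RE.ex_finite fun a => ?_)
    exact (RE.eq (by fun_prop) (by fun_prop)).and <| RE.ball_list (by fun_prop) <|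
      RE.mem_wordSpan hG (by fun_prop) (by fun_prop)
  · refine RE.ball_lt (by fun_prop) (RE.ex_finite fun e => ?_)
    refine RE.and ((M.re_edgeWF e).comp (g := fun x :
      ((List LWord × LWord) × AGraphCode × List LWord) × ℕ => (x.1.2.1, x.2)) (by fun_prop)) ?_
    refine (RE.mem_wordSpan hG (by fun_prop) (by fun_prop)).and <| (hA.re_comap e.2.2
      (by fun_prop) (by fun_prop) (by fun_prop) (by fun_prop)).and <|
      RE.ball_lt (by fun_prop) ?_
    exact (RE.eq (by fun_prop) (by fun_prop)).or <| (RE.ne (by fun_prop) (by fun_prop)).or <|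
      (RE.ne (by fun_prop) (by fun_prop)).or <|
      hA.re_coset e.2.2 (by fun_prop) (by fun_prop) (by fun_prop)

end Marking

end GraphOfGroups

/-! ## The graph described by a certificate -/

namespace AGraph

open GraphOfGroups

variable {Γ : SerreGraph.{u}} {A : GraphOfGroups.{u, v, w} Γ}

/-! ### Group elements represented by paths in an `A`-graph -/

section Loop

variable {v₀ : Γ.V} (τ : ∀ a, A.Path v₀ a) (𝔹 : AGraph A)

/-- The elements of the fundamental group represented by the paths from `a` to `b`. -/
def loops (a b : 𝔹.B.V) : Set (A.π₁ v₀) :=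
  {g | ∃ q : 𝔹.toGraphOfGroups.Path a b, toLoop τ (𝔹.μ q) = g}

theorem LAt_eq_loops (hτ : τ v₀ = Path.single 1) {a b : 𝔹.B.V} (ha : 𝔹.typ a = v₀)
    (hb : 𝔹.typ b = v₀) : 𝔹.LAt v₀ a b ha hb = 𝔹.loops τ a b := by
  ext g
  constructor
  · rintro ⟨x, hx, rfl⟩
    obtain ⟨q, rfl⟩ := (𝔹.mem_L_iff x).1 hx
    exact ⟨q, (cast_cls τ hτ ha hb _).symm⟩
  · rintro ⟨q, rfl⟩
    exact ⟨_, (𝔹.mem_L_iff _).2 ⟨q, rfl⟩, cast_cls τ hτ ha hb _⟩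

variable {τ 𝔹}

theorem one_mem_loops (a : 𝔹.B.V) : (1 : A.π₁ v₀) ∈ 𝔹.loops τ a a :=
  ⟨Path.single 1, toLoop_one τ⟩

theorem mul_mem_loops {a b c : 𝔹.B.V} {g h : A.π₁ v₀} (hg : g ∈ 𝔹.loops τ a b)
    (hh : h ∈ 𝔹.loops τ b c) : g * h ∈ 𝔹.loops τ a c := by
  obtain ⟨q, rfl⟩ := hg
  obtain ⟨r, rfl⟩ := hh
  exact ⟨q.comp r, by rw [μ_comp, toLoop_comp]⟩

theorem inv_mem_loops {a b : 𝔹.B.V} {g : A.π₁ v₀} (hg : g ∈ 𝔹.loops τ a b) :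
    g⁻¹ ∈ 𝔹.loops τ b a := by
  obtain ⟨q, rfl⟩ := hg
  refine ⟨q.symm, ?_⟩
  rw [eq_inv_iff_mul_eq_one, ← toLoop_comp, ← μ_comp,
    toLoop_congr τ (𝔹.μ_equiv (Path.symm_comp q))]
  exact toLoop_one τ

theorem loops_swap (a b : 𝔹.B.V) : 𝔹.loops τ b a = (𝔹.loops τ a b)⁻¹ := by
  ext g
  exact ⟨fun h => inv_mem_loops h, fun h => inv_inv g ▸ inv_mem_loops h⟩

/-- This makes the two outcomes of the search exclusive: a coset joining different vertices of a
folded graph contains no element of length zero. -/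
theorem IsFolded.eq_of_vertexHom_mem (h𝔹 : 𝔹.IsFolded) {a b : 𝔹.B.V} (ha : 𝔹.typ a = v₀)
    (hb : 𝔹.typ b = v₀) {y : A.GV v₀} (hy : vertexHom τ v₀ y ∈ 𝔹.loops τ a b) : a = b := by
  obtain ⟨q, hq⟩ := hy
  have : ∀ {a b : Γ.V}, a = v₀ → b = v₀ →
      ∃ r : A.Path a b, r.length = 0 ∧ toLoop τ r = vertexHom τ v₀ y := by
    rintro _ _ rfl rfl
    exact ⟨Path.single y, rfl, rfl⟩
  obtain ⟨r, hr, hr'⟩ := this ha hb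
  exact h𝔹.eq_of_length_eq_zero q r hr (equiv_of_toLoop_eq τ (hq.trans hr'.symm))

theorem vertexHom_mem_loops {a : 𝔹.B.V} {g : A.GV (𝔹.typ a)} (hg : g ∈ 𝔹.grp a) :
    vertexHom τ _ g ∈ 𝔹.loops τ a a :=
  ⟨Path.single (⟨g, hg⟩ : 𝔹.grp a), rfl⟩

theorem edge_mem_loops {a b : 𝔹.B.V} (f : 𝔹.B.E a b) :
    vertexHom τ _ (𝔹.lα f) * edgeElt τ (𝔹.etyp f) * vertexHom τ _ (𝔹.lω f) ∈ 𝔹.loops τ a b := by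
  refine ⟨Path.cons (1 : 𝔹.grp a) f (Path.single (1 : 𝔹.grp b)), ?_⟩
  simp only [μ, toLoop_cons, toLoop_comp, toLoop_single]
  simp

/-- Labels of the vertices by group elements that are compatible with a subgroup bound the
elements represented by paths. -/
theorem mem_of_mem_loops {H : Subgroup (A.π₁ v₀)} (γ : 𝔹.B.V → A.π₁ v₀)
    (hv : ∀ a, ∀ g ∈ 𝔹.grp a, γ a * vertexHom τ _ g * (γ a)⁻¹ ∈ H)
    (he : ∀ a b (f : 𝔹.B.E a b), γ a * (vertexHom τ _ (𝔹.lα f) * edgeElt τ (𝔹.etyp f) *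
      vertexHom τ _ (𝔹.lω f)) * (γ b)⁻¹ ∈ H) {a b : 𝔹.B.V} {g : A.π₁ v₀}
    (hg : g ∈ 𝔹.loops τ a b) : γ a * g * (γ b)⁻¹ ∈ H := by
  obtain ⟨q, rfl⟩ := hg
  induction q with
  | single g => exact hv _ _ g.2
  | @cons a b c g f q ih =>
    have := H.mul_mem (H.mul_mem (hv a g.1 g.2) (he a b f)) ih
    simp only [μ, toLoop_cons, toLoop_comp, toLoop_single, map_mul]
    convert this using 1
    group

end Loop

/-- The edges of the graph described by a code. -/
abbrev CodeEdge (C : AGraphCode) (i j : Fin C.1.length) : Type :=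
  {k : Fin C.2.1.length // C.org k = i ∧ C.ter k = j}

/-- The conditions on the inversion of edges for a code to describe a graph. -/
structure _root_.AGraphCode.InvWF (C : AGraphCode) (k : ℕ) : Prop where
  inv_lt : C.inv k < C.2.1.length
  inv_ne : C.inv k ≠ k
  inv_inv : C.inv (C.inv k) = k
  org_inv : C.org (C.inv k) = C.ter k
  wα_inv : C.wα (C.inv k) = wordInv (C.wω k)

/-- The inverse of an edge of the graph described by a code. -/
def CodeEdge.inv {C : AGraphCode} (hC : ∀ k < C.2.1.length, C.InvWF k) {i j : Fin C.1.length}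
    (f : CodeEdge C i j) : CodeEdge C j i :=
  ⟨⟨C.inv f.1, (hC _ f.1.2).inv_lt⟩, (hC _ f.1.2).org_inv.trans f.2.2, by
    have h := (hC _ (hC _ f.1.2).inv_lt).org_inv
    rw [(hC _ f.1.2).inv_inv] at h
    exact h.symm.trans f.2.1⟩

/-- The `A`-graph described by a code. -/
def ofCode (M : A.Marking) (C : AGraphCode) (typ : Fin C.1.length → Γ.V)
    (hC : ∀ k < C.2.1.length, C.InvWF k)
    (etyp : ∀ {i j : Fin C.1.length}, CodeEdge C i j → Γ.E (typ i) (typ j))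
    (hetyp : ∀ {i j : Fin C.1.length} (f : CodeEdge C i j),
      etyp (f.inv hC) = Γ.inv (etyp f)) : AGraph A where
  B := {
    V := Fin C.1.length
    E := CodeEdge C
    inv := CodeEdge.inv hC
    inv_inv := fun f => Subtype.ext (Fin.ext (hC _ f.1.2).inv_inv)
    inv_ne := fun f h => (hC _ f.1.2).inv_ne (congrArg (fun f => (f.1 : ℕ)) h) }
  typ := typ
  etyp := etyp
  etyp_inv := hetyp
  grp i := GWord.span (M.vGens (typ i)) (C.vGrp i)
  lα {i _} f := GWord.eval (M.vGens (typ i)) (C.wα f.1)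
  lω {_ j} f := GWord.eval (M.vGens (typ j)) (C.wω f.1)
  lα_inv {i j} f := by
    change GWord.eval (M.vGens (typ j)) (C.wα (C.inv f.1)) = _
    rw [(hC _ f.1.2).wα_inv]
    exact wordVal_inv (fun i => (M.vGens (typ j)).getD i 1) _

theorem describes_ofCode (M : A.Marking) (C : AGraphCode) (typ : Fin C.1.length → Γ.V)
    (hC : ∀ k < C.2.1.length, C.InvWF k)
    (etyp : ∀ {i j : Fin C.1.length}, CodeEdge C i j → Γ.E (typ i) (typ j))
    (hetyp : ∀ {i j : Fin C.1.length} (f : CodeEdge C i j), etyp (f.inv hC) = Γ.inv (etyp f))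
    (hlt : ∀ k < C.2.1.length, C.org k < C.1.length ∧ C.ter k < C.1.length)
    (htyp : ∀ i : Fin C.1.length, C.vTyp i = M.vNum (typ i))
    (hnum : ∀ {i j : Fin C.1.length} (f : CodeEdge C i j),
      C.eTyp f.1 = M.eNum ⟨_, _, etyp f⟩) (i j : Fin C.1.length)
    (hi : C.2.2.1 = i) (hj : C.2.2.2 = j) :
    M.DescribesAGraph C (ofCode M C typ hC etyp hetyp) i j := by
  let ne : (ofCode M C typ hC etyp hetyp).B.Edge ≃ Fin C.2.1.length :=
    { toFun := fun f => f.2.2.1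
      invFun := fun k => ⟨⟨C.org k, (hlt k k.2).1⟩, ⟨C.ter k, (hlt k k.2).2⟩, k, rfl, rfl⟩
      left_inv := by
        rintro ⟨⟨i, hi⟩, ⟨j, hj⟩, k, h1, h2⟩
        dsimp only at h1 h2
        subst h1
        subst h2
        rfl
      right_inv := fun k => rfl }
  refine ⟨Equiv.refl _, ne, ?_, ?_, Prod.ext hi hj⟩
  · intro (i : Fin C.1.length)
    have : C.1.get i = C.1.getD i (0, []) := by simp [List.getD]
    refine ⟨?_, ?_⟩
    · exact (congrArg Prod.fst this).trans (htyp i)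
    · exact congrArg (GWord.span _) (congrArg Prod.snd this).symm
  · intro i j f
    refine ⟨C.wα f.1, C.wω f.1, ?_, rfl, rfl⟩
    have : C.2.1.get f.1 = C.edge f.1 := by simp [AGraphCode.edge, List.getD]
    refine Eq.trans this ?_
    exact Prod.ext (Prod.ext f.2.1 (Prod.ext f.2.2 rfl)) (Prod.ext (hnum f) rfl)

end AGraph

/-! ### From a certificate to a folded `A`-graph -/

namespace GraphOfGroups.Marking

open AGraph

variable {Γ : SerreGraph.{u}} {A : GraphOfGroups.{u, v, w} Γ} {M : A.Marking} {v₀ : Γ.V}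
  {τ : ∀ a, A.Path v₀ a}

/-- A certificate yields a folded graph that represents the coset. -/
theorem IsCert.exists_agraph {X : List LWord} {x : LWord} {C : AGraphCode} {γ : List LWord}
    (h : M.IsCert τ X x C γ) : ∃ (𝔹 : AGraph A) (ux u0 : 𝔹.B.V), 𝔹.typ ux = v₀ ∧
      𝔹.typ u0 = v₀ ∧ ux ≠ u0 ∧ M.DescribesAGraph C 𝔹 ux u0 ∧ 𝔹.IsFolded ∧
      𝔹.loops τ ux u0 = M.val τ x • (wordSpan (M.letterVal τ) X : Set (A.π₁ v₀)) := by
  set H := wordSpan (M.letterVal τ) X with hH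
  choose typ htyp hgrp using fun i : Fin C.1.length => h.vertex i i.2
  -- The edge of `Γ` named in the certificate has endpoints known only through their numbers;
  -- identifying these with the chosen vertex types lets edge types be selected over `typ i` and
  -- `typ j`.
  have hE : ∀ {i j : Fin C.1.length} (f : CodeEdge C i j), ∃ e : Γ.E (typ i) (typ j),
      M.EdgeWF C f.1 ⟨_, _, e⟩ ∧
      M.val τ (γ.getD i [] ++ (M.emb (typ i) (C.wα f.1) ++ M.edgeWord e ++
        M.emb (typ j) (C.wω f.1)) ++ wordInv (γ.getD j [])) ∈ H ∧
      (GWord.span (M.vGens (typ i)) (C.vGrp i)).comap ((MulAut.conj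
          (GWord.eval (M.vGens (typ i)) (C.wα f.1))).toMonoidHom.comp (A.α e)) =
        (GWord.span (M.vGens (typ j)) (C.vGrp j)).comap ((MulAut.conj
          (GWord.eval (M.vGens (typ j)) (C.wω f.1))⁻¹).toMonoidHom.comp (A.ω e)) ∧
      ∀ l < C.2.1.length, l = f.1 ∨ C.org l ≠ i ∨ C.eTyp l ≠ C.eTyp f.1 ∨
        ∀ b ∈ GWord.span (M.vGens (typ i)) (C.vGrp i), ∀ c,
          GWord.eval (M.vGens (typ i)) (C.wα l) ≠
            b * GWord.eval (M.vGens (typ i)) (C.wα f.1) * A.α e c := by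
    rintro i j ⟨k, hi, hj⟩
    obtain ⟨⟨a, b, e⟩, he⟩ := h.edge k k.2
    have ha : a = typ i := by
      have := he.1.vTyp_org
      rw [hi, htyp] at this
      exact (M.vNum.injective (Fin.ext this)).symm
    have hb : b = typ j := by
      have := he.1.vTyp_ter
      rw [hj, htyp] at this
      exact (M.vNum.injective (Fin.ext this)).symm
    subst ha
    subst hb
    rw [hi, hj] at he
    exact ⟨e, he⟩
  choose etyp hwf hlab hfoldII hfoldI using @hE
  have hedge : ∀ k (hk : k < C.2.1.length), ∃ (i j : Fin C.1.length) (f : CodeEdge C i j),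
      (f.1 : ℕ) = k := by
    intro k hk
    obtain ⟨e, he, -⟩ := h.edge k hk
    exact ⟨⟨_, he.org_lt⟩, ⟨_, he.ter_lt⟩, ⟨⟨k, hk⟩, rfl, rfl⟩, rfl⟩
  have hC : ∀ k < C.2.1.length, C.InvWF k := by
    intro k hk
    obtain ⟨e, he, -⟩ := h.edge k hk
    exact ⟨he.inv_lt, he.inv_ne, he.inv_inv, he.org_inv, he.wα_inv⟩
  have hlt : ∀ k < C.2.1.length, C.org k < C.1.length ∧ C.ter k < C.1.length := by
    intro k hk
    obtain ⟨e, he, -⟩ := h.edge k hk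
    exact ⟨he.org_lt, he.ter_lt⟩
  have hinv : ∀ {i j : Fin C.1.length} (f : CodeEdge C i j),
      etyp (f.inv hC) = Γ.inv (etyp f) := by
    intro i j f
    have h1 := (hwf (f.inv hC)).eTyp
    have h2 := (hwf f).eTyp_inv
    have := M.eNum.injective (Fin.ext (h1.symm.trans h2))
    simpa using this
  let 𝔹 : AGraph A := ofCode M C typ hC etyp hinv
  let ux : Fin C.1.length := ⟨_, h.ux_lt⟩
  let u0 : Fin C.1.length := ⟨_, h.u0_lt⟩
  have hne : ux ≠ u0 := fun hu => h.ux_ne (congrArg Fin.val hu)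
  have hux : typ ux = v₀ := M.vNum.injective (Fin.ext ((htyp ux).symm.trans h.ux_typ))
  have hu0 : typ u0 = v₀ := M.vNum.injective (Fin.ext ((htyp u0).symm.trans h.u0_typ))
  have hdesc : M.DescribesAGraph C 𝔹 ux u0 :=
    describes_ofCode M C typ hC etyp hinv hlt htyp (fun f => (hwf f).eTyp) ux u0 rfl rfl
  have hfold : 𝔹.IsFolded := by
    constructor
    · rintro ⟨a, k, d, f₁, f₂, hne, htype, b, hb, c, hc⟩
      have htype' : (⟨_, _, 𝔹.etyp (𝔹.B.inv f₁)⟩ : Γ.Edge) = ⟨_, _, 𝔹.etyp f₂⟩ := by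
        have h1 := congrArg (fun e : Γ.Edge => (⟨e.2.1, e.1, Γ.inv e.2.2⟩ : Γ.Edge)) htype
        dsimp only at h1
        rwa [← 𝔹.etyp_inv, ← 𝔹.etyp_inv, 𝔹.B.inv_inv] at h1
      have heTyp : C.eTyp f₂.1 = C.eTyp (𝔹.B.inv f₁).1 :=
        (hwf f₂).eTyp.trans ((congrArg (fun e => (M.eNum e : ℕ)) htype').symm.trans
          (hwf (𝔹.B.inv f₁)).eTyp.symm)
      -- The certificate compares edges with a common origin, so the pair to test is `f₁⁻¹`, `f₂`.
      -- An equation `f₁_ω b f₂_α = ω(c)` then says that `f₂_α` lies in the forbidden double coset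
      -- of `(f₁⁻¹)_α`.
      obtain h1 | h1 | h1 | h1 := hfoldI (𝔹.B.inv f₁) f₂.1 f₂.1.2
      · apply hne
        have hd : d = a := by
          apply Fin.ext
          rw [← f₂.2.2, h1]
          exact (𝔹.B.inv f₁).2.2
        subst hd
        have h2 : f₂ = 𝔹.B.inv f₁ := Subtype.ext (Fin.ext h1)
        rw [h2, 𝔹.B.inv_inv]
      · exact h1 f₂.2.1
      · exact h1 heTyp
      · obtain ⟨φ, hφ⟩ := A.inv_edge (𝔹.etyp f₁)
        have hinv' : 𝔹.etyp (𝔹.B.inv f₁) = Γ.inv (𝔹.etyp f₁) := 𝔹.etyp_inv f₁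
        have key : ∀ e : Γ.E (typ k) (typ a), e = Γ.inv (𝔹.etyp f₁) →
            ∃ c', A.α e c' = A.ω (𝔹.etyp f₁) c := by
          rintro _ rfl
          exact ⟨φ c, (hφ c).1⟩
        obtain ⟨c', hc'⟩ := key _ hinv'
        refine h1 b⁻¹ (inv_mem hb) c' ?_
        have h2 : 𝔹.lα f₂ = b⁻¹ * 𝔹.lα (𝔹.B.inv f₁) * A.ω (𝔹.etyp f₁) c := by
          rw [← hc, 𝔹.lα_inv]
          group
        rw [← hc'] at h2
        exact h2
    · rintro ⟨a, b, f, hf⟩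
      exact hf (hfoldII f)
  let γ' : Fin C.1.length → A.π₁ v₀ := fun i => M.val τ (γ.getD i [])
  have hvH : ∀ a, ∀ g ∈ 𝔹.grp a, γ' a * vertexHom τ _ g * (γ' a)⁻¹ ∈ H := by
    intro (i : Fin C.1.length)
    have : GWord.span (M.vGens (typ i)) (C.vGrp i) ≤
        H.comap ((MulAut.conj (γ' i)).toMonoidHom.comp (vertexHom τ (typ i))) := by
      rw [GWord.span_eq_wordSpan, wordSpan_le]
      intro W hW
      have := hgrp i W hW
      rw [val_append, val_append, val_inv, val_emb] at this
      exact this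
    exact fun g hg => this hg
  have heH : ∀ a b (f : 𝔹.B.E a b), γ' a * (vertexHom τ _ (𝔹.lα f) * edgeElt τ (𝔹.etyp f) *
      vertexHom τ _ (𝔹.lω f)) * (γ' b)⁻¹ ∈ H := by
    intro i j f
    have := hlab f
    rw [val_append, val_append, val_append, val_append, val_inv, val_emb, val_emb,
      val_edgeWord] at this
    exact this
  have hreach : ∀ (i : Fin C.1.length) (s : ℕ × LWord),
      Relation.ReflTransGen (M.PathStep C) ((i : ℕ), []) s →
        ∃ hs : s.1 < C.1.length, M.val τ s.2 ∈ 𝔹.loops τ i ⟨s.1, hs⟩ := by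
    intro i s hs
    induction hs with
    | refl => exact ⟨i.2, one_mem_loops _⟩
    | @tail s t _ hst ih =>
      obtain ⟨hs, ih⟩ := ih
      obtain ⟨j, W⟩ := t
      obtain ⟨a, -, ha, hj, U, hU, hW⟩ | ⟨e, k, hk, hke, hko, hkt, hW⟩ := hst
      · dsimp only at hj hW
        subst hj
        refine ⟨hs, ?_⟩
        obtain rfl : a = typ ⟨s.1, hs⟩ :=
          M.vNum.injective (Fin.ext (ha.symm.trans (htyp ⟨s.1, hs⟩)))
        have hmem : GWord.eval (M.vGens (typ ⟨s.1, hs⟩)) U ∈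
            GWord.span (M.vGens (typ ⟨s.1, hs⟩)) (C.vGrp s.1) := by
          rw [GWord.eval_eq_wordVal, GWord.span_eq_wordSpan]
          exact wordVal_mem_wordSpan (fun l => (M.vGens (typ ⟨s.1, hs⟩)).getD l 1) hU
        have hloop : ∀ g ∈ GWord.span (M.vGens (typ ⟨s.1, hs⟩)) (C.vGrp s.1),
            vertexHom τ (typ ⟨s.1, hs⟩) g ∈ 𝔹.loops τ (⟨s.1, hs⟩ : Fin C.1.length) ⟨s.1, hs⟩ :=
          fun g hg => vertexHom_mem_loops (𝔹 := 𝔹) (a := (⟨s.1, hs⟩ : Fin C.1.length)) hg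
        rcases hW with rfl | rfl
        · rw [val_append, val_emb]
          exact mul_mem_loops ih (hloop _ hmem)
        · rw [val_append, val_emb, GWord.eval_eq_wordVal, wordVal_inv, ← GWord.eval_eq_wordVal]
          exact mul_mem_loops ih (hloop _ (inv_mem hmem))
      · dsimp only at hkt hW
        subst hkt
        refine ⟨(hlt k hk).2, ?_⟩
        let f : CodeEdge C ⟨s.1, hs⟩ ⟨C.ter k, (hlt k hk).2⟩ := ⟨⟨k, hk⟩, hko, rfl⟩
        obtain rfl : e = ⟨_, _, etyp f⟩ := M.eNum.injective (Fin.ext (hke.symm.trans (hwf f).eTyp))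
        subst hW
        rw [val_append, val_append, val_append, val_emb, val_emb, val_edgeWord]
        exact mul_mem_loops ih (edge_mem_loops (𝔹 := 𝔹) f)
  have hreach' : ∀ (i j : Fin C.1.length) g, M.Reaches τ C i j g → g ∈ 𝔹.loops τ i j := by
    rintro i j g ⟨W, rfl, hW⟩
    exact (hreach i _ hW).2
  have hHsub : ∀ g ∈ H, g ∈ 𝔹.loops τ u0 u0 := by
    intro g hg
    induction hg using Subgroup.closure_induction with
    | mem g hg =>
      obtain ⟨W, hW, rfl⟩ := hg
      exact hreach' u0 u0 _ (h.reaches W hW)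
    | one => exact one_mem_loops _
    | mul g h _ _ ihg ihh => exact mul_mem_loops ihg ihh
    | inv g _ ih => exact inv_mem_loops ih
  refine ⟨𝔹, ux, u0, hux, hu0, hne, hdesc, hfold, ?_⟩
  ext g
  rw [Set.mem_smul_set_iff_inv_smul_mem, smul_eq_mul, SetLike.mem_coe]
  have hx0 : γ' u0 ∈ H := h.u0_mem
  have hxx : γ' ux * M.val τ x ∈ H := by
    have := h.ux_mem
    rwa [val_append] at this
  constructor
  -- The labels give `γ(u_x) g γ(u_0)⁻¹ ∈ H`; since `γ(u_x) x` and `γ(u_0)` lie in `H`, so does `x⁻¹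
  -- g`.
  · intro hg
    have h1 := mem_of_mem_loops γ' hvH heH hg
    have h2 := H.mul_mem (H.inv_mem hxx) (H.mul_mem h1 hx0)
    convert h2 using 1
    group
  -- Follow the path for `x` and then a loop at `u_0` for `x⁻¹ g ∈ H`.
  · intro hg
    have := mul_mem_loops (hreach' ux u0 _ h.reaches_x) (hHsub _ hg)
    simpa using this

end GraphOfGroups.Marking

/-! ## Existence of certificates -/

namespace GraphOfGroups

variable {Γ : SerreGraph.{u}} {A : GraphOfGroups.{u, v, w} Γ} {v₀ : Γ.V}

/-! ### The quotient of the Bass–Serre tree by a subgroup -/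

section Classes

variable (τ : ∀ a, A.Path v₀ a) (H : Subgroup (A.π₁ v₀))

/-- The orbits of a subgroup on the vertices of the Bass–Serre tree. -/
abbrev VertexClass : Type (max u v) :=
  Σ a : Γ.V, DoubleCoset.Quotient (H : Set (A.π₁ v₀)) ((vertexHom τ a).range : Set (A.π₁ v₀))

/-- The orbits of a subgroup on the edges of the Bass–Serre tree. -/
abbrev EdgeClass : Type (max u v) :=
  Σ e : Γ.Edge, DoubleCoset.Quotient (H : Set (A.π₁ v₀))
    (((vertexHom τ e.1).comp (A.α e.2.2)).range : Set (A.π₁ v₀))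

/-- The orbit of the vertex of type `a` given by `g`. -/
def vMk (a : Γ.V) (g : A.π₁ v₀) : VertexClass τ H := ⟨a, DoubleCoset.mk _ _ g⟩

/-- The orbit of the edge of type `e` given by `g`. -/
def eMk (e : Γ.Edge) (g : A.π₁ v₀) : EdgeClass τ H := ⟨e, DoubleCoset.mk _ _ g⟩

variable {τ H}

theorem vMk_eq_iff {a : Γ.V} {g g' : A.π₁ v₀} :
    vMk τ H a g = vMk τ H a g' ↔ ∃ h ∈ H, ∃ k, g' = h * g * vertexHom τ a k := by
  simp only [vMk, Sigma.mk.injEq, heq_eq_eq, true_and, DoubleCoset.eq]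
  constructor
  · rintro ⟨h, hh, _, ⟨k, rfl⟩, hg⟩
    exact ⟨h, hh, k, hg⟩
  · rintro ⟨h, hh, k, hg⟩
    exact ⟨h, hh, _, ⟨k, rfl⟩, hg⟩

theorem eMk_eq_iff {e : Γ.Edge} {g g' : A.π₁ v₀} :
    eMk τ H e g = eMk τ H e g' ↔
      ∃ h ∈ H, ∃ c, g' = h * g * vertexHom τ e.1 (A.α e.2.2 c) := by
  simp only [eMk, Sigma.mk.injEq, heq_eq_eq, true_and, DoubleCoset.eq]
  constructor
  · rintro ⟨h, hh, _, ⟨k, rfl⟩, hg⟩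
    exact ⟨h, hh, k, hg⟩
  · rintro ⟨h, hh, k, hg⟩
    exact ⟨h, hh, _, ⟨k, rfl⟩, hg⟩

theorem eMk_mul_left {e : Γ.Edge} {h g : A.π₁ v₀} (hh : h ∈ H) :
    eMk τ H e (h * g) = eMk τ H e g :=
  (eMk_eq_iff.2 ⟨h, hh, 1, by simp⟩).symm

theorem vMk_mul_right {a : Γ.V} {g : A.π₁ v₀} (k : A.GV a) :
    vMk τ H a (g * vertexHom τ a k) = vMk τ H a g :=
  (vMk_eq_iff.2 ⟨1, H.one_mem, k, by simp⟩).symm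

theorem VertexClass.exists_rep (c : VertexClass τ H) : ∃ g, vMk τ H c.1 g = c := by
  obtain ⟨a, q⟩ := c
  exact ⟨q.out, congrArg (Sigma.mk a) (DoubleCoset.out_eq' _ _ q)⟩

theorem EdgeClass.exists_rep (ε : EdgeClass τ H) : ∃ g, eMk τ H ε.1 g = ε := by
  obtain ⟨a, q⟩ := ε
  exact ⟨q.out, congrArg (Sigma.mk a) (DoubleCoset.out_eq' _ _ q)⟩

/-- The origin of an edge orbit. -/
noncomputable def EdgeClass.org (ε : EdgeClass τ H) : VertexClass τ H :=
  vMk τ H ε.1.1 ε.exists_rep.choose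

/-- The inverse of an edge. -/
def edgeInv (e : Γ.Edge) : Γ.Edge := ⟨e.2.1, e.1, Γ.inv e.2.2⟩

theorem edgeInv_edgeInv (e : Γ.Edge) : edgeInv (edgeInv e) = e := by
  simp [edgeInv, Γ.inv_inv]

theorem edgeInv_ne (e : Γ.Edge) : edgeInv e ≠ e := by
  obtain ⟨a, b, e⟩ := e
  intro h
  have hab : b = a := congrArg Sigma.fst h
  subst hab
  simp only [edgeInv, Sigma.mk.injEq, heq_eq_eq, true_and] at h
  exact Γ.inv_ne e h

/-- The inverse of an edge orbit. -/
noncomputable def EdgeClass.inv (ε : EdgeClass τ H) : EdgeClass τ H :=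
  eMk τ H (edgeInv ε.1) (ε.exists_rep.choose * edgeElt τ ε.1.2.2)

theorem org_eMk (e : Γ.Edge) (g : A.π₁ v₀) : (eMk τ H e g).org = vMk τ H e.1 g := by
  have := (eMk τ H e g).exists_rep.choose_spec
  obtain ⟨h, hh, c, hg⟩ := eMk_eq_iff.1 this
  exact vMk_eq_iff.2 ⟨h, hh, _, hg⟩

/-- The ambiguity `α(c)` of a representative passes across the edge element as `ω(c)`, which lies in
the image of the inverse edge's group. Hence inversion of edge orbits does not depend on
representatives. -/
theorem eMk_edgeInv_congr {e : Γ.Edge} {g g' : A.π₁ v₀} (h : eMk τ H e g = eMk τ H e g') :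
    eMk τ H (edgeInv e) (g * edgeElt τ e.2.2) = eMk τ H (edgeInv e) (g' * edgeElt τ e.2.2) := by
  obtain ⟨k, hk, c, rfl⟩ := eMk_eq_iff.1 h
  obtain ⟨φ, hφ⟩ := A.inv_edge e.2.2
  refine eMk_eq_iff.2 ⟨k, hk, φ c, ?_⟩
  change _ = k * _ * vertexHom τ e.2.1 (A.α (Γ.inv e.2.2) (φ c))
  rw [(hφ c).1]
  simp only [mul_assoc, edgeElt_mul]

theorem inv_eMk (e : Γ.Edge) (g : A.π₁ v₀) :
    (eMk τ H e g).inv = eMk τ H (edgeInv e) (g * edgeElt τ e.2.2) :=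
  eMk_edgeInv_congr (eMk τ H e g).exists_rep.choose_spec

theorem EdgeClass.inv_inv (ε : EdgeClass τ H) : ε.inv.inv = ε := by
  obtain ⟨g, hg⟩ := ε.exists_rep
  rw [← hg, inv_eMk, inv_eMk, edgeInv_edgeInv]
  have : edgeElt τ (edgeInv ε.1).2.2 = (edgeElt τ ε.1.2.2)⁻¹ := edgeElt_inv τ _
  rw [this, mul_inv_cancel_right]

theorem EdgeClass.inv_ne (ε : EdgeClass τ H) : ε.inv ≠ ε := by
  intro h
  exact edgeInv_ne _ (congrArg Sigma.fst h)

/-- Representatives of the vertex orbits, with prescribed representatives of two orbits. -/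
theorem exists_vertex_reps {a : Γ.V} {g g' : A.π₁ v₀} (hne : vMk τ H a g ≠ vMk τ H a g') :
    ∃ γ : VertexClass τ H → A.π₁ v₀, (∀ c, vMk τ H c.1 (γ c) = c) ∧
      γ (vMk τ H a g) = g ∧ γ (vMk τ H a g') = g' := by
  classical
  refine ⟨fun c => if c = vMk τ H a g then g else if c = vMk τ H a g' then g' else
    c.exists_rep.choose, fun c => ?_, by simp, by simp [hne.symm]⟩
  dsimp only
  split_ifs with h1 h2
  · rw [h1]
    rfl
  · rw [h2]
    rfl
  · exact c.exists_rep.choose_spec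

/-- `pos` selects one element from each pair `ε`, `J ε`: choose freely there and transport to the
other. -/
theorem exists_equivariant {E D : Type*} (J : E → E) (hJ : ∀ ε, J (J ε) = ε) (flip : D → D)
    (hflip : ∀ d, flip (flip d) = d) (pos : E → Prop) (hpos : ∀ ε, pos (J ε) ↔ ¬ pos ε)
    (P : E → D → Prop) (hP : ∀ ε, ∃ d, P ε d) (hPf : ∀ ε d, P ε d → P (J ε) (flip d)) :
    ∃ F : E → D, (∀ ε, F (J ε) = flip (F ε)) ∧ ∀ ε, P ε (F ε) := by
  classical
  choose F hF using hP
  refine ⟨fun ε => if pos ε then F ε else flip (F (J ε)), fun ε => ?_, fun ε => ?_⟩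
  · by_cases h : pos ε
    · simp [h, hpos, hJ]
    · simp [h, hpos, hflip]
  · by_cases h : pos ε
    · simp [h, hF]
    · have := hPf _ _ (hF (J ε))
      rw [hJ] at this
      simpa [h] using this

variable (M : A.Marking)

/-- The pair of words `d` describes labels of the edge orbit `ε`, for the representatives `γ` of
the vertex orbits. -/
structure IsLabel (γ : VertexClass τ H → A.π₁ v₀) (ε : EdgeClass τ H) (d : GWord × GWord) :
    Prop where
  mk_eq : eMk τ H ε.1 (γ ε.org * vertexHom τ ε.1.1 (GWord.eval (M.vGens ε.1.1) d.1)) = ε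
  mem : γ ε.org * (vertexHom τ ε.1.1 (GWord.eval (M.vGens ε.1.1) d.1) * edgeElt τ ε.1.2.2 *
    vertexHom τ ε.1.2.1 (GWord.eval (M.vGens ε.1.2.1) d.2)) * (γ ε.inv.org)⁻¹ ∈ H

/-- The first label moves the chosen representative of the origin, modulo `H`, to a representative
of the edge. Crossing the edge gives a representative of the terminus, and the second label corrects
it, again modulo `H`, to the chosen one. -/
theorem exists_isLabel {γ : VertexClass τ H → A.π₁ v₀} (hγ : ∀ c, vMk τ H c.1 (γ c) = c)
    (ε : EdgeClass τ H) : ∃ d, IsLabel M γ ε d := by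
  obtain ⟨g, hg⟩ := ε.exists_rep
  have horg : ε.org = vMk τ H ε.1.1 g := by rw [← hg, org_eMk]; rfl
  have h1 : vMk τ H ε.1.1 (γ ε.org) = vMk τ H ε.1.1 g := (hγ ε.org).trans horg
  obtain ⟨h, hh, k, hk⟩ := vMk_eq_iff.1 h1
  have hmk : eMk τ H ε.1 (γ ε.org * vertexHom τ ε.1.1 k) = ε := by
    conv_rhs => rw [← hg, hk, mul_assoc, eMk_mul_left hh]
  have hinv : ε.inv.org = vMk τ H ε.1.2.1 (γ ε.org * vertexHom τ ε.1.1 k *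
      edgeElt τ ε.1.2.2) := by
    conv_lhs => rw [← hmk, inv_eMk, org_eMk]
    rfl
  have h2 := (hγ ε.inv.org).trans hinv
  obtain ⟨h', hh', k', hk'⟩ := vMk_eq_iff.1 h2.symm
  refine ⟨(M.word k, M.word k'), ?_, ?_⟩
  · simpa only [M.eval_word] using hmk
  · simp only [M.eval_word]
    rw [hk']
    convert H.inv_mem hh' using 1
    group

theorem IsLabel.flip {γ : VertexClass τ H → A.π₁ v₀} {ε : EdgeClass τ H} {d : GWord × GWord}
    (hd : IsLabel M γ ε d) : IsLabel M γ ε.inv (wordInv d.2, wordInv d.1) := by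
  have hinv : ∀ (a : Γ.V) (W : GWord), vertexHom τ a (GWord.eval (M.vGens a) (wordInv W)) =
      (vertexHom τ a (GWord.eval (M.vGens a) W))⁻¹ := by
    intro a W
    rw [← map_inv, GWord.eval_eq_wordVal, wordVal_inv]
    rfl
  have ht : edgeElt τ (Γ.inv ε.1.2.2) = (edgeElt τ ε.1.2.2)⁻¹ := edgeElt_inv τ _
  constructor
  · change eMk τ H (edgeInv ε.1) (γ ε.inv.org * vertexHom τ ε.1.2.1
      (GWord.eval (M.vGens ε.1.2.1) (wordInv d.2))) = ε.inv
    rw [hinv, ← eMk_mul_left hd.mem]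
    conv_rhs => rw [← hd.mk_eq, inv_eMk]
    congr 1
    group
  · change γ ε.inv.org * (vertexHom τ ε.1.2.1 (GWord.eval (M.vGens ε.1.2.1) (wordInv d.2)) *
      edgeElt τ (Γ.inv ε.1.2.2) * vertexHom τ ε.1.1 (GWord.eval (M.vGens ε.1.1) (wordInv d.1))) *
        (γ ε.inv.inv.org)⁻¹ ∈ H
    rw [hinv, hinv, ht, ε.inv_inv]
    convert H.inv_mem hd.mem using 1
    group

/-- Comparing the number of an edge type with that of its inverse orients the edge orbits, so labels
are chosen once for each inverse pair. -/
theorem exists_labels {γ : VertexClass τ H → A.π₁ v₀} (hγ : ∀ c, vMk τ H c.1 (γ c) = c) :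
    ∃ F : EdgeClass τ H → GWord × GWord,
      (∀ ε, F ε.inv = (wordInv (F ε).2, wordInv (F ε).1)) ∧ ∀ ε, IsLabel M γ ε (F ε) := by
  refine exists_equivariant EdgeClass.inv EdgeClass.inv_inv
    (fun d : GWord × GWord => (wordInv d.2, wordInv d.1))
    (fun d => by simp [wordInv_wordInv]) (fun ε => M.eNum ε.1 < M.eNum (edgeInv ε.1))
    (fun ε => ?_) _ (exists_isLabel M hγ) (fun ε d hd => hd.flip M)
  change M.eNum (edgeInv ε.1) < M.eNum (edgeInv (edgeInv ε.1)) ↔ _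
  rw [edgeInv_edgeInv, not_lt]
  exact ⟨le_of_lt, fun h => lt_of_le_of_ne h fun h' => edgeInv_ne _ (M.eNum.injective h')⟩

end Classes

/-! ### Families of generators -/

section Families

/-- A property of the sufficiently large families among those that satisfy `S`. -/
def EventuallyIn {ι : Type*} [SemilatticeSup ι] (S R : ι → Prop) : Prop :=
  ∃ Y₀, S Y₀ ∧ ∀ Y, Y₀ ≤ Y → R Y

variable {ι : Type*} [SemilatticeSup ι] {S : ι → Prop}

theorem EventuallyIn.mono {R R' : ι → Prop} (h : EventuallyIn S R) (hR : ∀ Y, R Y → R' Y) :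
    EventuallyIn S R' := by
  obtain ⟨Y, hY, h⟩ := h
  exact ⟨Y, hY, fun Z hZ => hR Z (h Z hZ)⟩

theorem EventuallyIn.and (hS : ∀ Y Z, S Y → S Z → S (Y ⊔ Z)) {R R' : ι → Prop}
    (h : EventuallyIn S R) (h' : EventuallyIn S R') :
    EventuallyIn S fun Y => R Y ∧ R' Y := by
  obtain ⟨Y, hY, h⟩ := h
  obtain ⟨Z, hZ, h'⟩ := h'
  exact ⟨Y ⊔ Z, hS Y Z hY hZ, fun T hT => ⟨h T (le_sup_left.trans hT),
    h' T (le_sup_right.trans hT)⟩⟩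

/-- Each requirement on the generating families survives enlargement, so finitely many are met at
once by joining their thresholds, which still satisfies `S`. -/
theorem EventuallyIn.finite_all (hS : ∀ Y Z, S Y → S Z → S (Y ⊔ Z)) {Y₀ : ι} (h0 : S Y₀)
    {κ : Type*} (s : Set κ) (hs : s.Finite) {R : κ → ι → Prop}
    (h : ∀ x ∈ s, EventuallyIn S (R x)) : EventuallyIn S fun Y => ∀ x ∈ s, R x Y := by
  induction s, hs using Set.Finite.induction_on with
  | empty => exact ⟨Y₀, h0, by simp⟩
  | @insert x s _ _ ih =>
    refine ((h x (Set.mem_insert x s)).and hS (ih fun y hy => h y (Set.mem_insert_of_mem x hy))).mono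
      fun Y hY => ?_
    rintro y (rfl | hy)
    · exact hY.1
    · exact hY.2 y hy

end Families

end GraphOfGroups

namespace GraphOfGroups

variable {Γ : SerreGraph.{u}} {A : GraphOfGroups.{u, v, w} Γ} {M : A.Marking} {v₀ : Γ.V}
  {τ : ∀ a, A.Path v₀ a} {H : Subgroup (A.π₁ v₀)}

/-! ### Group elements readable in a code -/

namespace Marking.Reaches

variable {C : AGraphCode}

theorem trans {i j k : ℕ} {g h : A.π₁ v₀} (hg : M.Reaches τ C i j g)
    (hh : M.Reaches τ C j k h) : M.Reaches τ C i k (g * h) := by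
  obtain ⟨W, rfl, hW⟩ := hg
  obtain ⟨W', rfl, hW'⟩ := hh
  refine ⟨W ++ W', val_append M τ W W', hW.trans ?_⟩
  have := Relation.ReflTransGen.lift (r := M.PathStep C) (p := M.PathStep C)
    (fun s : ℕ × LWord => (s.1, W ++ s.2)) ?_ _ _ hW'
  · simpa [Function.onFun] using this
  · rintro s t (⟨a, h1, h2, h3, U, hU, h4⟩ | ⟨e, l, h1, h2, h3, h4, h5⟩)
    · refine .inl ⟨a, h1, h2, h3, U, hU, h4.imp (fun h => ?_) (fun h => ?_)⟩ <;> simp [h]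
    · exact .inr ⟨e, l, h1, h2, h3, h4, by simp [h5]⟩

theorem vertex {a : Γ.V} {i : ℕ} {U : GWord} (hi : i < C.1.length) (ha : C.vTyp i = M.vNum a)
    (hU : U ∈ C.vGrp i) : M.Reaches τ C i i (vertexHom τ a (GWord.eval (M.vGens a) U)) :=
  ⟨M.emb a U, M.val_emb τ a U, .single (.inl ⟨a, hi, ha, rfl, U, hU, .inl rfl⟩)⟩

theorem edge {e : Γ.Edge} {k : ℕ} (hk : k < C.2.1.length) (he : C.eTyp k = M.eNum e) :
    M.Reaches τ C (C.org k) (C.ter k) (vertexHom τ e.1 (GWord.eval (M.vGens e.1) (C.wα k)) *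
      edgeElt τ e.2.2 * vertexHom τ e.2.1 (GWord.eval (M.vGens e.2.1) (C.wω k))) :=
  ⟨M.emb e.1 (C.wα k) ++ M.edgeWord e.2.2 ++ M.emb e.2.1 (C.wω k),
    by rw [val_append, val_append, val_emb, val_emb, val_edgeWord],
    .single (.inr ⟨e, k, hk, he, rfl, rfl, rfl⟩)⟩

end Marking.Reaches

theorem _root_.List.getD_map_idxOf {α β : Type*} [DecidableEq α] {l : List α} {a : α}
    (h : a ∈ l) (f : α → β) (d : β) : (l.map f).getD (l.idxOf a) d = f a := by
  have : l.idxOf a < l.length := List.idxOf_lt_length_iff.2 h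
  simp [List.getD, List.getElem?_map, List.getElem?_eq_getElem this]

/-- A finite set of vertex orbits and edge orbits, with representatives and labels. -/
structure Skeleton (M : A.Marking) (τ : ∀ a, A.Path v₀ a) (H : Subgroup (A.π₁ v₀)) where
  γ : VertexClass τ H → A.π₁ v₀
  label : EdgeClass τ H → GWord × GWord
  label_inv : ∀ ε, label ε.inv = (wordInv (label ε).2, wordInv (label ε).1)
  isLabel : ∀ ε, IsLabel M γ ε (label ε)
  verts : List (VertexClass τ H)
  edges : List (EdgeClass τ H)
  verts_nodup : verts.Nodup
  edges_nodup : edges.Nodup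
  org_mem : ∀ ε ∈ edges, ε.org ∈ verts
  inv_mem : ∀ ε ∈ edges, ε.inv ∈ edges
  cx : VertexClass τ H
  c0 : VertexClass τ H
  cx_mem : cx ∈ verts
  c0_mem : c0 ∈ verts

/-! ### Codes of finite subgraphs of the quotient -/

namespace Skeleton

variable (S : Skeleton M τ H)

open Classical in
/-- The number of a vertex orbit. -/
noncomputable def vIdx (c : VertexClass τ H) : ℕ := S.verts.idxOf c

open Classical in
/-- The number of an edge orbit. -/
noncomputable def eIdx (ε : EdgeClass τ H) : ℕ := S.edges.idxOf ε

/-- The code with the vertex groups generated by `Y`. -/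
noncomputable def code (Y : VertexClass τ H → Finset GWord) : AGraphCode :=
  (S.verts.map fun c => ((M.vNum c.1 : ℕ), (Y c).toList),
    S.edges.map fun ε => ((S.vIdx ε.org, S.vIdx ε.inv.org, S.eIdx ε.inv), (M.eNum ε.1 : ℕ),
      S.label ε), S.vIdx S.cx, S.vIdx S.c0)

variable {S} {Y : VertexClass τ H → Finset GWord}

theorem code_vert {c : VertexClass τ H} (hc : c ∈ S.verts) : S.vIdx c < (S.code Y).1.length ∧
    (S.code Y).vTyp (S.vIdx c) = M.vNum c.1 ∧ (S.code Y).vGrp (S.vIdx c) = (Y c).toList := by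
  classical
  refine ⟨?_, ?_, ?_⟩
  · simpa [code, vIdx, List.idxOf_lt_length_iff] using hc
  · exact congrArg Prod.fst (List.getD_map_idxOf hc _ _)
  · exact congrArg Prod.snd (List.getD_map_idxOf hc _ _)

theorem code_edge {ε : EdgeClass τ H} (hε : ε ∈ S.edges) :
    S.eIdx ε < (S.code Y).2.1.length ∧ (S.code Y).edge (S.eIdx ε) =
      ((S.vIdx ε.org, S.vIdx ε.inv.org, S.eIdx ε.inv), (M.eNum ε.1 : ℕ), S.label ε) := by
  classical
  refine ⟨?_, List.getD_map_idxOf hε _ _⟩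
  simpa [code, eIdx, List.idxOf_lt_length_iff] using hε

theorem exists_vert {i : ℕ} (hi : i < (S.code Y).1.length) : ∃ c ∈ S.verts, S.vIdx c = i := by
  classical
  have hi' : i < S.verts.length := by simpa [code] using hi
  exact ⟨_, List.getElem_mem hi', S.verts_nodup.idxOf_getElem i hi'⟩

theorem exists_edge {k : ℕ} (hk : k < (S.code Y).2.1.length) :
    ∃ ε ∈ S.edges, S.eIdx ε = k := by
  classical
  have hk' : k < S.edges.length := by simpa [code] using hk
  exact ⟨_, List.getElem_mem hk', S.edges_nodup.idxOf_getElem k hk'⟩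

theorem vIdx_inj {c c' : VertexClass τ H} (hc : c ∈ S.verts) (h : S.vIdx c = S.vIdx c') :
    c = c' := by
  classical exact (List.idxOf_inj hc).1 h

theorem eIdx_inj {ε ε' : EdgeClass τ H} (hε : ε ∈ S.edges) (h : S.eIdx ε = S.eIdx ε') :
    ε = ε' := by
  classical exact (List.idxOf_inj hε).1 h

variable (S)

/-- The words of the family represent elements of the stabilizers. -/
def Stab (Y : VertexClass τ H → Finset GWord) : Prop :=
  ∀ c, ∀ W ∈ Y c, S.γ c * vertexHom τ c.1 (GWord.eval (M.vGens c.1) W) * (S.γ c)⁻¹ ∈ H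

variable {S}

theorem Stab.sup (Y Z : VertexClass τ H → Finset GWord) (hY : S.Stab Y) (hZ : S.Stab Z) :
    S.Stab (Y ⊔ Z) := by
  intro c W hW
  rcases Finset.mem_union.1 hW with h | h
  · exact hY c W h
  · exact hZ c W h

theorem stab_bot : S.Stab ⊥ := fun _ W hW => absurd hW (Finset.notMem_empty W)

/-- The hypothesis says that `g` stabilizes the orbit representative, so a family with only the word
of `g` at `c` is an admissible threshold. -/
theorem eventually_word {c : VertexClass τ H} {g : A.GV c.1}
    (hg : S.γ c * vertexHom τ c.1 g * (S.γ c)⁻¹ ∈ H) :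
    EventuallyIn S.Stab fun Y => M.word g ∈ Y c := by
  classical
  refine ⟨Function.update ⊥ c {M.word g}, ?_, ?_⟩
  · intro c' W hW
    by_cases hc : c' = c
    · subst hc
      rw [Function.update_self, Finset.mem_singleton] at hW
      rw [hW, M.eval_word]
      exact hg
    · rw [Function.update_of_ne hc] at hW
      exact absurd hW (Finset.notMem_empty W)
  · intro Y hY
    refine hY c ?_
    rw [Function.update_self]
    exact Finset.mem_singleton_self _

theorem reaches_vertex {c : VertexClass τ H} (hc : c ∈ S.verts) {g : A.GV c.1}
    (hg : M.word g ∈ Y c) :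
    M.Reaches τ (S.code Y) (S.vIdx c) (S.vIdx c) (vertexHom τ c.1 g) := by
  obtain ⟨h1, h2, h3⟩ := code_vert (Y := Y) hc
  have := Marking.Reaches.vertex (τ := τ) (U := M.word g) h1 h2 (by simpa [h3] using hg)
  rwa [M.eval_word] at this

theorem reaches_edge {ε : EdgeClass τ H} (hε : ε ∈ S.edges) :
    M.Reaches τ (S.code Y) (S.vIdx ε.org) (S.vIdx ε.inv.org)
      (vertexHom τ ε.1.1 (GWord.eval (M.vGens ε.1.1) (S.label ε).1) * edgeElt τ ε.1.2.2 *
        vertexHom τ ε.1.2.1 (GWord.eval (M.vGens ε.1.2.1) (S.label ε).2)) := by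
  obtain ⟨h1, h2⟩ := code_edge (Y := Y) hε
  have := Marking.Reaches.edge (M := M) (τ := τ) (e := ε.1) h1 (by rw [AGraphCode.eTyp, h2])
  rwa [AGraphCode.org, AGraphCode.ter, AGraphCode.wα, AGraphCode.wω, h2] at this

/-- The labels of an edge orbit, stated over the endpoints of `e` itself so that no types depend on
the orbit. The representative `d` is the labelled one up to `H` on the left and `α(c)` on the right.
-/
theorem exists_label_eq {a b : Γ.V} (e : Γ.E a b) {d : A.π₁ v₀}
    (hd : eMk τ H ⟨a, b, e⟩ d ∈ S.edges) : ∃ (x : A.GV a) (y : A.GV b),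
    (∃ h ∈ H, ∃ c, d = h * S.γ (vMk τ H a d) * vertexHom τ a x * vertexHom τ a (A.α e c)) ∧
    S.γ (vMk τ H a d) * (vertexHom τ a x * edgeElt τ e * vertexHom τ b y) *
      (S.γ (vMk τ H b (d * edgeElt τ e)))⁻¹ ∈ H ∧
    ∀ Y, M.Reaches τ (S.code Y) (S.vIdx (vMk τ H a d)) (S.vIdx (vMk τ H b (d * edgeElt τ e)))
      (vertexHom τ a x * edgeElt τ e * vertexHom τ b y) := by
  have horg : (eMk τ H ⟨a, b, e⟩ d).org = vMk τ H a d := org_eMk _ _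
  have hinv : (eMk τ H ⟨a, b, e⟩ d).inv.org = vMk τ H b (d * edgeElt τ e) := by
    rw [inv_eMk, org_eMk]
    rfl
  have hlab := S.isLabel (eMk τ H ⟨a, b, e⟩ d)
  rw [← horg, ← hinv]
  refine ⟨_, _, ?_, hlab.mem, fun Y => reaches_edge hd⟩
  obtain ⟨h, hh, c, hc⟩ := eMk_eq_iff.1 hlab.mk_eq
  exact ⟨h, hh, c, hc.trans (by simp only [mul_assoc]; rfl)⟩

end Skeleton

variable (τ H) in
/-- The edge orbits met by the path `p` that starts at `d`. -/
def tracedEdges : ∀ {a b : Γ.V}, A.π₁ v₀ → A.Path a b → List (EdgeClass τ H)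
  | _, _, _, .single _ => []
  | a, _, d, .cons g e p => eMk τ H ⟨_, _, e⟩ (d * vertexHom τ a g) ::
      tracedEdges (d * vertexHom τ a g * edgeElt τ e) p

/-- A path in the tree starting at `d` projects to the quotient. At each vertex the position differs
from the chosen representative by an element of `H` on the left and one of the vertex group on the
right. Reading the projection needs, at each vertex, one vertex-group element that reconciles the
incoming position with the label of the outgoing edge. It stabilizes the representative, so its word
may be added to the family; one is needed for each edge of `p` and one at the end. -/
theorem Skeleton.trace (S : Skeleton M τ H) {a b : Γ.V} (p : A.Path a b) :
    ∀ {d h h' : A.π₁ v₀} {k : A.GV a} {k' : A.GV b}, h ∈ H → h' ∈ H →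
      vMk τ H a d ∈ S.verts → (∀ ε ∈ tracedEdges τ H d p, ε ∈ S.edges) →
      d = h * S.γ (vMk τ H a d) * vertexHom τ a k →
      d * toLoop τ p = h' * S.γ (vMk τ H b (d * toLoop τ p)) * vertexHom τ b k' →
      EventuallyIn S.Stab fun Y => M.Reaches τ (S.code Y) (S.vIdx (vMk τ H a d))
        (S.vIdx (vMk τ H b (d * toLoop τ p)))
        (vertexHom τ a k * toLoop τ p * (vertexHom τ b k')⁻¹) := by
  induction p with
  | @single a g =>
    intro d h h' k k' hh hh' hv _ hd hd'
    rw [toLoop_single] at hd' ⊢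
    rw [vMk_mul_right] at hd' ⊢
    have hstab : S.γ (vMk τ H a d) * vertexHom τ a (k * g * k'⁻¹) * (S.γ (vMk τ H a d))⁻¹ ∈ H := by
      have h1 : S.γ (vMk τ H a d) * vertexHom τ a k = h⁻¹ * d := by
        rw [eq_inv_mul_iff_mul_eq, ← mul_assoc, ← hd]
      have h2 : vertexHom τ a g * (vertexHom τ a k')⁻¹ * (S.γ (vMk τ H a d))⁻¹ = d⁻¹ * h' := by
        rw [eq_inv_mul_iff_mul_eq, ← mul_assoc, ← mul_assoc, hd']
        group
      have := H.mul_mem (H.inv_mem hh) hh'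
      rw [map_mul, map_mul, map_inv]
      convert this using 1
      calc _ = (S.γ (vMk τ H a d) * vertexHom τ a k) * (vertexHom τ a g * (vertexHom τ a k')⁻¹ *
            (S.γ (vMk τ H a d))⁻¹) := by group
        _ = _ := by rw [h1, h2]; group
    refine (eventually_word (c := vMk τ H a d) hstab).mono fun Y hY => ?_
    have := reaches_vertex hv hY
    change M.Reaches τ (S.code Y) _ _ (vertexHom τ a (k * g * k'⁻¹)) at this
    rwa [map_mul, map_mul, map_inv] at this
  | @cons a b c g e p ih =>
    intro d h h' k k' hh hh' hv hp hd hd'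
    have hv1 : vMk τ H a (d * vertexHom τ a g) = vMk τ H a d := vMk_mul_right g
    have he : eMk τ H ⟨a, b, e⟩ (d * vertexHom τ a g) ∈ S.edges := hp _ (by simp [tracedEdges])
    obtain ⟨x, y, ⟨h1, hh1, z, hz⟩, hm, hstep⟩ := exists_label_eq e he
    have hv2 : vMk τ H b (d * vertexHom τ a g * edgeElt τ e) ∈ S.verts := by
      have := S.org_mem _ (S.inv_mem _ he)
      rwa [inv_eMk, org_eMk] at this
    rw [hv1] at hz hm
    have hend : d * toLoop τ (Path.cons g e p) =
        d * vertexHom τ a g * edgeElt τ e * toLoop τ p := by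
      rw [toLoop_cons]
      simp only [mul_assoc]
    rw [hend] at hd' ⊢
    -- The position after crossing `e`, in the form required by the induction: the vertex-group
    -- correction becomes `y⁻¹ ω(z)`, where `y` is the second label and `z` the ambiguity of the
    -- edge representative.
    have hd2 : d * vertexHom τ a g * edgeElt τ e =
        h1 * (S.γ (vMk τ H a d) * (vertexHom τ a x * edgeElt τ e * vertexHom τ b y) *
          (S.γ (vMk τ H b (d * vertexHom τ a g * edgeElt τ e)))⁻¹) *
        S.γ (vMk τ H b (d * vertexHom τ a g * edgeElt τ e)) *
          vertexHom τ b (y⁻¹ * A.ω e z) := by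
      have : d * vertexHom τ a g * edgeElt τ e =
          h1 * S.γ (vMk τ H a d) * vertexHom τ a x * (edgeElt τ e * vertexHom τ b (A.ω e z)) := by
        rw [edgeElt_mul, ← mul_assoc, ← hz]
      rw [map_mul, map_inv]
      generalize S.γ (vMk τ H b (d * vertexHom τ a g * edgeElt τ e)) = γ'
      rw [this]
      group
    -- Two expressions for `d g` over the same representative differ by `h⁻¹ h1 ∈ H`.
    have hstab : S.γ (vMk τ H a d) * vertexHom τ a (k * g * (x * A.α e z)⁻¹) *
        (S.γ (vMk τ H a d))⁻¹ ∈ H := by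
      convert H.mul_mem (H.inv_mem hh) hh1 using 1
      rw [eq_inv_mul_iff_mul_eq, map_mul, map_mul, map_inv, map_mul]
      calc _ = (h * S.γ (vMk τ H a d) * vertexHom τ a k) * vertexHom τ a g *
            (vertexHom τ a x * vertexHom τ a (A.α e z))⁻¹ * (S.γ (vMk τ H a d))⁻¹ := by group
        _ = _ := by
          rw [← hd, hz]
          group
    refine ((ih (H.mul_mem hh1 hm) hh' hv2 (fun ε hε => hp ε (by simp [tracedEdges, hε]))
      hd2 hd').and Stab.sup (eventually_word (c := vMk τ H a d) hstab)).mono fun Y hY => ?_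
    have hs := hstep Y
    rw [hv1] at hs
    have := ((reaches_vertex hv hY.2).trans hs).trans hY.1
    convert this using 1
    change _ = vertexHom τ a (k * g * (x * A.α e z)⁻¹) * _ * _
    rw [toLoop_cons]
    simp only [map_mul, map_inv, mul_inv_rev, mul_assoc, inv_mul_cancel_left,
      mul_inv_cancel_left]
    congr 2
    rw [← mul_assoc (edgeElt τ e) (vertexHom τ b (A.ω e z)), edgeElt_mul, mul_assoc,
      inv_mul_cancel_left]

end GraphOfGroups

namespace GraphOfGroups

variable {Γ : SerreGraph.{u}} {A : GraphOfGroups.{u, v, w} Γ} {M : A.Marking} {v₀ : Γ.V}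
  {τ : ∀ a, A.Path v₀ a}

/-! ### Saturated families and foldedness -/

namespace Skeleton

section

variable {H : Subgroup (A.π₁ v₀)} {S : Skeleton M τ H} {Y : VertexClass τ H → Finset GWord}

/-- The elements `s` with `f s` in the stabilizer form a subgroup of `E`, finitely generated by
`hE`; it suffices to add words for the images of its generators. -/
theorem eventually_comap {E : Type*} [Group E] (hE : ∀ K : Subgroup E, K.FG)
    (c : VertexClass τ H) (f : E →* A.GV c.1) : EventuallyIn S.Stab fun Y => ∀ s,
      S.γ c * vertexHom τ c.1 (f s) * (S.γ c)⁻¹ ∈ H →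
        f s ∈ GWord.span (M.vGens c.1) (Y c).toList := by
  obtain ⟨T, hT⟩ := hE (H.comap ((MulAut.conj (S.γ c)).toMonoidHom.comp ((vertexHom τ c.1).comp f)))
  have hmem : ∀ s, s ∈ Subgroup.closure (T : Set E) ↔
      S.γ c * vertexHom τ c.1 (f s) * (S.γ c)⁻¹ ∈ H := by
    intro s
    rw [hT]
    rfl
  refine (EventuallyIn.finite_all Stab.sup stab_bot (T : Set E) T.finite_toSet
    (R := fun t Y => M.word (f t) ∈ Y c) fun t ht =>
      eventually_word ((hmem t).1 (Subgroup.subset_closure ht))).mono fun Y hY s hs => ?_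
  have : Subgroup.closure (T : Set E) ≤ (GWord.span (M.vGens c.1) (Y c).toList).comap f :=
    (Subgroup.closure_le _).2 fun t ht =>
      Subgroup.subset_closure ⟨M.word (f t), Finset.mem_toList.2 (hY t ht), M.eval_word _⟩
  exact this ((hmem s).2 hs)

theorem Stab.mem_of_mem_span (hY : S.Stab Y) {c : VertexClass τ H} {g : A.GV c.1}
    (hg : g ∈ GWord.span (M.vGens c.1) (Y c).toList) :
    S.γ c * vertexHom τ c.1 g * (S.γ c)⁻¹ ∈ H := by
  have : GWord.span (M.vGens c.1) (Y c).toList ≤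
      H.comap ((MulAut.conj (S.γ c)).toMonoidHom.comp (vertexHom τ c.1)) := by
    refine (Subgroup.closure_le _).2 ?_
    rintro _ ⟨W, hW, rfl⟩
    exact hY c W (Finset.mem_toList.1 hW)
  exact this hg

variable (S) in
/-- The value of the first label of an edge orbit. -/
noncomputable def lα (ε : EdgeClass τ H) : A.GV ε.1.1 :=
  GWord.eval (M.vGens ε.1.1) (S.label ε).1

variable (S) in
/-- The value of the second label of an edge orbit. -/
noncomputable def lω (ε : EdgeClass τ H) : A.GV ε.1.2.1 :=
  GWord.eval (M.vGens ε.1.2.1) (S.label ε).2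

variable (S) in
/-- The vertex groups generated by `Y` contain the edge stabilizers. -/
def Saturated (Y : VertexClass τ H → Finset GWord) : Prop :=
  ∀ ε ∈ S.edges,
    (∀ s, S.γ ε.org * vertexHom τ ε.1.1 (S.lα ε * A.α ε.1.2.2 s * (S.lα ε)⁻¹) *
      (S.γ ε.org)⁻¹ ∈ H → S.lα ε * A.α ε.1.2.2 s * (S.lα ε)⁻¹ ∈
        GWord.span (M.vGens ε.1.1) (Y ε.org).toList) ∧
    ∀ s, S.γ ε.inv.org * vertexHom τ ε.1.2.1 ((S.lω ε)⁻¹ * A.ω ε.1.2.2 s * (S.lω ε)⁻¹⁻¹) *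
      (S.γ ε.inv.org)⁻¹ ∈ H → (S.lω ε)⁻¹ * A.ω ε.1.2.2 s * (S.lω ε)⁻¹⁻¹ ∈
        GWord.span (M.vGens ε.1.2.1) (Y ε.inv.org).toList

theorem eventually_saturated (hA : Benign M) : EventuallyIn S.Stab S.Saturated :=
  EventuallyIn.finite_all Stab.sup stab_bot {ε | ε ∈ S.edges} (List.finite_toSet _) fun ε _ =>
    (eventually_comap (hA.noetherian ε.1.2.2) ε.org
      ((MulAut.conj (S.lα ε)).toMonoidHom.comp (A.α ε.1.2.2))).and Stab.sup
    (eventually_comap (hA.noetherian ε.1.2.2) ε.inv.org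
      ((MulAut.conj (S.lω ε)⁻¹).toMonoidHom.comp (A.ω ε.1.2.2)))

/-- By saturation each side consists of those `s` whose image, conjugated by the vertex
representative, lies in `H`. The two conjugates differ by conjugation with the label element `m ∈
H`, so both sides are the edge stabilizer. -/
theorem comap_eq_comap (hY : S.Stab Y) (hS : S.Saturated Y) {ε : EdgeClass τ H}
    (hε : ε ∈ S.edges) : (GWord.span (M.vGens ε.1.1) (Y ε.org).toList).comap
      ((MulAut.conj (S.lα ε)).toMonoidHom.comp (A.α ε.1.2.2)) =
    (GWord.span (M.vGens ε.1.2.1) (Y ε.inv.org).toList).comap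
      ((MulAut.conj (S.lω ε)⁻¹).toMonoidHom.comp (A.ω ε.1.2.2)) := by
  ext s
  have h1 : S.lα ε * A.α ε.1.2.2 s * (S.lα ε)⁻¹ ∈
      GWord.span (M.vGens ε.1.1) (Y ε.org).toList ↔ S.γ ε.org * vertexHom τ ε.1.1
        (S.lα ε * A.α ε.1.2.2 s * (S.lα ε)⁻¹) * (S.γ ε.org)⁻¹ ∈ H :=
    ⟨fun h => hY.mem_of_mem_span (c := ε.org) h, (hS ε hε).1 s⟩
  have h2 : (S.lω ε)⁻¹ * A.ω ε.1.2.2 s * (S.lω ε)⁻¹⁻¹ ∈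
      GWord.span (M.vGens ε.1.2.1) (Y ε.inv.org).toList ↔ S.γ ε.inv.org * vertexHom τ ε.1.2.1
        ((S.lω ε)⁻¹ * A.ω ε.1.2.2 s * (S.lω ε)⁻¹⁻¹) * (S.γ ε.inv.org)⁻¹ ∈ H :=
    ⟨fun h => hY.mem_of_mem_span (c := ε.inv.org) h, (hS ε hε).2 s⟩
  refine h1.trans (Iff.trans ?_ h2.symm)
  have hm : S.γ ε.org * (vertexHom τ ε.1.1 (S.lα ε) * edgeElt τ ε.1.2.2 *
    vertexHom τ ε.1.2.1 (S.lω ε)) * (S.γ ε.inv.org)⁻¹ ∈ H := (S.isLabel ε).mem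
  set m := S.γ ε.org * (vertexHom τ ε.1.1 (S.lα ε) * edgeElt τ ε.1.2.2 *
    vertexHom τ ε.1.2.1 (S.lω ε)) * (S.γ ε.inv.org)⁻¹ with hmdef
  have hω : vertexHom τ ε.1.2.1 (A.ω ε.1.2.2 s) =
      (edgeElt τ ε.1.2.2)⁻¹ * vertexHom τ ε.1.1 (A.α ε.1.2.2 s) * edgeElt τ ε.1.2.2 := by
    rw [mul_assoc, ← edgeElt_mul, inv_mul_cancel_left]
  have : S.γ ε.inv.org * vertexHom τ ε.1.2.1 ((S.lω ε)⁻¹ * A.ω ε.1.2.2 s * (S.lω ε)⁻¹⁻¹) *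
      (S.γ ε.inv.org)⁻¹ = m⁻¹ * (S.γ ε.org * vertexHom τ ε.1.1
        (S.lα ε * A.α ε.1.2.2 s * (S.lα ε)⁻¹) * (S.γ ε.org)⁻¹) * m := by
    simp only [map_mul, map_inv, inv_inv, hω, hmdef]
    group
  rw [this, H.mul_mem_cancel_right hm, H.mul_mem_cancel_left (H.inv_mem hm)]

/-- Such a relation between labels exhibits both edges as one orbit: `b` becomes an element of `H`
once moved past the representative, and `α(c)` does not change the edge. -/
theorem eq_of_label_eq (hY : S.Stab Y) {ε ε' : EdgeClass τ H} (horg : ε'.org = ε.org)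
    (htyp : ε'.1 = ε.1) {b : A.GV ε.1.1}
    (hb : b ∈ GWord.span (M.vGens ε.1.1) (Y ε.org).toList) {c : A.GE ε.1.2.2}
    (h : GWord.eval (M.vGens ε.1.1) (S.label ε').1 = b * S.lα ε * A.α ε.1.2.2 c) : ε' = ε := by
  have h1 : ∀ e, ε'.1 = e → eMk τ H e (S.γ ε'.org * vertexHom τ e.1
      (GWord.eval (M.vGens e.1) (S.label ε').1)) = ε' := by
    rintro _ rfl
    exact (S.isLabel ε').mk_eq
  rw [← h1 _ htyp, horg, h]
  refine Eq.trans (Eq.symm (eMk_eq_iff.2 ⟨_, hY.mem_of_mem_span (c := ε.org) hb, c, ?_⟩))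
    (S.isLabel ε).mk_eq
  change _ = _ * (S.γ ε.org * vertexHom τ ε.1.1 (S.lα ε)) * _
  have h2 : vertexHom τ ε.org.1 b = vertexHom τ ε.1.1 b := rfl
  rw [h2, map_mul, map_mul]
  group

theorem code_edgeWF {ε : EdgeClass τ H} (hε : ε ∈ S.edges) :
    M.EdgeWF (S.code Y) (S.eIdx ε) ε.1 := by
  have h1 := code_edge (Y := Y) hε
  have h2 := code_edge (Y := Y) (S.inv_mem _ hε)
  have h3 := code_vert (Y := Y) (S.org_mem _ hε)
  have h4 := code_vert (Y := Y) (S.org_mem _ (S.inv_mem _ hε))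
  have hi : (S.code Y).inv (S.eIdx ε) = S.eIdx ε.inv := by rw [AGraphCode.inv, h1.2]
  have ho : (S.code Y).org (S.eIdx ε) = S.vIdx ε.org := by rw [AGraphCode.org, h1.2]
  have ht : (S.code Y).ter (S.eIdx ε) = S.vIdx ε.inv.org := by rw [AGraphCode.ter, h1.2]
  refine ⟨?_, ?_, ?_, ?_, ?_, ?_, ?_, ?_, ?_, ?_, ?_⟩
  · rw [AGraphCode.eTyp, h1.2]
  · exact ho ▸ h3.1
  · exact ht ▸ h4.1
  · exact hi ▸ h2.1
  · rw [hi]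
    exact fun h => ε.inv_ne (eIdx_inj (S.inv_mem _ hε) h)
  · rw [hi, AGraphCode.inv, h2.2, ε.inv_inv]
  · rw [hi, ht, AGraphCode.org, h2.2]
  · rw [hi, AGraphCode.eTyp, h2.2]
    rfl
  · rw [ho, h3.2.1]
    rfl
  · rw [ht, h4.2.1]
    rfl
  · rw [hi, AGraphCode.wα, AGraphCode.wω, h1.2, h2.2, S.label_inv]

end

theorem isCert {X : List LWord} {x : LWord} {S : Skeleton M τ (wordSpan (M.letterVal τ) X)}
    {Y : VertexClass τ (wordSpan (M.letterVal τ) X) → Finset GWord} (hY : S.Stab Y)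
    (hS : S.Saturated Y) {U : A.π₁ v₀ → LWord} (hU : ∀ g, M.val τ (U g) = g)
    (hx : S.cx.1 = v₀) (h0 : S.c0.1 = v₀) (hne : S.cx ≠ S.c0) (hγx : S.γ S.cx = (M.val τ x)⁻¹)
    (hγ0 : S.γ S.c0 = 1) (hrx : M.Reaches τ (S.code Y) (S.vIdx S.cx) (S.vIdx S.c0) (M.val τ x))
    (hr : ∀ W ∈ X, M.Reaches τ (S.code Y) (S.vIdx S.c0) (S.vIdx S.c0) (M.val τ W)) :
    M.IsCert τ X x (S.code Y) (S.verts.map fun c => U (S.γ c)) := by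
  classical
  have hγ : ∀ c ∈ S.verts, M.val τ ((S.verts.map fun c => U (S.γ c)).getD (S.vIdx c) []) =
      S.γ c := by
    intro c hc
    have : (S.verts.map fun c => U (S.γ c)).getD (S.vIdx c) [] = U (S.γ c) :=
      List.getD_map_idxOf hc _ _
    rw [this, hU]
  refine ⟨?_, ?_, ?_, ?_, ?_, ?_, ?_, ?_, ?_, hrx, hr⟩
  · intro i hi
    obtain ⟨c, hc, rfl⟩ := exists_vert hi
    obtain ⟨-, h2, h3⟩ := code_vert (Y := Y) hc
    refine ⟨c.1, h2, fun W hW => ?_⟩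
    rw [h3, Finset.mem_toList] at hW
    rw [M.val_append, M.val_append, M.val_inv, hγ c hc, M.val_emb]
    exact hY c W hW
  · intro k hk
    obtain ⟨ε, hε, rfl⟩ := exists_edge hk
    have h1 := (code_edge (Y := Y) hε).2
    have hv := S.org_mem _ hε
    have hv' := S.org_mem _ (S.inv_mem _ hε)
    have ho : (S.code Y).org (S.eIdx ε) = S.vIdx ε.org := by rw [AGraphCode.org, h1]
    have ht : (S.code Y).ter (S.eIdx ε) = S.vIdx ε.inv.org := by rw [AGraphCode.ter, h1]
    have hα : (S.code Y).wα (S.eIdx ε) = (S.label ε).1 := by rw [AGraphCode.wα, h1]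
    have hω : (S.code Y).wω (S.eIdx ε) = (S.label ε).2 := by rw [AGraphCode.wω, h1]
    refine ⟨ε.1, code_edgeWF hε, ?_, ?_, fun l hl => ?_⟩
    · rw [ho, ht, hα, hω, M.val_append, M.val_append, M.val_append, M.val_append, M.val_inv,
        hγ _ hv, hγ _ hv', M.val_emb, M.val_emb, M.val_edgeWord]
      exact (S.isLabel ε).mem
    · rw [ho, ht, hα, hω, (code_vert hv).2.2, (code_vert hv').2.2]
      exact comap_eq_comap hY hS hε
    · obtain ⟨ε', hε', rfl⟩ := exists_edge hl
      have h1' := (code_edge (Y := Y) hε').2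
      have ho' : (S.code Y).org (S.eIdx ε') = S.vIdx ε'.org := by rw [AGraphCode.org, h1']
      rw [or_iff_not_imp_left, or_iff_not_imp_left, or_iff_not_imp_left, not_not, not_not]
      intro hlk horg htyp b hb c hbc
      rw [ho, ho'] at horg
      rw [AGraphCode.eTyp, AGraphCode.eTyp, h1, h1'] at htyp
      rw [ho, (code_vert hv).2.2] at hb
      rw [AGraphCode.wα, h1', hα] at hbc
      exact hlk (congrArg S.eIdx (eq_of_label_eq hY (vIdx_inj (S.org_mem _ hε') horg)
        (M.eNum.injective (Fin.ext htyp)) hb hbc))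
  · exact (code_vert S.cx_mem).1
  · exact (code_vert S.c0_mem).1
  · exact fun h => hne (vIdx_inj S.cx_mem h)
  · change (S.code Y).vTyp (S.vIdx S.cx) = _
    rw [(code_vert S.cx_mem).2.1, hx]
  · change (S.code Y).vTyp (S.vIdx S.c0) = _
    rw [(code_vert S.c0_mem).2.1, h0]
  · change M.val τ (List.getD _ (S.vIdx S.c0) []) ∈ _
    rw [hγ _ S.c0_mem, hγ0]
    exact Subgroup.one_mem _
  · change M.val τ (List.getD _ (S.vIdx S.cx) [] ++ x) ∈ _
    rw [M.val_append, hγ _ S.cx_mem, hγx, inv_mul_cancel]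
    exact Subgroup.one_mem _

end Skeleton

/-! ### Construction of a certificate -/

theorem exists_toLoop_eq (hτ : τ v₀ = Path.single 1) (g : A.π₁ v₀) :
    ∃ p : A.Path v₀ v₀, toLoop τ p = g := by
  induction g using Quotient.inductionOn with | _ p
  exact ⟨p, (cls_eq_toLoop τ hτ p).symm⟩

theorem exists_isCert (hA : Benign M) (hτ : τ v₀ = Path.single 1) (X : List LWord) (x : LWord)
    (hno : ∀ y : A.GV v₀, (vertexHom τ v₀ y)⁻¹ * M.val τ x ∉ wordSpan (M.letterVal τ) X) :
    ∃ C γ, M.IsCert τ X x C γ := by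
  classical
  set H := wordSpan (M.letterVal τ) X with hH
  -- If `1 = h x⁻¹ k` with `k` in the vertex group, then `k⁻¹ x = h ∈ H`, contrary to `hno`.
  have hne : vMk τ H v₀ (M.val τ x)⁻¹ ≠ vMk τ H v₀ 1 := by
    intro h
    obtain ⟨h, hh, k, hk⟩ := vMk_eq_iff.1 h
    refine hno k ?_
    convert hh using 1
    rw [inv_mul_eq_iff_eq_mul, ← mul_inv_eq_iff_eq_mul]
    have : vertexHom τ v₀ k = (h * (M.val τ x)⁻¹)⁻¹ := by
      rw [eq_inv_iff_mul_eq_one, eq_comm, mul_eq_one_iff_eq_inv'.1 hk.symm]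
      group
    rw [this]
    group
  obtain ⟨γ, hγ, hγx, hγ0⟩ := exists_vertex_reps hne
  obtain ⟨F, hF, hFl⟩ := exists_labels M hγ
  choose p hp using exists_toLoop_eq hτ
  -- The path for `x` starts at `x⁻¹`, so that it ends exactly at `1`; the generators of `H` are
  -- traced from `1` and return to its orbit.
  let E₀ : List (EdgeClass τ H) := tracedEdges τ H (M.val τ x)⁻¹ (p (M.val τ x)) ++
    X.flatMap fun W => tracedEdges τ H 1 (p (M.val τ W))
  let E := (E₀ ++ E₀.map EdgeClass.inv).dedup
  have hEmem : ∀ ε, ε ∈ E ↔ ε ∈ E₀ ∨ ε.inv ∈ E₀ := by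
    intro ε
    simp only [E, List.mem_dedup, List.mem_append, List.mem_map]
    refine or_congr_right ⟨?_, fun h => ⟨_, h, ε.inv_inv⟩⟩
    rintro ⟨ε', h, rfl⟩
    rwa [EdgeClass.inv_inv]
  let S : Skeleton M τ H :=
    { γ := γ
      label := F
      label_inv := hF
      isLabel := hFl
      verts := (vMk τ H v₀ (M.val τ x)⁻¹ :: vMk τ H v₀ 1 :: E.map EdgeClass.org).dedup
      edges := E
      verts_nodup := List.nodup_dedup _
      edges_nodup := List.nodup_dedup _
      org_mem := fun ε hε => List.mem_dedup.2 (List.mem_cons_of_mem _ (List.mem_cons_of_mem _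
        (List.mem_map_of_mem hε)))
      inv_mem := fun ε hε => (hEmem _).2 (by rw [ε.inv_inv]; exact ((hEmem _).1 hε).symm)
      cx := vMk τ H v₀ (M.val τ x)⁻¹
      c0 := vMk τ H v₀ 1
      cx_mem := List.mem_dedup.2 List.mem_cons_self
      c0_mem := List.mem_dedup.2 (List.mem_cons_of_mem _ List.mem_cons_self) }
  have htr : ∀ {d h : A.π₁ v₀} (p : A.Path v₀ v₀), γ (vMk τ H v₀ d) = d → h ∈ H →
      d * toLoop τ p = h * γ (vMk τ H v₀ (d * toLoop τ p)) → vMk τ H v₀ d ∈ S.verts →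
      (∀ ε ∈ tracedEdges τ H d p, ε ∈ E₀) → EventuallyIn S.Stab fun Y =>
        M.Reaches τ (S.code Y) (S.vIdx (vMk τ H v₀ d)) (S.vIdx (vMk τ H v₀ (d * toLoop τ p)))
          (toLoop τ p) := by
    intro d h p hd hh hd' hv hE
    have := S.trace p (d := d) (h := 1) (h' := h) (k := 1) (k' := 1) H.one_mem hh hv
      (fun ε hε => (hEmem ε).2 (.inl (hE ε hε)))
      (by rw [map_one, one_mul, mul_one]; exact hd.symm)
      (by rw [map_one, mul_one]; exact hd')
    simpa only [map_one, one_mul, inv_one, mul_one] using this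
  have hrx : EventuallyIn S.Stab fun Y =>
      M.Reaches τ (S.code Y) (S.vIdx S.cx) (S.vIdx S.c0) (M.val τ x) := by
    have h1 : (M.val τ x)⁻¹ * toLoop τ (p (M.val τ x)) = 1 := by rw [hp, inv_mul_cancel]
    have := htr (p (M.val τ x)) hγx H.one_mem (by rw [h1, hγ0, mul_one]) S.cx_mem
      (fun ε hε => List.mem_append_left _ hε)
    rwa [h1, hp] at this
  have hr : EventuallyIn S.Stab fun Y => ∀ W ∈ {W | W ∈ X},
      M.Reaches τ (S.code Y) (S.vIdx S.c0) (S.vIdx S.c0) (M.val τ W) := by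
    refine EventuallyIn.finite_all Skeleton.Stab.sup Skeleton.stab_bot _ (List.finite_toSet X)
      fun W hW => ?_
    have h1 : vMk τ H v₀ (1 * toLoop τ (p (M.val τ W))) = vMk τ H v₀ 1 :=
      (vMk_eq_iff.2 ⟨M.val τ W, wordVal_mem_wordSpan _ hW, 1, by rw [hp, map_one]; group⟩).symm
    have := htr (p (M.val τ W)) hγ0 (wordVal_mem_wordSpan _ hW) (by rw [h1, hγ0, hp]; group)
      S.c0_mem fun ε hε => List.mem_append_right _ (List.mem_flatMap.2 ⟨W, hW, hε⟩)
    rwa [h1, hp] at this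
  -- The threshold family itself is used: it is large enough for all requirements, and its words lie
  -- in the stabilizers.
  obtain ⟨Y, hY, h⟩ := (Skeleton.eventually_saturated hA).and Skeleton.Stab.sup
    (hrx.and Skeleton.Stab.sup hr)
  obtain ⟨hS, hrx, hr⟩ := h Y le_rfl
  choose q hq using exists_toLoop_eq hτ
  exact ⟨_, _, Skeleton.isCert hY hS (U := fun g => M.pathWord (q g))
    (fun g => by rw [M.val_pathWord, hq]) rfl rfl hne hγx hγ0 hrx hr⟩

end GraphOfGroups

/-! ## The algorithms -/

namespace GraphOfGroups

variable {Γ : SerreGraph.{u}} {A : GraphOfGroups.{u, v, w} Γ} {M : A.Marking} {v₀ : Γ.V}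
  {τ : ∀ a, A.Path v₀ a}

theorem exists_tree_paths (hΓ : Γ.Connected) (A : GraphOfGroups.{u, v, w} Γ) (v₀ : Γ.V) :
    ∃ τ : ∀ a, A.Path v₀ a, τ v₀ = Path.single 1 := by
  classical
  have h : ∀ a, Nonempty (A.Path v₀ a) := by
    intro a
    induction hΓ.2 v₀ a with
    | refl => exact ⟨Path.single 1⟩
    | tail _ h ih =>
      obtain ⟨p⟩ := ih
      obtain ⟨e⟩ := h
      exact ⟨p.comp (Path.cons 1 e (Path.single 1))⟩
  exact ⟨Function.update (fun a => (h a).some) v₀ (Path.single 1), Function.update_self _ _ _⟩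

theorem _root_.SerreGraph.Connected.exists_edge {Γ : SerreGraph.{u}} (hΓ : Γ.Connected) {a b : Γ.V}
    (e : Γ.E a b) (c : Γ.V) : ∃ d, Nonempty (Γ.E c d) := by
  rcases (hΓ.2 c a).cases_head with h | ⟨d, h, -⟩
  · subst h
    exact ⟨b, ⟨e⟩⟩
  · exact ⟨d, h⟩

/-! ### Translation of path codes into words -/

namespace Marking

variable (M)

/-- The word for the part of a path that begins with its first edge. -/
def tailWord (l : List (ℕ × GWord)) : LWord :=
  l.flatMap fun q => ((0, q.1), true) :: q.2.map fun i =>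
    -- A finite table of the terminus of each edge keeps the map primitive recursive; the shift by
    -- one is due to first component `0` being reserved for edge letters.
    (((List.ofFn fun k => (M.vNum (M.eNum.symm k).2.1 : ℕ)).getD q.1 0 + 1, i.1), i.2)

/-- The word in the generators of the fundamental group for a path code. -/
def flat (v₀ : Γ.V) (P : PathCode) : LWord := M.emb v₀ P.1 ++ M.tailWord P.2

theorem tailWord_cons (e : Γ.Edge) (W : GWord) (l : List (ℕ × GWord)) :
    M.tailWord (((M.eNum e : ℕ), W) :: l) =
      M.edgeWord e.2.2 ++ (M.emb e.2.1 W ++ M.tailWord l) := by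
  have : (List.ofFn fun k => (M.vNum (M.eNum.symm k).2.1 : ℕ)).getD (M.eNum e) 0 =
      M.vNum e.2.1 := by
    rw [List.getD_eq_getElem _ _ (by simp), List.getElem_ofFn, Fin.eta, M.eNum.symm_apply_apply]
  rw [tailWord, List.flatMap_cons]
  dsimp only
  rw [this]
  simp [tailWord, edgeWord, emb]

theorem primrec_tailWord : Primrec M.tailWord := by
  let T := List.ofFn fun k => (M.vNum (M.eNum.symm k).2.1 : ℕ)
  have h1 : Primrec fun x : (List (ℕ × GWord) × ℕ × GWord) × ℕ × Bool =>
      ((T.getD x.1.2.1 0 + 1, x.2.1), x.2.2) :=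
    Primrec.pair (Primrec.pair (Primrec.succ.comp ((Primrec.list_getD 0).comp (Primrec.const T)
      (Primrec.fst.comp (Primrec.snd.comp Primrec.fst)))) (Primrec.fst.comp Primrec.snd))
      (Primrec.snd.comp Primrec.snd)
  have h2 : Primrec fun x : List (ℕ × GWord) × ℕ × GWord => (((0 : ℕ), x.2.1), true) :=
    ((Primrec.const 0).pair (Primrec.fst.comp Primrec.snd)).pair (Primrec.const true)
  have h3 : Primrec fun x : List (ℕ × GWord) × ℕ × GWord =>
      ((0, x.2.1), true) :: x.2.2.map fun i => ((T.getD x.2.1 0 + 1, i.1), i.2) :=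
    Primrec.list_cons.comp h2 (Primrec.list_map (Primrec.snd.comp Primrec.snd) h1.to₂)
  exact Primrec.list_flatMap Primrec.id h3.to₂

theorem primrec_flat (v₀ : Γ.V) : Primrec (M.flat v₀) :=
  Primrec.list_append.comp ((M.primrec_emb v₀).comp Primrec.fst)
    (M.primrec_tailWord.comp Primrec.snd)

theorem computable_map_flat (v₀ : Γ.V) :
    Computable fun z : List PathCode × PathCode => z.1.map (M.flat v₀) :=
  (Primrec.list_map Primrec.fst ((M.primrec_flat v₀).comp Primrec.snd).to₂).to_comp

variable {M}

theorem Describes.val_eq {a b : Γ.V} {P : PathCode} {p : A.Path a b} (h : M.Describes P p) :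
    M.val τ (M.flat a P) = toLoop τ p := by
  induction h with
  | @single a W =>
    rw [toLoop_single, ← M.val_emb]
    simp [flat, tailWord]
  | @cons a b c W W' e l p _ ih =>
    rw [flat, tailWord_cons M ⟨a, b, e⟩, M.val_append, M.val_append, toLoop_cons, M.val_emb,
      M.val_edgeWord, mul_assoc, ← ih, flat]

theorem DescribesElt.val_eq (hτ : τ v₀ = Path.single 1) {P : PathCode} {g : A.π₁ v₀}
    (h : M.DescribesElt P g) : M.val τ (M.flat v₀ P) = g := by
  obtain ⟨p, hp, rfl⟩ := h
  rw [hp.val_eq, cls_eq_toLoop τ hτ]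

/-- A code describes at most one element, namely the value of its word, so the two generating sets
agree. -/
theorem wordSpan_map_flat (hτ : τ v₀ = Path.single 1) {X : List PathCode}
    (hX : ∀ Q ∈ X, ∃ h : A.π₁ v₀, M.DescribesElt Q h) :
    wordSpan (M.letterVal τ) (X.map (M.flat v₀)) =
      Subgroup.closure {h : A.π₁ v₀ | ∃ Q ∈ X, M.DescribesElt Q h} := by
  rw [wordSpan]
  congr 1
  ext g
  simp only [List.mem_map, Set.mem_ofPred_eq]
  constructor
  · rintro ⟨_, ⟨Q, hQ, rfl⟩, rfl⟩
    obtain ⟨h, hh⟩ := hX Q hQ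
    obtain rfl := hh.val_eq hτ
    exact ⟨Q, hQ, hh⟩
  · rintro ⟨Q, hQ, h⟩
    exact ⟨_, ⟨Q, hQ, rfl⟩, h.val_eq hτ⟩

end Marking

/-- Both kinds of answer are enumerable, and when no `y` exists a certificate does, so the search
always ends. That the answers exclude each other is a matter of foldedness and plays no role here.
-/
theorem Benign.exists_coset_algorithm (hA : Benign M) (hE : ∀ a : Γ.V, ∃ b, Nonempty (Γ.E a b))
    (hτ : τ v₀ = Path.single 1) :
    ∃ F : List LWord × LWord → GWord ⊕ AGraphCode, Computable F ∧ ∀ z,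
      (∃ W : GWord, F z = Sum.inl W ∧ (vertexHom τ v₀ (GWord.eval (M.vGens v₀) W))⁻¹ *
        M.val τ z.2 ∈ wordSpan (M.letterVal τ) z.1) ∨
      ∃ y : AGraphCode × List LWord, F z = Sum.inr y.1 ∧ M.IsCert τ z.1 z.2 y.1 y.2 := by
  have hG := hA.re_val_eq_one hE hτ
  refine RE.exists_computable (p := fun (z : List LWord × LWord) (s : GWord ⊕ AGraphCode) =>
    (∃ W : GWord, s = Sum.inl W ∧ (vertexHom τ v₀ (GWord.eval (M.vGens v₀) W))⁻¹ *
      M.val τ z.2 ∈ wordSpan (M.letterVal τ) z.1) ∨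
    ∃ y : AGraphCode × List LWord, s = Sum.inr y.1 ∧ M.IsCert τ z.1 z.2 y.1 y.2) ?_ fun z => ?_
  · refine RE.or (RE.ex (RE.and ?_ ?_)) (RE.ex (RE.and ?_ ?_))
    · exact RE.eq (by fun_prop) (Primrec.sumInl.to_comp.comp Computable.snd)
    · refine (RE.mem_wordSpan hG (f := fun x : ((List LWord × LWord) × (GWord ⊕ AGraphCode)) ×
        GWord => wordInv (M.emb v₀ x.2) ++ x.1.1.2) (X := fun x => x.1.1.1) (by fun_prop)
        (by fun_prop)).of_iff fun x => ?_
      rw [wordVal_append, wordVal_inv, ← M.val_emb]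
    · exact RE.eq (by fun_prop) (Primrec.sumInr.to_comp.comp (by fun_prop))
    · exact (Marking.re_isCert hA hG).comp (g := fun x : ((List LWord × LWord) ×
        (GWord ⊕ AGraphCode)) × AGraphCode × List LWord => (x.1.1, x.2)) (by fun_prop)
  · by_cases h : ∃ y : A.GV v₀, (vertexHom τ v₀ y)⁻¹ * M.val τ z.2 ∈
      wordSpan (M.letterVal τ) z.1
    · obtain ⟨y, hy⟩ := h
      exact ⟨_, .inl ⟨M.word y, rfl, by rwa [M.eval_word]⟩⟩
    · obtain ⟨C, γ, hC⟩ := exists_isCert hA hτ z.1 z.2 fun y hy => h ⟨y, hy⟩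
      exact ⟨_, .inr ⟨(C, γ), rfl, hC⟩⟩

theorem eq_lengthZero_of_isEmpty (hΓ : ∀ a b : Γ.V, IsEmpty (Γ.E a b)) {P : PathCode}
    {x : A.π₁ v₀} (h : M.DescribesElt P x) :
    A.lengthZero v₀ (GWord.eval (M.vGens v₀) P.1) = x := by
  obtain ⟨p, hp, rfl⟩ := h
  cases hp with
  | single W => rfl
  | cons W W' e => exact ((hΓ _ _).false e).elim

/-- The algorithm for words in the generators of the fundamental group. -/
theorem Benign.exists_word_algorithm (hA : Benign M) (hE : ∀ a : Γ.V, ∃ b, Nonempty (Γ.E a b))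
    (hτ : τ v₀ = Path.single 1) :
    ∃ F : List LWord × LWord → GWord ⊕ AGraphCode, Computable F ∧ ∀ X x,
      (∃ W : GWord, F (X, x) = Sum.inl W ∧ (A.lengthZero v₀ (GWord.eval (M.vGens v₀) W))⁻¹ *
        M.val τ x ∈ wordSpan (M.letterVal τ) X) ∨
      ((¬ ∃ y : A.GV v₀, (A.lengthZero v₀ y)⁻¹ * M.val τ x ∈ wordSpan (M.letterVal τ) X) ∧
        ∃ C : AGraphCode, F (X, x) = Sum.inr C ∧
          ∃ (𝔹 : AGraph A) (ux u0 : 𝔹.B.V) (hx : 𝔹.typ ux = v₀) (h0 : 𝔹.typ u0 = v₀),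
            M.DescribesAGraph C 𝔹 ux u0 ∧ 𝔹.IsFolded ∧ 𝔹.LAt v₀ ux u0 hx h0 =
              M.val τ x • (wordSpan (M.letterVal τ) X : Set (A.π₁ v₀)) ∧
            𝔹.LAt v₀ u0 ux h0 hx =
              (M.val τ x • (wordSpan (M.letterVal τ) X : Set (A.π₁ v₀)))⁻¹) := by
  have hl : ∀ y, A.lengthZero v₀ y = vertexHom τ v₀ y := fun y => cls_eq_toLoop τ hτ _
  simp only [hl]
  obtain ⟨F, hF, hF'⟩ := hA.exists_coset_algorithm hE hτ
  refine ⟨F, hF, fun X x => (hF' (X, x)).imp id ?_⟩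
  rintro ⟨⟨C, γ⟩, hC, hcert⟩
  obtain ⟨𝔹, ux, u0, hx, h0, hne, hd, hf, hL⟩ := hcert.exists_agraph
  refine ⟨?_, C, hC, 𝔹, ux, u0, hx, h0, hd, hf, ?_, ?_⟩
  -- A suitable `y` would lie in the coset read from `ux` to `u0`, and foldedness would force `ux =
  -- u0`.
  · rintro ⟨y, hy⟩
    refine hne (hf.eq_of_vertexHom_mem (τ := τ) (y := y) hx h0 ?_)
    rw [hL, mem_leftCoset_iff]
    have := inv_mem hy
    rwa [mul_inv_rev, inv_inv] at this
  · rw [AGraph.LAt_eq_loops _ _ hτ, hL]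
  · rw [AGraph.LAt_eq_loops _ _ hτ, AGraph.loops_swap, hL]

theorem Benign.exists_left_coset_algorithm (hA : Benign M) (v₀ : Γ.V) :
    ∃ F : List PathCode × PathCode → GWord ⊕ AGraphCode, Computable F ∧
    ∀ (X : List PathCode) (P : PathCode) (x : A.π₁ v₀) (H : Subgroup (A.π₁ v₀)),
      (∀ Q ∈ X, ∃ h : A.π₁ v₀, M.DescribesElt Q h) →
      H = Subgroup.closure {h | ∃ Q ∈ X, M.DescribesElt Q h} →
      M.DescribesElt P x →
      (∃ W : GWord, F (X, P) = Sum.inl W ∧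
        A.lengthZero v₀ (GWord.eval (M.vGens v₀) W) • (H : Set (A.π₁ v₀)) =
          x • (H : Set (A.π₁ v₀))) ∨
      ((¬ ∃ y : A.GV v₀,
          A.lengthZero v₀ y • (H : Set (A.π₁ v₀)) = x • (H : Set (A.π₁ v₀))) ∧
        ∃ C : AGraphCode, F (X, P) = Sum.inr C ∧
          ∃ (𝔹 : AGraph A) (ux u0 : 𝔹.B.V) (hx : 𝔹.typ ux = v₀) (h0 : 𝔹.typ u0 = v₀),
            M.DescribesAGraph C 𝔹 ux u0 ∧ 𝔹.IsFolded ∧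
            𝔹.LAt v₀ ux u0 hx h0 = x • (H : Set (A.π₁ v₀))) := by
  obtain ⟨τ, hτ⟩ := exists_tree_paths hA.connected A v₀
  -- Without edges the conditions say nothing about the vertex group, whose word problem may be
  -- undecidable. But every loop then has length zero, and the input word for `x` is itself an
  -- answer.
  by_cases hΓ : ∀ a b : Γ.V, IsEmpty (Γ.E a b)
  · exact ⟨fun z => Sum.inl z.2.1, Primrec.sumInl.to_comp.comp (by fun_prop),
      fun X P x H _ _ hP => .inl ⟨_, rfl, by rw [eq_lengthZero_of_isEmpty hΓ hP]⟩⟩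
  · simp only [not_forall, not_isEmpty_iff] at hΓ
    obtain ⟨a, b, ⟨e⟩⟩ := hΓ
    obtain ⟨F, hF, hF'⟩ := hA.exists_word_algorithm (hA.connected.exists_edge e) hτ
    refine ⟨fun z => F (z.1.map (M.flat v₀), M.flat v₀ z.2), hF.comp
      ((M.computable_map_flat v₀).pair ((M.primrec_flat v₀).to_comp.comp Computable.snd)),
      fun X P x H hX hH hP => ?_⟩
    rw [← Marking.wordSpan_map_flat hτ hX] at hH
    subst hH
    simp only [leftCoset_eq_iff]
    have := hF' (X.map (M.flat v₀)) (M.flat v₀ P)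
    rw [hP.val_eq hτ] at this
    refine this.imp id (And.imp_right ?_)
    rintro ⟨C, hC, 𝔹, ux, u0, hx, h0, hd, hf, hL, -⟩
    exact ⟨C, hC, 𝔹, ux, u0, hx, h0, hd, hf, hL⟩

/-- Since `Hx = (x⁻¹H)⁻¹`, the search is run on `x⁻¹`; a length-zero answer is inverted, and a graph
is kept unchanged with its paths read backwards. -/
theorem Benign.exists_right_coset_algorithm (hA : Benign M) (v₀ : Γ.V) :
    ∃ F : List PathCode × PathCode → GWord ⊕ AGraphCode, Computable F ∧
    ∀ (X : List PathCode) (P : PathCode) (x : A.π₁ v₀) (H : Subgroup (A.π₁ v₀)),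
      (∀ Q ∈ X, ∃ h : A.π₁ v₀, M.DescribesElt Q h) →
      H = Subgroup.closure {h | ∃ Q ∈ X, M.DescribesElt Q h} →
      M.DescribesElt P x →
      (∃ W : GWord, F (X, P) = Sum.inl W ∧
        MulOpposite.op (A.lengthZero v₀ (GWord.eval (M.vGens v₀) W)) • (H : Set (A.π₁ v₀)) =
          MulOpposite.op x • (H : Set (A.π₁ v₀))) ∨
      ((¬ ∃ y : A.GV v₀,
          MulOpposite.op (A.lengthZero v₀ y) • (H : Set (A.π₁ v₀)) =
            MulOpposite.op x • (H : Set (A.π₁ v₀))) ∧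
        ∃ C : AGraphCode, F (X, P) = Sum.inr C ∧
          ∃ (𝔹 : AGraph A) (ux u0 : 𝔹.B.V) (hx : 𝔹.typ ux = v₀) (h0 : 𝔹.typ u0 = v₀),
            M.DescribesAGraph C 𝔹 ux u0 ∧ 𝔹.IsFolded ∧
            𝔹.LAt v₀ u0 ux h0 hx = MulOpposite.op x • (H : Set (A.π₁ v₀))) := by
  obtain ⟨τ, hτ⟩ := exists_tree_paths hA.connected A v₀
  by_cases hΓ : ∀ a b : Γ.V, IsEmpty (Γ.E a b)
  · exact ⟨fun z => Sum.inl z.2.1, Primrec.sumInl.to_comp.comp (by fun_prop),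
      fun X P x H _ _ hP => .inl ⟨_, rfl, by rw [eq_lengthZero_of_isEmpty hΓ hP]⟩⟩
  · simp only [not_forall, not_isEmpty_iff] at hΓ
    obtain ⟨a, b, ⟨e⟩⟩ := hΓ
    obtain ⟨F, hF, hF'⟩ := hA.exists_word_algorithm (hA.connected.exists_edge e) hτ
    have hl : ∀ (H : Subgroup (A.π₁ v₀)) (x : A.π₁ v₀) (y : A.GV v₀),
        (A.lengthZero v₀ y)⁻¹ * x⁻¹ ∈ H ↔ x * (A.lengthZero v₀ y⁻¹)⁻¹ ∈ H := by
      intro H x y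
      have : A.lengthZero v₀ y⁻¹ = (A.lengthZero v₀ y)⁻¹ := rfl
      rw [this, inv_inv, ← inv_mem_iff, mul_inv_rev, inv_inv, inv_inv]
    refine ⟨fun z => (F (z.1.map (M.flat v₀), wordInv (M.flat v₀ z.2))).map wordInv id, ?_,
      fun X P x H hX hH hP => ?_⟩
    · have hin := (M.computable_map_flat v₀).pair (Computable.fun_wordInv
        ((M.primrec_flat v₀).to_comp.comp (Computable.snd (α := List PathCode))))
      refine (Computable.sumCasesOn (hF.comp hin) (Primrec.sumInl.comp (Primrec.wordInv.comp
        Primrec.snd)).to_comp.to₂ (Primrec.sumInr.comp Primrec.snd).to_comp.to₂).of_eq fun z => ?_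
      generalize F (z.1.map (M.flat v₀), wordInv (M.flat v₀ z.2)) = s
      cases s <;> rfl
    rw [← Marking.wordSpan_map_flat hτ hX] at hH
    subst hH
    simp only [rightCoset_eq_iff]
    have := hF' (X.map (M.flat v₀)) (wordInv (M.flat v₀ P))
    rw [M.val_inv, hP.val_eq hτ] at this
    refine this.imp ?_ (And.imp ?_ ?_)
    · rintro ⟨W, hW, h⟩
      refine ⟨wordInv W, by rw [hW]; rfl, ?_⟩
      rw [hl] at h
      rwa [GWord.eval_eq_wordVal, wordVal_inv]
    · rintro h ⟨y, hy⟩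
      exact h ⟨y⁻¹, by rwa [hl, inv_inv]⟩
    · rintro ⟨C, hC, 𝔹, ux, u0, hx, h0, hd, hf, -, hL⟩
      refine ⟨C, by rw [hC]; rfl, 𝔹, ux, u0, hx, h0, hd, hf, hL.trans ?_⟩
      ext g
      rw [Set.mem_inv, mem_leftCoset_iff, mem_rightCoset_iff, inv_inv, SetLike.mem_coe,
        SetLike.mem_coe, ← inv_mem_iff, mul_inv_rev, inv_inv]

end GraphOfGroups

theorem mainTheorem11 {Γ : SerreGraph.{u}} (A : GraphOfGroups.{u, v, w} Γ) (M : A.Marking)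
    (hA : GraphOfGroups.Benign M) (v₀ : Γ.V) :
    -- left cosets
    (∃ F : List PathCode × PathCode → GWord ⊕ AGraphCode, Computable F ∧
      ∀ (X : List PathCode) (P : PathCode) (x : A.π₁ v₀) (H : Subgroup (A.π₁ v₀)),
        (∀ Q ∈ X, ∃ h : A.π₁ v₀, M.DescribesElt Q h) →
        H = Subgroup.closure {h | ∃ Q ∈ X, M.DescribesElt Q h} →
        M.DescribesElt P x →
        (∃ W : GWord, F (X, P) = Sum.inl W ∧
          A.lengthZero v₀ (GWord.eval (M.vGens v₀) W) • (H : Set (A.π₁ v₀)) =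
            x • (H : Set (A.π₁ v₀))) ∨
        ((¬ ∃ y : A.GV v₀,
            A.lengthZero v₀ y • (H : Set (A.π₁ v₀)) = x • (H : Set (A.π₁ v₀))) ∧
          ∃ C : AGraphCode, F (X, P) = Sum.inr C ∧
            ∃ (𝔹 : AGraph A) (ux u0 : 𝔹.B.V) (hx : 𝔹.typ ux = v₀) (h0 : 𝔹.typ u0 = v₀),
              M.DescribesAGraph C 𝔹 ux u0 ∧ 𝔹.IsFolded ∧
              𝔹.LAt v₀ ux u0 hx h0 = x • (H : Set (A.π₁ v₀)))) ∧
    -- right cosets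
    (∃ F : List PathCode × PathCode → GWord ⊕ AGraphCode, Computable F ∧
      ∀ (X : List PathCode) (P : PathCode) (x : A.π₁ v₀) (H : Subgroup (A.π₁ v₀)),
        (∀ Q ∈ X, ∃ h : A.π₁ v₀, M.DescribesElt Q h) →
        H = Subgroup.closure {h | ∃ Q ∈ X, M.DescribesElt Q h} →
        M.DescribesElt P x →
        (∃ W : GWord, F (X, P) = Sum.inl W ∧
          MulOpposite.op (A.lengthZero v₀ (GWord.eval (M.vGens v₀) W)) • (H : Set (A.π₁ v₀)) =
            MulOpposite.op x • (H : Set (A.π₁ v₀))) ∨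
        ((¬ ∃ y : A.GV v₀,
            MulOpposite.op (A.lengthZero v₀ y) • (H : Set (A.π₁ v₀)) =
              MulOpposite.op x • (H : Set (A.π₁ v₀))) ∧
          ∃ C : AGraphCode, F (X, P) = Sum.inr C ∧
            ∃ (𝔹 : AGraph A) (ux u0 : 𝔹.B.V) (hx : 𝔹.typ ux = v₀) (h0 : 𝔹.typ u0 = v₀),
              M.DescribesAGraph C 𝔹 ux u0 ∧ 𝔹.IsFolded ∧
              𝔹.LAt v₀ u0 ux h0 hx = MulOpposite.op x • (H : Set (A.π₁ v₀)))) :=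
  ⟨hA.exists_left_coset_algorithm v₀, hA.exists_right_coset_algorithm v₀⟩
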